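/- Let $A=\mathbb{C}[X_1,\dots,X_n]$, let $f\in A$ be squarefree of degree $d\ge 3$, and suppose that the hypersurface $\{f=0\}\subset\mathbb{C}^n$ is smooth, i.e. $f,\partial_1f,\dots,\partial_nf$ have no common zero in $\mathbb{C}^n$. Let $B=A/(f)$ and let $\hat A=\varprojlim_\nu A/(f^\nu)$ be the completion of $A$ along $(f)$, with its projection $\pi\colon\hat A\to B$. For $b\in B$ let $\deg b$ be the least degree of a polynomial representing $b$ (with $\deg 0:=0$). For $y\in\hat A$ write $\deg_\nu y\le\delta_\nu$ if $y=\sum_{\nu\ge 0} c_\nu f^\nu$ for some polynomials $c_\nu\in A$ with $\deg c_\nu\le\delta_\nu$ for all $\nu$. (1) There is an injective homomorphism of $\mathbb{C}$-algebras $\psi\colon B\to\hat A$ such that $$\pi\circ\psi=\mathrm{id}_B\quad\text{and}\quad \deg_\nu\psi(\overline{X}_i)\le d^\nu(2d^{n-1}+1)\quad(1\le i\le n).\qquad(*)$$ (2) For every homomorphism of $\mathbb{C}$-algebras $\psi\colon B\to\hat A$ that satisfies $(*)$, the map $$\hat\psi\colon B[[T]]\to\hat A,\qquad \sum_\nu b_\nu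 T^\nu\mapsto\sum_\nu\psi(b_\nu)f^\nu,$$ is an isomorphism of rings, and for every polynomial $a\in A$ the coefficients $b_\nu\in B$ of $\hat\psi^{-1}(a)=\sum_\nu b_\nu T^\nu$ satisfy $$\deg b_\nu\le(2d^n+d)^\nu\cdot\deg a\quad\text{for all }\nu\ge 0.$$ -/

import Mathlib

namespace HypersurfaceCompletion

/-- The coordinate ring `B = ℂ[X₁,…,Xₙ]/(f)`. -/
abbrev CoordRing {n : ℕ} (f : MvPolynomial (Fin n) ℂ) : Type :=
  MvPolynomial (Fin n) ℂ ⧸ Ideal.span {f}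

/-- The completion `Â` of `A = ℂ[X₁,…,Xₙ]` along `(f)`, i.e. the inverse limit of the
rings `A/(f)^N`. -/
abbrev Completion {n : ℕ} (f : MvPolynomial (Fin n) ℂ) : Type :=
  AdicCompletion (Ideal.span {f}) (MvPolynomial (Fin n) ℂ)

/-- Smoothness of the hypersurface with reduced equation `f`: the polynomial and its partial
derivatives have no common zero in `ℂⁿ`. -/
def IsSmoothHypersurface {n : ℕ} (f : MvPolynomial (Fin n) ℂ) : Prop :=
  ∀ x : Fin n → ℂ, MvPolynomial.eval x f = 0 →
    ∃ i : Fin n, MvPolynomial.eval x (MvPolynomial.pderiv i f) ≠ 0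

/-- The degree of a residue class: the least degree of a polynomial representing it
(the zero class has degree `0`). -/
noncomputable def classDegree {n : ℕ} (f : MvPolynomial (Fin n) ℂ) (b : CoordRing f) : ℕ :=
  sInf {m : ℕ | ∃ g : MvPolynomial (Fin n) ℂ,
    Ideal.Quotient.mk (Ideal.span {f}) g = b ∧ g.totalDegree = m}

/-- `y = ∑_ν x_ν f^ν` in the completion: modulo `(f)^N`, only the terms with `ν < N` matter,
and for every `N` their sum agrees with `y`. -/
def HasAdicSum {n : ℕ} (f : MvPolynomial (Fin n) ℂ) (x : ℕ → Completion f)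
    (y : Completion f) : Prop :=
  ∀ N : ℕ, AdicCompletion.evalₐ (Ideal.span {f}) N y =
    AdicCompletion.evalₐ (Ideal.span {f}) N
      (∑ ν ∈ Finset.range N,
        x ν * (algebraMap (MvPolynomial (Fin n) ℂ) (Completion f) f) ^ ν)

/-- `deg_ν y ≤ δ_ν`: there are polynomials `c_ν` of degree at most `δ_ν`
with `y = ∑_ν c_ν f^ν`. -/
def HasDegreeBound {n : ℕ} (f : MvPolynomial (Fin n) ℂ) (y : Completion f)
    (δ : ℕ → ℕ) : Prop :=
  ∃ c : ℕ → MvPolynomial (Fin n) ℂ,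
    HasAdicSum f (fun ν => algebraMap (MvPolynomial (Fin n) ℂ) (Completion f) (c ν)) y ∧
    ∀ ν, (c ν).totalDegree ≤ δ ν

/-- `ψ : B → Â` is a lift of the identity of `B` whose values on the coordinate functions obey
`deg_ν ψ(X̄_i) ≤ d^ν (2 d^(n-1) + 1)`, where `d = deg f`. Reducing `ψ` modulo `(f)^ν` for
`ν = 1, 2, …` gives a sequence of algebra maps `B → A/(f)^ν`, starting with the identity of `B`,
each of which lifts the preceding one. -/
structure IsBoundedLift {n : ℕ} (f : MvPolynomial (Fin n) ℂ)
    (ψ : CoordRing f →ₐ[ℂ] Completion f) : Prop where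
  lifts_id : ∀ b : CoordRing f, AdicCompletion.evalOneₐ (Ideal.span {f}) (ψ b) = b
  degree_le : ∀ i : Fin n,
    HasDegreeBound f (ψ (Ideal.Quotient.mk (Ideal.span {f}) (MvPolynomial.X i)))
      (fun ν => f.totalDegree ^ ν * (2 * f.totalDegree ^ (n - 1) + 1))

end HypersurfaceCompletion

/-!
Write `A = ℂ[X₁, …, Xₙ]`, `B = A/(f)` and `d = deg f`, and let `Â` be the completion along `(f)`.

*Effective Nullstellensatz.* Smoothness means that `1` is a combination of the partial derivatives
modulo `f`. The proof rests on a representation `∑ g_i ∂_i f = 1 + h f` with `deg g_i ≤ 2 dⁿ - d`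
(`IsSmoothHypersurface.exists_sum_pderiv_sub_one`). For `n = m + 1 ≥ 2` choose general linear
combinations `F_1, …, F_m` of the partial derivatives, so that `f = F_1 = ⋯ = F_m = 0` has finitely
many solutions (`exists_combinations_height`, `finite_zeros_of_le_height`). For a general linear
form `l` there is an eliminant: a polynomial `φ` of degree at most `dⁿ` in one variable, with roots
among the values of `l` at the solutions, such that `φ(l)` is modulo `f` a combination of the `F_i`
in which all summands have degree at most `dⁿ` (`exists_eliminant`). To find it for an irreducible
`f`, adjoin a variable `z` to `B`. By Noether normalization (`exists_translates_isIntegral`) `B` is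
integral over the algebra generated by `l` and elements `F_i z + l'_i` with linear forms `l'_i`.
These are algebraically independent, and `z` satisfies a single irreducible relation `W` over
them. Comparing the dimensions of spaces of polynomials of bounded degree shows that the weighted
degree of `W` is at most `dⁿ` (`card_weightSet_le`, `le_mul_pow_of_simplexCard_le`). The leading
coefficient of `W` in `z` is a polynomial `φ(l)`, as `z` becomes integral after multiplication by a
polynomial in `l`, and the coefficient of the highest power of `z` in the relation is the required
congruence for `φ(l)`. For a reducible `f` the eliminants of the irreducible factors are
multiplied. A second general system has other solutions, so its eliminant is coprime to
the first one if `l` separates the two sets of solutions; a Bézout relation between the two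
eliminants represents `1`.

*The lift.* The point `X` is moved along the direction `g`: the equation `f(X - g s) = 0` reads
`f - (1 + h f) s + s² q(s) = 0`. With `f` replaced by `T` where it acts as the small parameter, it
is solved by a power series `s` in `T` without constant term, by iteration, and the degrees of the
coefficients of `s` grow at most linearly (`exists_newton_series`). Substituting `f` for `T` turns
the coordinates of `X - g s` into elements of `Â` on which `f` vanishes, so they define
`ψ : B → Â` (`IsSmoothHypersurface.exists_isBoundedLift`); linear growth stays below the exponential
bounds required of `ψ`.

*Expansions.* As `ψ` lifts the identity of `B`, each `y ∈ Â` determines successively the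
coefficients of its expansion `∑ ψ(b_ν) f^ν`: the class `b_0` of `y` modulo `f`, then that of
`(y - ψ(b_0)) / f`, and so on (`adicEval_bijective`). If `y = ∑ c_ν f^ν` with polynomials
`c_ν` of degree at most `m d^ν`, then `b_0` is represented by `c_0`, and `(y - ψ(b_0)) / f` has
an expansion of the same kind with `m` multiplied by `d (2 d^(n-1) + 1) = 2 dⁿ + d`
(`exists_mk_eq_coeff_totalDegree_le`). For a polynomial `y` one starts from `m = deg y`.
-/


namespace HypersurfaceCompletion

open MvPolynomial

/-! ### Noether normalization by general linear forms -/

section NoetherNormalization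

variable {k : Type*} [Field k] {S : Type*} [CommRing S] [Algebra k S]

theorem coeff_prod_sum_of_natDegree_le {ι R : Type*} [CommSemiring R] (s : Finset ι)
    (p : ι → Polynomial R) (m : ι → ℕ) (h : ∀ i ∈ s, (p i).natDegree ≤ m i) :
    (∏ i ∈ s, p i).coeff (∑ i ∈ s, m i) = ∏ i ∈ s, (p i).coeff (m i) := by
  classical
  induction s using Finset.induction_on with
  | empty => simp
  | insert i s hi ih =>
    rw [Finset.prod_insert hi, Finset.sum_insert hi, Finset.prod_insert hi,
      Polynomial.coeff_mul_add_eq_of_natDegree_le (h i (Finset.mem_insert_self _ _)), ih]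
    · exact fun j hj => h j (Finset.mem_insert_of_mem hj)
    · exact (Polynomial.natDegree_prod_le _ _).trans
        (Finset.sum_le_sum fun j hj => h j (Finset.mem_insert_of_mem hj))

/-- The substitution of `a_t + b_t X` for the variables turns a polynomial `F` of degree at most `N`
into a polynomial in `X` of degree at most `N`, with the value at `b` of the homogeneous part of
degree `N` as coefficient of `X ^ N`. -/
theorem natDegree_aeval_add_le_and_coeff {τ : Type*} (a : τ → S) (b : τ → k) (N : ℕ)
    (F : MvPolynomial τ k) (hF : F.totalDegree ≤ N) :
    (aeval (fun t => Polynomial.C (a t) + Polynomial.C (algebraMap k S (b t)) * Polynomial.X) F :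
        Polynomial S).natDegree ≤ N ∧
    (aeval (fun t => Polynomial.C (a t) + Polynomial.C (algebraMap k S (b t)) * Polynomial.X) F :
        Polynomial S).coeff N = algebraMap k S (eval b (homogeneousComponent N F)) := by
  classical
  have key : ∀ s : τ →₀ ℕ, s.degree ≤ N → ∀ c : k,
      (aeval (fun t => Polynomial.C (a t) + Polynomial.C (algebraMap k S (b t)) * Polynomial.X)
        (monomial s c) : Polynomial S).natDegree ≤ s.degree ∧
      (aeval (fun t => Polynomial.C (a t) + Polynomial.C (algebraMap k S (b t)) * Polynomial.X)
        (monomial s c) : Polynomial S).coeff s.degree = algebraMap k S (eval b (monomial s c)) := by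
    intro s _ c
    rw [aeval_monomial, Finsupp.prod, eval_monomial, Finsupp.prod]
    have h1 : ∀ t ∈ s.support, ((Polynomial.C (a t) +
        Polynomial.C (algebraMap k S (b t)) * Polynomial.X) ^ s t).natDegree ≤ s t := by
      intro t _
      refine (Polynomial.natDegree_pow_le_of_le (m := 1) _ ?_).trans (by simp)
      compute_degree
    have h2 : (∏ t ∈ s.support, (Polynomial.C (a t) +
        Polynomial.C (algebraMap k S (b t)) * Polynomial.X) ^ s t).natDegree ≤ s.degree := by
      rw [Finsupp.degree_apply]
      exact (Polynomial.natDegree_prod_le _ _).trans (Finset.sum_le_sum h1)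
    have h3 : (∏ t ∈ s.support, (Polynomial.C (a t) +
        Polynomial.C (algebraMap k S (b t)) * Polynomial.X) ^ s t).coeff s.degree =
        ∏ t ∈ s.support, (algebraMap k S (b t)) ^ s t := by
      rw [Finsupp.degree_apply, coeff_prod_sum_of_natDegree_le _ _ _ h1]
      refine Finset.prod_congr rfl fun t _ => ?_
      have := Polynomial.coeff_pow_of_natDegree_le (p := Polynomial.C (a t) +
        Polynomial.C (algebraMap k S (b t)) * Polynomial.X) (m := s t) (n := 1)
        (by compute_degree)
      simpa using this
    rw [Polynomial.algebraMap_apply]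
    constructor
    · exact (Polynomial.natDegree_C_mul_le _ _).trans h2
    · rw [Polynomial.coeff_C_mul, h3]
      simp
  have hsum : aeval (fun t => Polynomial.C (a t) +
      Polynomial.C (algebraMap k S (b t)) * Polynomial.X) F =
      ∑ s ∈ F.support, aeval (fun t => Polynomial.C (a t) +
        Polynomial.C (algebraMap k S (b t)) * Polynomial.X) (monomial s (coeff s F)) := by
    conv_lhs => rw [F.as_sum]
    rw [map_sum]
  have hdeg : ∀ s ∈ F.support, s.degree ≤ N := fun s hs =>
    (le_totalDegree hs).trans hF
  constructor
  · rw [hsum]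
    exact Polynomial.natDegree_sum_le_of_forall_le _ _
      fun s hs => ((key s (hdeg s hs) _).1).trans (hdeg s hs)
  · rw [hsum, Polynomial.finsetSum_coeff, homogeneousComponent_apply, map_sum, map_sum,
      Finset.sum_filter]
    refine Finset.sum_congr rfl fun s hs => ?_
    split_ifs with h
    · rw [← h]; exact (key s (hdeg s hs) _).2
    · exact Polynomial.coeff_eq_zero_of_natDegree_lt
        (lt_of_le_of_lt (key s (hdeg s hs) _).1 (lt_of_le_of_ne (hdeg s hs) h))

/-- A relation `F (v) = 0` whose top form does not vanish at `b` makes `v_none` integral over the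
algebra generated by the `v_t - b_t v_none`: in terms of these it is, up to a constant factor, monic
in `v_none`. -/
theorem isIntegral_of_aeval_eq_zero {τ : Type*} (v : Option τ → S) (b : Option τ → k)
    (hb : b none = 1) (F : MvPolynomial (Option τ) k) (hF : aeval v F = 0)
    (htop : eval b (homogeneousComponent F.totalDegree F) ≠ 0) :
    IsIntegral (Algebra.adjoin k (Set.range fun t : τ => v (some t) - b (some t) • v none))
      (v none) := by
  set R := Algebra.adjoin k (Set.range fun t : τ => v (some t) - b (some t) • v none) with hR
  let a : Option τ → R := fun o => o.elim 0 fun t =>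
    ⟨v (some t) - b (some t) • v none, Algebra.subset_adjoin ⟨t, rfl⟩⟩
  obtain ⟨h1, h2⟩ := natDegree_aeval_add_le_and_coeff a b F.totalDegree F le_rfl
  set P : Polynomial R := aeval (fun t => Polynomial.C (a t) +
    Polynomial.C (algebraMap k R (b t)) * Polynomial.X) F with hP
  have hval : Polynomial.aeval (v none) P = 0 := by
    have : ((Polynomial.aeval (v none) : Polynomial R →ₐ[R] S).restrictScalars k).comp
        (aeval (fun t => Polynomial.C (a t) +
          Polynomial.C (algebraMap k R (b t)) * Polynomial.X)) = aeval v := by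
      ext o
      rcases o with _ | t
      · simp [a, hb]
      · simp only [AlgHom.comp_apply, aeval_X, AlgHom.restrictScalars_apply, map_add, map_mul,
          Polynomial.aeval_C, Polynomial.aeval_X, a, Option.elim]
        rw [← IsScalarTower.algebraMap_apply k R S]
        simp [Algebra.smul_def]
    have h := DFunLike.congr_fun this F
    simpa [hF] using h
  set c := eval b (homogeneousComponent F.totalDegree F)
  refine ⟨Polynomial.C (algebraMap k R c⁻¹) * P, ?_, ?_⟩
  · refine Polynomial.monic_of_natDegree_le_of_coeff_eq_one F.totalDegree
      ((Polynomial.natDegree_C_mul_le _ _).trans h1) ?_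
    rw [Polynomial.coeff_C_mul, h2, ← map_mul, inv_mul_cancel₀ htop, map_one]
  · have := congrArg (fun s => algebraMap R S (algebraMap k R c⁻¹) * s) hval
    simpa [Polynomial.aeval_def] using this

/-- Both the top form of `F` and `L` are homogeneous, so a point where neither vanishes may be
scaled to have first coordinate `1`. -/
theorem exists_eval_eq_one_and_eval_homogeneousComponent_ne_zero [Infinite k] {τ : Type*}
    (F : MvPolynomial (Option τ) k) (hF : F ≠ 0) (L : MvPolynomial (Option τ) k) (N : ℕ)
    (hL : L.IsHomogeneous N) (hL0 : L ≠ 0) :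
    ∃ b : Option τ → k, b none = 1 ∧ eval b (homogeneousComponent F.totalDegree F) ≠ 0 ∧
      eval b L ≠ 0 := by
  have htop : homogeneousComponent F.totalDegree F ≠ 0 := by
    intro h
    obtain ⟨s, hs, hsd⟩ := Finset.exists_mem_eq_sup F.support (support_nonempty.mpr hF)
      (fun s => s.sum fun _ e => e)
    have h2 : coeff s (homogeneousComponent F.totalDegree F) = coeff s F := by
      rw [coeff_homogeneousComponent, if_pos]
      exact hsd.symm
    rw [h, coeff_zero] at h2
    exact (mem_support_iff.mp hs) h2.symm
  have hne : homogeneousComponent F.totalDegree F * L * X none ≠ 0 :=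
    mul_ne_zero (mul_ne_zero htop hL0) (X_ne_zero _)
  obtain ⟨b, hb⟩ : ∃ b : Option τ → k,
      eval b (homogeneousComponent F.totalDegree F * L * X none) ≠ 0 := by
    by_contra! h
    exact hne (MvPolynomial.funext (by simpa using h))
  rw [map_mul, map_mul, eval_X] at hb
  have hb0 : b none ≠ 0 := right_ne_zero_of_mul hb
  have hb1 := left_ne_zero_of_mul (left_ne_zero_of_mul hb)
  have hb2 := right_ne_zero_of_mul (left_ne_zero_of_mul hb)
  have hscale : ∀ (G : MvPolynomial (Option τ) k) (N : ℕ), G.IsHomogeneous N → eval b G ≠ 0 →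
      eval (fun t => (b none)⁻¹ * b t) G ≠ 0 := by
    intro G N hG hG0
    have : eval (fun t => (b none)⁻¹ * b t) G = (b none)⁻¹ ^ N * eval b G := by
      rw [eval_eq, eval_eq, Finset.mul_sum]
      refine Finset.sum_congr rfl fun s hs => ?_
      have hs' : s.degree = N := by
        rw [Finsupp.degree_eq_weight_one]; exact hG (mem_support_iff.mp hs)
      simp only [mul_pow, Finset.prod_mul_distrib, Finset.prod_pow_eq_pow_sum]
      rw [show ∑ i ∈ s.support, s i = N from (Finsupp.degree_apply s).symm.trans hs']
      ring
    rw [this]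
    exact mul_ne_zero (pow_ne_zero _ (inv_ne_zero hb0)) hG0
  exact ⟨fun t => (b none)⁻¹ * b t, by simp [hb0],
    hscale _ _ (homogeneousComponent_isHomogeneous _ _) hb1, hscale _ _ hL hb2⟩

/-- The linear combination `∑ c_j x_j` (at `none`) and the translates `y_i + ∑ e_ij x_j`. -/
def translates {ι κ : Type*} [Fintype κ] (x : κ → S) (y : ι → S) (c : κ → k) (e : ι → κ → k) :
    Option ι → S :=
  fun o => o.elim (∑ j, c j • x j) fun i => y i + ∑ j, e i j • x j

/-- Generic linear Noether normalization. If no `card ι + 2` elements are algebraically independent,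
then the `x_j` are integral over the algebra generated by one linear combination `∑ c_j x_j` and by
translates `y_i + ∑ e_ij x_j` of given elements, and `∑ c_j x_j` can be chosen to be nonzero on
finitely many prescribed vectors. In each step a relation among the last `x_j`, the first `x_j` and
the `y_i` is used to eliminate the last `x_j`. -/
theorem exists_translates_isIntegral [Infinite k] {ι : Type*} (K : ℕ) (x : Fin (K + 1) → S)
    (y : ι → S) (hdep : ∀ v : Option (Option ι) → S, ¬ AlgebraicIndependent k v)
    (V : Finset (Fin (K + 1) → k)) (hV : 0 ∉ V) :
    ∃ (c : Fin (K + 1) → k) (e : ι → Fin (K + 1) → k), (∀ v ∈ V, ∑ j, c j * v j ≠ 0) ∧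
      ∀ j, IsIntegral (Algebra.adjoin k (Set.range (translates x y c e))) (x j) := by
  classical
  induction K generalizing y with
  | zero =>
    refine ⟨fun _ => 1, 0, fun v hv h0 => hV ?_, fun j => ?_⟩
    · have : v = 0 := by
        ext j; rw [Fin.fin_one_eq_zero j]; simpa using h0
      rwa [← this]
    · have hj : x j ∈ Algebra.adjoin k (Set.range (translates x y (fun _ => (1 : k)) 0)) :=
        Algebra.subset_adjoin ⟨none, by simp [translates, Fin.fin_one_eq_zero j]⟩
      exact isIntegral_algebraMap (R := Algebra.adjoin k
        (Set.range (translates x y (fun _ => (1 : k)) 0))) (x := ⟨x j, hj⟩)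
  | succ K ih =>
    -- `x_last` is eliminated by a relation among `x_last`, `x_0` and the `y_i`.
    let v : Option (Option ι) → S := fun o => o.elim (x (Fin.last _)) fun o' => o'.elim (x 0) y
    obtain ⟨F, hF, hF0⟩ : ∃ F : MvPolynomial (Option (Option ι)) k, aeval v F = 0 ∧ F ≠ 0 := by
      by_contra! h
      exact hdep v ((injective_iff_map_eq_zero _).mpr h)
    -- `L` vanishes at `b` if the elimination maps a vector of `V` to one with first entry `0`; the
    -- vectors outside `W`, for which this cannot be avoided, keep their remaining entries.
    let W := V.filter fun u => ¬ (u 0 = 0 ∧ u (Fin.last _) = 0)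
    let L : MvPolynomial (Option (Option ι)) k :=
      ∏ u ∈ W, (C (u 0) * X none - C (u (Fin.last _)) * X (some none))
    have hL : L.IsHomogeneous (∑ u ∈ W, 1) := by
      refine IsHomogeneous.prod _ _ _ fun u _ => IsHomogeneous.sub ?_ ?_ <;>
        exact isHomogeneous_C_mul_X _ _
    have hL0 : L ≠ 0 := by
      refine Finset.prod_ne_zero_iff.mpr fun u hu h0 => ?_
      refine (Finset.mem_filter.mp hu).2 ⟨?_, ?_⟩
      · simpa using congrArg (eval fun o : Option (Option ι) => if o = none then (1 : k) else 0) h0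
      · simpa using congrArg
          (eval fun o : Option (Option ι) => if o = some none then (1 : k) else 0) h0
    obtain ⟨b, hb, hbF, hbL⟩ :=
      exists_eval_eq_one_and_eval_homogeneousComponent_ne_zero F hF0 L _ hL hL0
    have hint := isIntegral_of_aeval_eq_zero v b hb F hF hbF
    set γ : Fin (K + 1) → k := fun j => if j = 0 then b (some none) else 0 with hγ
    set η : ι → k := fun i => b (some (some i)) with hη
    obtain ⟨c, e, hc, he⟩ := ih (fun j => x j.castSucc - γ j • x (Fin.last _))
      (fun i => y i - η i • x (Fin.last _))
      (V.image fun u j => u j.castSucc - γ j * u (Fin.last _)) (by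
        intro hmem
        obtain ⟨u, hu, hu0⟩ := Finset.mem_image.mp hmem
        by_cases huW : u ∈ W
        · have h1 := Finset.prod_ne_zero_iff.mp (by simpa [L, map_prod] using hbL) u huW
          apply h1
          have := congrFun hu0 0
          simp only [hγ, if_true, Pi.zero_apply] at this
          rw [hb, mul_one, mul_comm]
          exact this
        · have h2 : u 0 = 0 ∧ u (Fin.last _) = 0 := by
            by_contra h; exact huW (Finset.mem_filter.mpr ⟨hu, h⟩)
          apply hV
          convert hu
          ext j
          refine Fin.lastCases ?_ (fun j => ?_) j
          · exact h2.2.symm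
          · have := congrFun hu0 j
            simpa [h2.2] using this.symm)
    -- the forms in the `x_j - γ_j x_last`, rewritten as forms in the `x_j`
    set c' : Fin (K + 2) → k := Fin.snoc c (-∑ j, γ j * c j) with hc'
    set e' : ι → Fin (K + 2) → k := fun i => Fin.snoc (e i) (-η i - ∑ j, γ j * e i j) with he'
    have htr : translates (fun j : Fin (K + 1) => x j.castSucc - γ j • x (Fin.last _))
        (fun i => y i - η i • x (Fin.last _)) c e = translates x y c' e' := by
      ext o
      rcases o with _ | i
      · simp only [translates, Option.elim, Fin.sum_univ_castSucc (n := K + 1), hc',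
          Fin.snoc_castSucc, Fin.snoc_last, smul_sub, Finset.sum_sub_distrib, neg_smul,
          Finset.sum_smul, smul_smul, mul_comm]
        abel
      · simp only [translates, Option.elim, Fin.sum_univ_castSucc (n := K + 1), he',
          Fin.snoc_castSucc, Fin.snoc_last, smul_sub, Finset.sum_sub_distrib, neg_smul, sub_smul,
          Finset.sum_smul, smul_smul, mul_comm]
        abel
    rw [htr] at he
    refine ⟨c', e', ?_, ?_⟩
    · intro u hu
      have := hc _ (Finset.mem_image_of_mem _ hu)
      convert this using 1
      simp only [Fin.sum_univ_castSucc (n := K + 1), hc', Fin.snoc_castSucc, Fin.snoc_last, mul_sub,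
        Finset.sum_sub_distrib, neg_mul, Finset.sum_mul]
      rw [sub_eq_add_neg]
      congr 2
      exact Finset.sum_congr rfl fun j _ => by ring
    · set R := Algebra.adjoin k (Set.range (translates x y c' e')) with hR
      let T : Subalgebra k S := (integralClosure R S).restrictScalars k
      have hRT : ∀ s ∈ R, s ∈ T := fun s hs =>
        (integralClosure R S).algebraMap_mem ⟨s, hs⟩
      have hxT : ∀ j : Fin (K + 1), x j.castSucc - γ j • x (Fin.last _) ∈ T := he
      have hyT : ∀ i, y i - η i • x (Fin.last _) ∈ T := by
        intro i
        have h1 : translates x y c' e' (some i) ∈ T :=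
          hRT _ (Algebra.subset_adjoin ⟨_, rfl⟩)
        rw [← htr] at h1
        have h2 := T.sub_mem h1 (T.sum_mem (t := Finset.univ)
          fun j _ => T.smul_mem (hxT j) (e i j))
        simpa [translates] using h2
      have hlast : x (Fin.last _) ∈ T := by
        have hle : Algebra.adjoin k
            (Set.range fun t : Option ι => v (some t) - b (some t) • v none) ≤ T := by
          rw [Algebra.adjoin_le_iff]
          rintro _ ⟨t, rfl⟩
          rcases t with _ | i
          · simpa [v, hγ] using hxT 0
          · simpa [v, hη] using hyT i
        obtain ⟨P, hP, hP0⟩ := hint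
        let φ : Algebra.adjoin k (Set.range fun t : Option ι => v (some t) - b (some t) • v none)
            →+* integralClosure R S :=
          { toFun := fun s => ⟨s, hle s.2⟩
            map_one' := rfl
            map_mul' := fun _ _ => rfl
            map_zero' := rfl
            map_add' := fun _ _ => rfl }
        have h3 : IsIntegral (integralClosure R S) (x (Fin.last _)) :=
          ⟨P.map φ, hP.map _, (Polynomial.eval₂_map _ _ _).trans hP0⟩
        exact isIntegral_trans (R := R) (A := integralClosure R S) _ h3
      intro j
      change x j ∈ T
      refine Fin.lastCases hlast (fun j => ?_) j
      have := T.add_mem (hxT j) (T.smul_mem hlast (γ j))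
      simpa using this

end NoetherNormalization

/-! ### Algebraic dependence in quotients and products -/

section Dependence

variable {k : Type*} [Field k]

/-- Passing to the quotient by a nonzero element of a domain lowers the maximal number of
algebraically independent elements: a relation between the element and lifts of the given classes
may be divided by a power of the variable standing for the element, and then that variable may be
set to zero. -/
theorem not_algebraicIndependent_of_map_eq_zero {R R' : Type*} [CommRing R] [IsDomain R]
    [CommRing R'] [Algebra k R] [Algebra k R'] (π : R →ₐ[k] R') (hπ : Function.Surjective π)
    (h : R) (h0 : h ≠ 0) (hker : π h = 0) {τ : Type*}
    (hdep : ∀ v : Option τ → R, ¬ AlgebraicIndependent k v) (v : τ → R') :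
    ¬ AlgebraicIndependent k v := by
  choose s hs using hπ
  let v' : τ → R := fun t => s (v t)
  intro hv
  apply hdep (fun o => o.elim h v')
  rw [AlgebraicIndependent, injective_iff_map_eq_zero]
  intro P hP
  by_contra hP0
  set Q := optionEquivLeft k τ P with hQ
  have hQ0 : Q ≠ 0 := by simpa [hQ] using hP0
  let ev : Polynomial (MvPolynomial τ k) →+* R :=
    Polynomial.eval₂RingHom (aeval v' : MvPolynomial τ k →ₐ[k] R).toRingHom h
  have hev : ∀ P : MvPolynomial (Option τ) k,
      ev (optionEquivLeft k τ P) = aeval (fun o : Option τ => o.elim h v') P := by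
    intro P
    induction P using MvPolynomial.induction_on with
    | C a => simp [ev, optionEquivLeft_C]
    | add p q hp hq => simp [hp, hq]
    | mul_X p o hp =>
      rw [map_mul, map_mul, hp, map_mul]
      congr 1
      rcases o with _ | t <;> simp [ev]
  obtain ⟨q, hq, hq'⟩ := Polynomial.exists_eq_pow_rootMultiplicity_mul_and_not_dvd Q hQ0 0
  have hevq : ev q = 0 := by
    have h1 : ev Q = 0 := by rw [hQ, hev, hP]
    rw [hq, map_mul, map_pow] at h1
    refine (mul_eq_zero.mp h1).resolve_left (pow_ne_zero _ ?_)
    simpa [ev] using h0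
  have hc : q.coeff 0 ≠ 0 := by
    intro h; apply hq'; rw [map_zero, sub_zero]; exact Polynomial.X_dvd_iff.mpr h
  apply hc
  apply hv
  rw [map_zero]
  have h2 : (π : R →+* R').comp ev = (Polynomial.evalRingHom 0).comp
      (Polynomial.mapRingHom (aeval v : MvPolynomial τ k →ₐ[k] R').toRingHom) := by
    ext t
    · simp [ev]
    · simp [ev, v', hs]
    · simp [ev, hker]
  have h3 := RingHom.congr_fun h2 q
  simp only [RingHom.comp_apply, hevq, map_zero, Polynomial.coe_evalRingHom,
    Polynomial.coe_mapRingHom, Polynomial.eval_map, Polynomial.eval₂_at_zero] at h3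
  exact h3.symm

theorem not_algebraicIndependent_polynomial {m : ℕ} {τ : Type} [Fintype τ]
    (hτ : Fintype.card τ = m + 2) {K : Type} [Field K]
    (v : τ → Polynomial (MvPolynomial (Fin m) K)) : ¬ AlgebraicIndependent K v := by
  intro hv
  have h1 := (hv.map' (f := (optionEquivLeft K (Fin m)).symm.toAlgHom)
    (optionEquivLeft K (Fin m)).symm.injective).cardinalMk_le_trdeg
  rw [MvPolynomial.trdeg_of_isDomain, Cardinal.mk_fintype, hτ, Cardinal.mk_fintype,
    Fintype.card_option, Fintype.card_fin, Cardinal.lift_id] at h1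
  norm_cast at h1
  omega

/-- The product of a relation in the first factor and a relation in the second one is a relation in
the product ring. -/
theorem not_algebraicIndependent_prod {S S' : Type*} [CommRing S] [CommRing S'] [Algebra k S]
    [Algebra k S'] {τ : Type*} (v : τ → S × S')
    (h1 : ¬ AlgebraicIndependent k fun t => (v t).1)
    (h2 : ¬ AlgebraicIndependent k fun t => (v t).2) : ¬ AlgebraicIndependent k v := by
  rw [AlgebraicIndependent, injective_iff_map_eq_zero] at h1 h2 ⊢
  push Not at h1 h2 ⊢
  obtain ⟨F, hF, hF0⟩ := h1
  obtain ⟨G, hG, hG0⟩ := h2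
  refine ⟨F * G, ?_, mul_ne_zero hF0 hG0⟩
  have e1 : (AlgHom.fst k S S').comp (aeval v) = aeval fun t => (v t).1 := by ext; simp
  have e2 : (AlgHom.snd k S S').comp (aeval v) = aeval fun t => (v t).2 := by ext; simp
  have f1 := DFunLike.congr_fun e1 F
  have f2 := DFunLike.congr_fun e2 G
  simp only [AlgHom.comp_apply, AlgHom.fst_apply, AlgHom.snd_apply, hF, hG] at f1 f2
  ext <;> simp [f1, f2]

/-- In the ring `(A/(f))[z]`, and hence in its square, there are at most as many algebraically
independent elements as there are variables in `A`. The square allows two systems of polynomials to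
be normalized simultaneously. -/
theorem not_algebraicIndependent_quotient_prod {m : ℕ} {K : Type} [Field K]
    (f : MvPolynomial (Fin (m + 1)) K) (hf : f ≠ 0)
    (v : Option (Option (Fin m)) →
      Polynomial (MvPolynomial (Fin (m + 1)) K ⧸ Ideal.span {f}) ×
      Polynomial (MvPolynomial (Fin (m + 1)) K ⧸ Ideal.span {f})) :
    ¬ AlgebraicIndependent K v := by
  have key : ∀ v : Option (Option (Fin m)) →
      Polynomial (MvPolynomial (Fin (m + 1)) K ⧸ Ideal.span {f}),
      ¬ AlgebraicIndependent K v := by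
    intro v
    refine not_algebraicIndependent_of_map_eq_zero
      (Polynomial.mapAlgHom (Ideal.Quotient.mkₐ K (Ideal.span {f})))
      (Polynomial.map_surjective _ Ideal.Quotient.mk_surjective) (Polynomial.C f)
      (by simpa using hf) ?_ (fun w => ?_) v
    · simp only [Polynomial.coe_mapAlgHom, Polynomial.map_C, RingHom.coe_coe,
        Ideal.Quotient.mkₐ_eq_mk]
      rw [Ideal.Quotient.eq_zero_iff_mem.mpr (Ideal.mem_span_singleton_self f), map_zero]
    · refine not_algebraicIndependent_polynomial ?_ w
      simp
  exact not_algebraicIndependent_prod v (key _) (key _)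

end Dependence

/-! ### Counting exponents -/

section Counting

/-- The number of points `a ∈ ℕᵐ` with `a₁ + ⋯ + a_m ≤ N`. -/
noncomputable def simplexCard (m N : ℕ) : ℕ := Nat.card {a : Fin m → ℕ // ∑ i, a i ≤ N}

instance finite_simplex (m N : ℕ) : Finite {a : Fin m → ℕ // ∑ i, a i ≤ N} := by
  refine Finite.of_injective (β := Fin m → Fin (N + 1)) (fun a i => ⟨a.1 i, ?_⟩) ?_
  · exact Nat.lt_succ_of_le ((Finset.single_le_sum (f := a.1) (fun _ _ => Nat.zero_le _)
      (Finset.mem_univ i)).trans a.2)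
  · intro a b h
    ext i
    simpa using congrFun h i

theorem simplexCard_pos (m N : ℕ) : 0 < simplexCard m N :=
  have : Nonempty {a : Fin m → ℕ // ∑ i, a i ≤ N} := ⟨⟨0, by simp⟩⟩
  Nat.card_pos

theorem simplexCard_le_pow (m N : ℕ) : simplexCard m N ≤ (N + 1) ^ m := by
  have := Nat.card_le_card_of_injective (β := Fin m → Fin (N + 1))
    (fun (a : {a : Fin m → ℕ // ∑ i, a i ≤ N}) i =>
      ⟨a.1 i, Nat.lt_succ_of_le ((Finset.single_le_sum (f := a.1) (fun _ _ => Nat.zero_le _)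
        (Finset.mem_univ i)).trans a.2)⟩) (by
      intro a b h
      ext i
      simpa using congrFun h i)
  simpa [simplexCard] using this

/-- Division with remainder by `d` in each coordinate. -/
theorem simplexCard_mul_add_le (m d L w : ℕ) (hd : 0 < d) :
    simplexCard m (d * L + w) ≤ d ^ m * simplexCard m (L + w) := by
  have := Nat.card_le_card_of_injective
    (β := (Fin m → Fin d) × {a : Fin m → ℕ // ∑ i, a i ≤ L + w})
    (fun (a : {a : Fin m → ℕ // ∑ i, a i ≤ d * L + w}) =>
      (fun i => ⟨a.1 i % d, Nat.mod_lt _ hd⟩, ⟨fun i => a.1 i / d, by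
        have h1 : d * ∑ i, a.1 i / d ≤ d * L + w := by
          rw [Finset.mul_sum]
          exact (Finset.sum_le_sum fun i _ => Nat.mul_div_le _ _).trans a.2
        have h2 : d * ∑ i, a.1 i / d ≤ d * (L + w) := h1.trans (by
          rw [mul_add]; exact Nat.add_le_add_left (Nat.le_mul_of_pos_left w hd) _)
        exact Nat.le_of_mul_le_mul_left h2 hd⟩)) (by
      intro a b h
      ext i
      have h1 := congrFun (congrArg Prod.fst h) i
      have h2 := congrFun (congrArg Subtype.val (congrArg Prod.snd h)) i
      simp only [Fin.mk.injEq] at h1 h2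
      rw [← Nat.div_add_mod (a.1 i) d, ← Nat.div_add_mod (b.1 i) d, h1, h2])
  simpa [simplexCard, Nat.card_prod] using this

/-- As `simplexCard m` grows like a polynomial of degree `m` whose leading term is multiplied by
`d ^ m` under `N ↦ d * N`, the comparison `w * simplexCard m L ≤ e * simplexCard m (d * L + w)`
for all large `L` forces `w ≤ e * d ^ m`. -/
theorem le_mul_pow_of_simplexCard_le (m d w e L₀ : ℕ) (hd : 0 < d)
    (h : ∀ L ≥ L₀, w * simplexCard m L ≤ e * simplexCard m (d * L + w)) : w ≤ e * d ^ m := by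
  by_contra! hlt
  set c := e * d ^ m with hc
  have h1 : ∀ L ≥ L₀, (c + 1) * simplexCard m L ≤ c * simplexCard m (L + w) := fun L hL =>
    calc (c + 1) * simplexCard m L ≤ w * simplexCard m L := Nat.mul_le_mul_right _ hlt
      _ ≤ e * simplexCard m (d * L + w) := h L hL
      _ ≤ e * (d ^ m * simplexCard m (L + w)) :=
        Nat.mul_le_mul_left _ (simplexCard_mul_add_le m d L w hd)
      _ = c * simplexCard m (L + w) := by rw [hc, mul_assoc]
  have hc0 : 0 < c := by
    rcases Nat.eq_zero_or_pos c with h0 | h0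
    · have := h1 L₀ le_rfl
      have h2 := simplexCard_pos m L₀
      rw [h0] at this
      omega
    · exact h0
  -- iteration yields exponential growth, whereas `simplexCard m` grows polynomially
  have h2 : ∀ j, (c + 1) ^ j ≤ c ^ j * simplexCard m (L₀ + j * w) := by
    intro j
    induction j with
    | zero => simpa using Nat.succ_le_of_lt (simplexCard_pos m L₀)
    | succ j ih =>
      calc (c + 1) ^ (j + 1) = (c + 1) * (c + 1) ^ j := by ring
        _ ≤ (c + 1) * (c ^ j * simplexCard m (L₀ + j * w)) := Nat.mul_le_mul_left _ ih
        _ = c ^ j * ((c + 1) * simplexCard m (L₀ + j * w)) := by ring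
        _ ≤ c ^ j * (c * simplexCard m (L₀ + j * w + w)) :=
          Nat.mul_le_mul_left _ (h1 _ (Nat.le_add_right _ _))
        _ = c ^ (j + 1) * simplexCard m (L₀ + (j + 1) * w) := by
          rw [show L₀ + j * w + w = L₀ + (j + 1) * w by ring]; ring
  have hcR : (0 : ℝ) < c := by exact_mod_cast hc0
  have hr : (1 : ℝ) < (c + 1) / c := by rw [lt_div_iff₀ hcR]; linarith
  set M : ℝ := L₀ + 1 + w with hM
  have hMpos : 0 < M := by positivity
  have h3 : ∀ j : ℕ, 1 ≤ j → (1 / M ^ m : ℝ) ≤ (j : ℝ) ^ m / ((c + 1) / c) ^ j := by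
    intro j hj
    have hjR : (1 : ℝ) ≤ j := by exact_mod_cast hj
    have h4 : ((c : ℝ) + 1) ^ j ≤ c ^ j * (L₀ + j * w + 1) ^ m := by
      exact_mod_cast (h2 j).trans (Nat.mul_le_mul_left _ (simplexCard_le_pow m _))
    have h5 : ((L₀ : ℝ) + j * w + 1) ≤ M * j := by
      have : (0 : ℝ) ≤ L₀ := Nat.cast_nonneg _
      nlinarith
    rw [div_le_div_iff₀ (by positivity) (by positivity), one_mul, div_pow,
      div_le_iff₀ (by positivity)]
    calc ((c : ℝ) + 1) ^ j ≤ c ^ j * (L₀ + j * w + 1) ^ m := h4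
      _ ≤ c ^ j * (M * j) ^ m := by gcongr
      _ = _ := by rw [mul_pow]; ring
  have h6 := tendsto_pow_const_div_const_pow_of_one_lt m hr
  have h7 := ge_of_tendsto h6 (Filter.eventually_atTop.mpr ⟨1, h3⟩)
  have h8 : (0 : ℝ) < 1 / M ^ m := by positivity
  linarith

/-- The exponents of the monomials `U^b T^a` of weight `b + d * |a|` at most `N`. -/
def weightSet (m d N : ℕ) : Set (Option (Fin m) →₀ ℕ) := {s | s none + d * ∑ i, s (some i) ≤ N}

/-- The exponents of the monomials of degree at most `N` in `n` variables. -/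
def degreeSet (n N : ℕ) : Set (Fin n →₀ ℕ) := {s | ∑ i, s i ≤ N}

theorem finite_weightSet (m d N : ℕ) (hd : 0 < d) : Finite (weightSet m d N) := by
  refine Finite.of_injective (β := Option (Fin m) → Fin (N + 1)) (fun a i => ⟨a.1 i, ?_⟩) ?_
  · have h := a.2
    simp only [weightSet, Set.mem_ofPred_eq] at h
    rcases i with _ | i
    · omega
    · have h1 := Finset.single_le_sum (f := fun i => a.1 (some i)) (fun _ _ => Nat.zero_le _)
        (Finset.mem_univ i)
      have h2 := Nat.le_mul_of_pos_left (∑ i, a.1 (some i)) hd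
      omega
  · intro a b h
    ext i
    simpa using congrFun h i

instance finite_degreeSet (n N : ℕ) : Finite (degreeSet n N) :=
  Finite.of_injective (β := {a : Fin n → ℕ // ∑ i, a i ≤ N}) (fun s => ⟨s.1, s.2⟩) (by
    intro a b h
    ext i
    simpa using congrFun (congrArg Subtype.val h) i)

/-- For each `a` with `|a| ≤ L` there are `w` exponents `b` with `d L < b + d |a| ≤ d L + w`. -/
theorem card_weightSet_add_le (m d L w : ℕ) (hd : 0 < d) :
    Nat.card (weightSet m d (d * L)) + w * simplexCard m L ≤
      Nat.card (weightSet m d (d * L + w)) := by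
  have := finite_weightSet m d (d * L) hd
  have := finite_weightSet m d (d * L + w) hd
  have := Nat.card_le_card_of_injective
    (α := weightSet m d (d * L) ⊕ (Fin w × {a : Fin m → ℕ // ∑ i, a i ≤ L}))
    (β := weightSet m d (d * L + w))
    (Sum.elim (fun s => ⟨s.1, s.2.trans (Nat.le_add_right _ _)⟩)
      (fun p => ⟨Finsupp.equivFunOnFinite.symm
        (fun o => o.elim (d * L + 1 + p.1 - d * ∑ i, p.2.1 i) p.2.1), by
          have h1 := Nat.mul_le_mul_left d p.2.2
          have h2 := p.1.2
          simp only [weightSet, Set.mem_ofPred_eq, Finsupp.equivFunOnFinite_symm_apply_apply,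
            Option.elim]
          omega⟩)) (by
      have hbig : ∀ p : Fin w × {a : Fin m → ℕ // ∑ i, a i ≤ L},
          (d * L + 1 + p.1 - d * ∑ i, p.2.1 i) + d * ∑ i, p.2.1 i = d * L + 1 + p.1 := by
        intro p
        have h1 := Nat.mul_le_mul_left d p.2.2
        omega
      rintro (s | p) (t | q) h
      · simpa [Subtype.ext_iff] using h
      · exfalso
        have h1 := congrArg Subtype.val h
        simp only [Sum.elim_inl, Sum.elim_inr] at h1
        have h2 := s.2
        rw [h1] at h2
        simp only [weightSet, Set.mem_ofPred_eq, Finsupp.equivFunOnFinite_symm_apply_apply,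
          Option.elim, hbig] at h2
        omega
      · exfalso
        have h1 := congrArg Subtype.val h
        simp only [Sum.elim_inl, Sum.elim_inr] at h1
        have h2 := t.2
        rw [← h1] at h2
        simp only [weightSet, Set.mem_ofPred_eq, Finsupp.equivFunOnFinite_symm_apply_apply,
          Option.elim, hbig] at h2
        omega
      · have h1 := Finsupp.equivFunOnFinite.symm.injective (congrArg Subtype.val h)
        have h2 : p.2.1 = q.2.1 := funext fun i => congrFun h1 (some i)
        have h3 := congrFun h1 none
        simp only [Option.elim] at h3
        have hp := hbig p
        have hq := hbig q
        rw [h3, h2] at hp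
        have h4 : p.1 = q.1 := Fin.ext (by omega)
        exact congrArg Sum.inr (Prod.ext h4 (Subtype.ext h2)))
  simpa [Nat.card_sum, Nat.card_prod, simplexCard] using this

/-- An exponent of degree larger than `N - e` is determined by its degree and by its entries apart
from the first one. -/
theorem card_degreeSet_le (m e N : ℕ) :
    Nat.card (degreeSet (m + 1) N) ≤
      Nat.card (degreeSet (m + 1) (N - e)) + e * simplexCard m N := by
  have hdec : ∀ s : degreeSet (m + 1) N, ¬ (∑ i, s.1 i ≤ N - e) → N - ∑ i, s.1 i < e := by
    intro s hs
    have := s.2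
    simp only [degreeSet, Set.mem_ofPred_eq] at this
    omega
  classical
  have := Nat.card_le_card_of_injective
    (α := degreeSet (m + 1) N)
    (β := degreeSet (m + 1) (N - e) ⊕ (Fin e × {a : Fin m → ℕ // ∑ i, a i ≤ N}))
    (fun s => if h : ∑ i, s.1 i ≤ N - e then Sum.inl ⟨s.1, h⟩ else
      Sum.inr (⟨N - ∑ i, s.1 i, hdec s h⟩, ⟨fun i => s.1 i.succ, by
        have := s.2
        simp only [degreeSet, Set.mem_ofPred_eq, Fin.sum_univ_succ] at this
        change ∑ i : Fin m, s.1 i.succ ≤ N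
        omega⟩)) (by
      intro s t h
      have hs := s.2
      have ht := t.2
      simp only [degreeSet, Set.mem_ofPred_eq] at hs ht
      simp only at h
      split_ifs at h with h1 h2 h2
      · simpa [Subtype.ext_iff] using h
      · have h3 := Sum.inr_injective h
        have h4 := congrArg (fun p => (p.1 : Fin e).1) h3
        have h5 := congrArg (fun p => p.2.1) h3
        simp only at h4 h5
        rw [Fin.sum_univ_succ] at hs
        rw [Fin.sum_univ_succ] at ht
        rw [Fin.sum_univ_succ, Fin.sum_univ_succ] at h4
        have h6 : ∑ i : Fin m, s.1 i.succ = ∑ i : Fin m, t.1 i.succ :=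
          Finset.sum_congr rfl fun i _ => congrFun h5 i
        ext i
        refine Fin.cases ?_ (fun i => congrFun h5 i) i
        omega)
  simpa [Nat.card_sum, Nat.card_prod, simplexCard] using this

end Counting

/-! ### Filtrations by degree -/

section Filtrations

variable {K : Type} [Field K]

theorem mem_restrictSupport_degreeSet {n N : ℕ} {g : MvPolynomial (Fin n) K} :
    g ∈ restrictSupport K (degreeSet n N) ↔ g.totalDegree ≤ N := by
  rw [mem_restrictSupport_iff, totalDegree, Finset.sup_le_iff]
  refine forall₂_congr fun s _ => ?_
  rw [Finsupp.sum_fintype _ _ (fun _ => rfl)]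
  rfl

/-- The span of the products `g * F_i` with `deg g + d ≤ N`: the combinations of the `F_i`, all of
degree at most `d`, in which no summand has degree larger than `N`. -/
noncomputable def boundedCombos {n m : ℕ} (F : Fin m → MvPolynomial (Fin n) K) (d N : ℕ) :
    Submodule K (MvPolynomial (Fin n) K) :=
  Submodule.span K {y | ∃ i g, g.totalDegree + d ≤ N ∧ y = g * F i}

variable {n m : ℕ} {F : Fin m → MvPolynomial (Fin n) K} {d : ℕ}

theorem boundedCombos_mono {N N' : ℕ} (h : N ≤ N') : boundedCombos F d N ≤ boundedCombos F d N' :=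
  Submodule.span_mono fun _ ⟨i, g, hg, hy⟩ => ⟨i, g, hg.trans h, hy⟩

theorem mul_mem_boundedCombos {N N' : ℕ} {y c : MvPolynomial (Fin n) K}
    (hy : y ∈ boundedCombos F d N) (hc : c.totalDegree ≤ N') :
    c * y ∈ boundedCombos F d (N + N') := by
  induction hy using Submodule.span_induction with
  | mem y hy =>
    obtain ⟨i, g, hg, rfl⟩ := hy
    refine Submodule.subset_span ⟨i, c * g, ?_, by ring⟩
    have := totalDegree_mul c g
    omega
  | zero => simp
  | add x y _ _ hx hy => rw [mul_add]; exact Submodule.add_mem _ hx hy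
  | smul a x _ hx => rw [mul_smul_comm]; exact Submodule.smul_mem _ _ hx

theorem totalDegree_le_of_mem_boundedCombos (hF : ∀ i, (F i).totalDegree ≤ d) {N : ℕ}
    {y : MvPolynomial (Fin n) K} (hy : y ∈ boundedCombos F d N) : y.totalDegree ≤ N := by
  induction hy using Submodule.span_induction with
  | mem y hy =>
    obtain ⟨i, g, hg, rfl⟩ := hy
    have := totalDegree_mul g (F i)
    have := hF i
    omega
  | zero => simp
  | add x y _ _ hx hy => exact (totalDegree_add _ _).trans (max_le hx hy)
  | smul a x _ hx => exact (totalDegree_smul_le _ _).trans hx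

/-- The polynomials in `z` of degree at most `N` whose coefficients have degree at most `N` and,
apart from the constant one, are combinations of the `F_i` without summands of larger degree. -/
noncomputable def zFiltration (F : Fin m → MvPolynomial (Fin n) K) (d N : ℕ) :
    Submodule K (Polynomial (MvPolynomial (Fin n) K)) where
  carrier := {H | H.natDegree ≤ N ∧ (∀ i, (H.coeff i).totalDegree ≤ N) ∧
    ∀ i, i ≠ 0 → H.coeff i ∈ boundedCombos F d N}
  add_mem' := by
    rintro G H ⟨hG1, hG2, hG3⟩ ⟨hH1, hH2, hH3⟩
    refine ⟨Polynomial.natDegree_add_le_of_degree_le hG1 hH1, fun i => ?_, fun i hi => ?_⟩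
    · rw [Polynomial.coeff_add]
      exact (totalDegree_add _ _).trans (max_le (hG2 i) (hH2 i))
    · rw [Polynomial.coeff_add]
      exact Submodule.add_mem _ (hG3 i hi) (hH3 i hi)
  zero_mem' := by simp
  smul_mem' := by
    rintro c H ⟨hH1, hH2, hH3⟩
    refine ⟨(Polynomial.natDegree_smul_le _ _).trans hH1, fun i => ?_, fun i hi => ?_⟩
    · rw [Polynomial.coeff_smul]
      exact (totalDegree_smul_le _ _).trans (hH2 i)
    · rw [Polynomial.coeff_smul]
      exact Submodule.smul_mem _ _ (hH3 i hi)

theorem zFiltration_mono {N N' : ℕ} (h : N ≤ N') : zFiltration F d N ≤ zFiltration F d N' :=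
  fun _ ⟨h1, h2, h3⟩ => ⟨h1.trans h, fun i => (h2 i).trans h,
    fun i hi => boundedCombos_mono h (h3 i hi)⟩

theorem C_mul_mem_zFiltration {N e : ℕ} {l : MvPolynomial (Fin n) K} (hl : l.totalDegree ≤ e)
    {H : Polynomial (MvPolynomial (Fin n) K)} (hH : H ∈ zFiltration F d N) :
    Polynomial.C l * H ∈ zFiltration F d (N + e) := by
  obtain ⟨h1, h2, h3⟩ := hH
  refine ⟨(Polynomial.natDegree_C_mul_le _ _).trans (h1.trans (Nat.le_add_right _ _)),
    fun i => ?_, fun i hi => ?_⟩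
  · rw [Polynomial.coeff_C_mul]
    have := totalDegree_mul l (H.coeff i)
    have := h2 i
    omega
  · rw [Polynomial.coeff_C_mul]
    exact mul_mem_boundedCombos (h3 i hi) hl

theorem C_mul_X_mul_mem_zFiltration (hd : 0 < d) (hF : ∀ i, (F i).totalDegree ≤ d) (i : Fin m)
    {N : ℕ} {H : Polynomial (MvPolynomial (Fin n) K)} (hH : H ∈ zFiltration F d N) :
    Polynomial.C (F i) * Polynomial.X * H ∈ zFiltration F d (N + d) := by
  obtain ⟨h1, h2, h3⟩ := hH
  have hcoeff : ∀ j, ((Polynomial.C (F i) * Polynomial.X * H).coeff (j + 1)) =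
      H.coeff j * F i := by
    intro j
    rw [mul_assoc, Polynomial.coeff_C_mul, Polynomial.coeff_X_mul, mul_comm]
  have hcoeff0 : (Polynomial.C (F i) * Polynomial.X * H).coeff 0 = 0 := by
    rw [mul_assoc, Polynomial.coeff_C_mul, Polynomial.coeff_X_mul_zero, mul_zero]
  have hmem : ∀ j, j ≠ 0 → (Polynomial.C (F i) * Polynomial.X * H).coeff j ∈
      boundedCombos F d (N + d) := by
    intro j hj
    obtain ⟨j, rfl⟩ := Nat.exists_eq_succ_of_ne_zero hj
    rw [Nat.succ_eq_add_one, hcoeff]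
    exact Submodule.subset_span ⟨i, H.coeff j, Nat.add_le_add_right (h2 j) d, rfl⟩
  refine ⟨?_, fun j => ?_, hmem⟩
  · rw [mul_assoc]
    refine (Polynomial.natDegree_C_mul_le _ _).trans ?_
    refine Polynomial.natDegree_mul_le.trans ?_
    have := Polynomial.natDegree_X_le (R := MvPolynomial (Fin n) K)
    omega
  · rcases Nat.eq_zero_or_pos j with rfl | hj
    · rw [hcoeff0]; simp
    · exact totalDegree_le_of_mem_boundedCombos hF (hmem j hj.ne')

/-- The substitution of `l` and of the `F_i z + l'_i` for `U` and for the `T_i` maps the polynomials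
of weighted degree at most `N` to `zFiltration F d N`. -/
theorem aeval_mem_zFiltration (hd : 0 < d) (hF : ∀ i, (F i).totalDegree ≤ d)
    {l : MvPolynomial (Fin n) K} (hl : l.totalDegree ≤ 1) {l' : Fin m → MvPolynomial (Fin n) K}
    (hl' : ∀ i, (l' i).totalDegree ≤ 1) {N : ℕ} {q : MvPolynomial (Option (Fin m)) K}
    (hq : q ∈ restrictSupport K (weightSet m d N)) :
    aeval (fun o : Option (Fin m) => o.elim (Polynomial.C l)
      fun i => Polynomial.C (F i) * Polynomial.X + Polynomial.C (l' i)) q ∈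
        zFiltration F d N := by
  have hone : (1 : Polynomial (MvPolynomial (Fin n) K)) ∈ zFiltration F d 0 := by
    refine ⟨by simp, fun i => ?_, fun i hi => ?_⟩
    · rw [Polynomial.coeff_one]; split_ifs <;> simp
    · rw [Polynomial.coeff_one, if_neg hi]; exact Submodule.zero_mem _
  have hpow1 : ∀ (a N : ℕ) (H : Polynomial (MvPolynomial (Fin n) K)), H ∈ zFiltration F d N →
      Polynomial.C l ^ a * H ∈ zFiltration F d (N + a) := by
    intro a N H hH
    induction a with
    | zero => simpa using hH
    | succ a ih =>
      rw [pow_succ', mul_assoc]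
      exact C_mul_mem_zFiltration hl ih
  have hpow2 : ∀ (i : Fin m) (a N : ℕ) (H : Polynomial (MvPolynomial (Fin n) K)),
      H ∈ zFiltration F d N →
      (Polynomial.C (F i) * Polynomial.X + Polynomial.C (l' i)) ^ a * H ∈
        zFiltration F d (N + d * a) := by
    intro i a N H hH
    induction a with
    | zero => simpa using hH
    | succ a ih =>
      rw [pow_succ', mul_assoc, add_mul, mul_add, mul_one, ← add_assoc]
      exact Submodule.add_mem _ (C_mul_X_mul_mem_zFiltration hd hF i ih)
        (C_mul_mem_zFiltration ((hl' i).trans hd) ih)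
  have hprod : ∀ (s : Fin m → ℕ) (t : Finset (Fin m)),
      ∏ i ∈ t, (Polynomial.C (F i) * Polynomial.X + Polynomial.C (l' i)) ^ s i ∈
        zFiltration F d (d * ∑ i ∈ t, s i) := by
    intro s t
    classical
    induction t using Finset.induction_on with
    | empty => simpa using hone
    | insert i t hi ih =>
      rw [Finset.prod_insert hi, Finset.sum_insert hi, mul_add, add_comm]
      exact hpow2 i _ _ _ ih
  rw [q.as_sum, map_sum]
  refine Submodule.sum_mem _ fun s hs => ?_
  have hsN : s none + d * ∑ i, s (some i) ≤ N := ((mem_restrictSupport_iff K).mp hq) hs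
  rw [aeval_monomial, Finsupp.prod_fintype _ _ (fun _ => pow_zero _), Fintype.prod_option]
  simp only [Option.elim]
  have h1 := zFiltration_mono (N' := N) (by rw [add_comm]; exact hsN)
    (hpow1 (s none) _ _ (hprod (fun i => s (some i)) Finset.univ))
  have h2 := Submodule.smul_mem (zFiltration F d N) (coeff s q) h1
  rwa [Algebra.smul_def] at h2

end Filtrations

/-! ### The weighted degree -/

section WeightedDegree

variable {K : Type} [Field K] {m : ℕ}

/-- `q(U, T) ↦ q(sU, s^d T)`; the degree in `s` of the image is the weighted degree of `q` for the
weights `1` of `U` and `d` of the `T_i`. -/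
noncomputable def weightHom (K : Type) [Field K] (m d : ℕ) :
    MvPolynomial (Option (Fin m)) K →ₐ[K] Polynomial (MvPolynomial (Option (Fin m)) K) :=
  aeval fun o => Polynomial.C (X o) * Polynomial.X ^ (o.elim 1 fun _ => d : ℕ)

/-- The extension of `weightHom` to polynomials in a further variable of weight `0`. -/
noncomputable def weightHomPoly (K : Type) [Field K] (m d : ℕ) :
    Polynomial (MvPolynomial (Option (Fin m)) K) →+*
      Polynomial (Polynomial (MvPolynomial (Option (Fin m)) K)) :=
  Polynomial.eval₂RingHom (S := Polynomial (Polynomial (MvPolynomial (Option (Fin m)) K)))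
    ((Polynomial.mapRingHom Polynomial.C).comp (weightHom K m d).toRingHom)
    (Polynomial.C Polynomial.X)

/-- The weighted degree of a polynomial in `U`, `T_i`, `Z` with weights `1`, `d`, `0`. -/
noncomputable def weightDegree (d : ℕ) (H : Polynomial (MvPolynomial (Option (Fin m)) K)) : ℕ :=
  (weightHomPoly K m d H).natDegree

theorem weightHom_monomial (d : ℕ) (s : Option (Fin m) →₀ ℕ) (c : K) :
    weightHom K m d (monomial s c) =
      Polynomial.monomial (s none + d * ∑ i, s (some i)) (monomial s c) := by
  rw [weightHom, aeval_monomial, Finsupp.prod_fintype _ _ (fun _ => pow_zero _)]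
  simp only [mul_pow, ← pow_mul, Finset.prod_mul_distrib, Finset.prod_pow_eq_pow_sum]
  rw [Fintype.sum_option]
  simp only [Option.elim, one_mul, ← Finset.mul_sum]
  rw [← Polynomial.C_mul_X_pow_eq_monomial, ← mul_assoc, monomial_eq,
    Finsupp.prod_fintype _ _ (fun _ => pow_zero _), map_mul, map_prod]
  simp only [map_pow]
  rfl

theorem coeff_coeff_weightHom (d : ℕ) (q : MvPolynomial (Option (Fin m)) K) (j : ℕ)
    (s : Option (Fin m) →₀ ℕ) :
    coeff s ((weightHom K m d q).coeff j) =
      if s none + d * ∑ i, s (some i) = j then coeff s q else 0 := by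
  classical
  induction q using MvPolynomial.induction_on' with
  | monomial t c =>
    rw [weightHom_monomial, Polynomial.coeff_monomial]
    by_cases hst : t = s
    · subst hst; split_ifs <;> simp
    · split_ifs <;> simp [coeff_monomial, hst]
  | add p q hp hq =>
    rw [map_add, Polynomial.coeff_add, coeff_add, hp, hq, coeff_add]
    split_ifs <;> simp

theorem natDegree_weightHom_le_iff (d N : ℕ) (q : MvPolynomial (Option (Fin m)) K) :
    (weightHom K m d q).natDegree ≤ N ↔ q ∈ restrictSupport K (weightSet m d N) := by
  rw [Polynomial.natDegree_le_iff_coeff_eq_zero, mem_restrictSupport_iff]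
  constructor
  · intro h s hs
    by_contra hN
    have h1 := coeff_coeff_weightHom d q (s none + d * ∑ i, s (some i)) s
    rw [h _ (not_le.mp hN), if_pos rfl, coeff_zero] at h1
    exact (mem_support_iff.mp hs) h1.symm
  · intro h j hj
    ext s
    rw [coeff_coeff_weightHom, coeff_zero]
    split_ifs with hs
    · by_contra h0
      have : s none + d * ∑ i, s (some i) ≤ N := h (mem_support_iff.mpr h0)
      omega
    · rfl

theorem coeff_coeff_weightHomPoly (d : ℕ) (H : Polynomial (MvPolynomial (Option (Fin m)) K))
    (i j : ℕ) :
    ((weightHomPoly K m d H).coeff i).coeff j = (weightHom K m d (H.coeff j)).coeff i := by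
  induction H using Polynomial.induction_on' with
  | add p q hp hq => simp [hp, hq]
  | monomial t q =>
    rw [weightHomPoly, Polynomial.coe_eval₂RingHom, Polynomial.eval₂_monomial, ← map_pow,
      Polynomial.coeff_mul_C, RingHom.comp_apply, Polynomial.coe_mapRingHom, Polynomial.coeff_map,
      Polynomial.coeff_C_mul, Polynomial.coeff_X_pow, Polynomial.coeff_monomial]
    by_cases h : j = t
    · subst h; simp
    · rw [if_neg h, if_neg (Ne.symm h)]; simp

theorem weightDegree_le_iff (d N : ℕ) (H : Polynomial (MvPolynomial (Option (Fin m)) K)) :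
    weightDegree d H ≤ N ↔ ∀ j, H.coeff j ∈ restrictSupport K (weightSet m d N) := by
  simp only [← natDegree_weightHom_le_iff, weightDegree,
    Polynomial.natDegree_le_iff_coeff_eq_zero]
  constructor
  · intro h j i hi
    rw [← coeff_coeff_weightHomPoly, h i hi, Polynomial.coeff_zero]
  · intro h i hi
    ext1 j
    rw [coeff_coeff_weightHomPoly, h j i hi, Polynomial.coeff_zero]

theorem weightHomPoly_injective (d : ℕ) : Function.Injective (weightHomPoly K m d) := by
  rw [injective_iff_map_eq_zero]
  intro H hH
  ext j s
  have h := coeff_coeff_weightHom d (H.coeff j) (s none + d * ∑ i, s (some i)) s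
  rw [← coeff_coeff_weightHomPoly, hH, if_pos rfl] at h
  simpa using h.symm

theorem weightDegree_mul (d : ℕ) {G H : Polynomial (MvPolynomial (Option (Fin m)) K)}
    (hG : G ≠ 0) (hH : H ≠ 0) :
    weightDegree d (G * H) = weightDegree d G + weightDegree d H := by
  rw [weightDegree, map_mul, Polynomial.natDegree_mul]
  · rfl
  · exact (map_ne_zero_iff _ (weightHomPoly_injective d)).mpr hG
  · exact (map_ne_zero_iff _ (weightHomPoly_injective d)).mpr hH

end WeightedDegree

/-! ### Dimensions of spaces of polynomials -/

section Rank

variable {K : Type} [Field K]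

theorem finrank_restrictSupport {σ : Type*} (s : Set (σ →₀ ℕ)) :
    Module.finrank K (restrictSupport K s) = Nat.card s :=
  Module.finrank_eq_nat_card_basis (basisRestrictSupport K s)

theorem finite_restrictSupport {σ : Type*} (s : Set (σ →₀ ℕ)) [Finite s] :
    Module.Finite K (restrictSupport K s) :=
  Module.Finite.of_basis (basisRestrictSupport K s)

/-- The space of residue classes modulo `p` of polynomials of degree at most `N`. -/
noncomputable def classFiltration {n : ℕ} (p : MvPolynomial (Fin n) K) (N : ℕ) :
    Submodule K (MvPolynomial (Fin n) K ⧸ Ideal.span {p}) :=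
  (restrictSupport K (degreeSet n N)).map (Ideal.Quotient.mkₐ K (Ideal.span {p})).toLinearMap

instance {n : ℕ} (p : MvPolynomial (Fin n) K) (N : ℕ) : Module.Finite K (classFiltration p N) :=
  have := finite_restrictSupport (K := K) (degreeSet n N)
  Module.Finite.map _ _

/-- The kernel of the passage to residue classes contains the multiples of `p` by polynomials of
degree at most `N - deg p`. -/
theorem finrank_classFiltration_le {m : ℕ} (p : MvPolynomial (Fin (m + 1)) K) (hp : p ≠ 0) (N : ℕ)
    (hN : p.totalDegree ≤ N) :
    Module.finrank K (classFiltration p N) ≤ p.totalDegree * simplexCard m N := by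
  have := finite_restrictSupport (K := K) (degreeSet (m + 1) N)
  set φ : restrictSupport K (degreeSet (m + 1) N) →ₗ[K]
      MvPolynomial (Fin (m + 1)) K ⧸ Ideal.span {p} :=
    (Ideal.Quotient.mkₐ K (Ideal.span {p})).toLinearMap ∘ₗ Submodule.subtype _ with hφ
  have h1 : classFiltration p N = LinearMap.range φ := by
    rw [hφ, LinearMap.range_comp, Submodule.range_subtype]; rfl
  have h2 := LinearMap.finrank_range_add_finrank_ker φ
  rw [← h1, finrank_restrictSupport] at h2
  let μ : restrictSupport K (degreeSet (m + 1) (N - p.totalDegree)) →ₗ[K] LinearMap.ker φ :=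
    { toFun := fun g => ⟨⟨p * g.1, by
          have h3 := mem_restrictSupport_degreeSet.mp g.2
          rw [mem_restrictSupport_degreeSet]
          have := totalDegree_mul p g.1
          omega⟩, by
          rw [LinearMap.mem_ker]
          exact Ideal.Quotient.eq_zero_iff_mem.mpr
            (Ideal.mul_mem_right _ _ (Ideal.mem_span_singleton_self p))⟩
      map_add' := fun g h => by ext1; ext1; exact mul_add _ _ _
      map_smul' := fun c g => by ext1; ext1; exact mul_smul_comm _ _ _ }
  have hμ : Function.Injective μ := by
    intro g h hgh
    have h4 := congrArg (fun x => x.1.1) hgh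
    exact Subtype.ext (mul_left_cancel₀ hp h4)
  have h5 := LinearMap.finrank_le_finrank_of_injective hμ
  rw [finrank_restrictSupport] at h5
  have h6 := card_degreeSet_le m p.totalDegree N
  omega

variable {m : ℕ} {n : ℕ}

/-- The map sending coefficients `v_0, …, v_(ρ-1)` to `∑ v_j Z^j`. -/
noncomputable def toPoly {R : Type*} [CommRing R] [Algebra K R] (V : Submodule K R) (ρ : ℕ) :
    (Fin ρ → V) →ₗ[K] Polynomial R :=
  ∑ j : Fin ρ, ((Polynomial.monomial (j : ℕ)).restrictScalars K ∘ₗ V.subtype) ∘ₗ LinearMap.proj j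

theorem toPoly_apply {R : Type*} [CommRing R] [Algebra K R] (V : Submodule K R) (ρ : ℕ)
    (v : Fin ρ → V) : toPoly V ρ v = ∑ j : Fin ρ, Polynomial.monomial (j : ℕ) (v j : R) := by
  simp [toPoly]

theorem mem_range_toPoly {R : Type*} [CommRing R] [Algebra K R] (V : Submodule K R) (ρ : ℕ)
    (H : Polynomial R) :
    H ∈ LinearMap.range (toPoly V ρ) ↔ H.degree < ρ ∧ ∀ j, H.coeff j ∈ V := by
  have hc : ∀ (v : Fin ρ → V) (j : ℕ), (toPoly V ρ v).coeff j =
      if h : j < ρ then (v ⟨j, h⟩ : R) else 0 := by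
    intro v j
    rw [toPoly_apply, Polynomial.finsetSum_coeff]
    simp only [Polynomial.coeff_monomial]
    split_ifs with h
    · rw [Finset.sum_eq_single ⟨j, h⟩]
      · simp
      · intro i _ hi
        rw [if_neg]
        intro hij
        exact hi (Fin.ext hij)
      · simp
    · refine Finset.sum_eq_zero fun i _ => ?_
      rw [if_neg]
      have := i.2
      omega
  constructor
  · rintro ⟨v, rfl⟩
    refine ⟨(Polynomial.degree_lt_iff_coeff_zero _ _).mpr fun j hj => ?_, fun j => ?_⟩
    · rw [hc, dif_neg (not_lt.mpr hj)]
    · rw [hc]; split_ifs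
      · exact (v _).2
      · exact V.zero_mem
  · rintro ⟨h1, h2⟩
    refine ⟨fun j => ⟨H.coeff j, h2 j⟩, ?_⟩
    ext1 j
    rw [hc]
    split_ifs with h
    · rfl
    · exact ((Polynomial.degree_lt_iff_coeff_zero _ _).mp h1 j (not_lt.mp h)).symm

theorem toPoly_injective {R : Type*} [CommRing R] [Algebra K R] (V : Submodule K R) (ρ : ℕ) :
    Function.Injective (toPoly V ρ) := by
  rw [← LinearMap.ker_eq_bot, LinearMap.ker_eq_bot']
  intro v hv
  ext j
  have h := congrArg (fun P => P.coeff (j : ℕ)) hv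
  simp only [toPoly_apply, Polynomial.finsetSum_coeff, Polynomial.coeff_monomial,
    Polynomial.coeff_zero] at h
  rw [Finset.sum_eq_single j] at h
  · simpa using h
  · intro i _ hi
    rw [if_neg]
    intro hij
    exact hi (Fin.ext hij)
  · simp

theorem finrank_pi_submodule {R : Type*} [CommRing R] [Algebra K R] (V : Submodule K R) (ρ : ℕ)
    [Module.Finite K V] : Module.finrank K (Fin ρ → V) = ρ * Module.finrank K V := by
  rw [Module.finrank_pi_fintype]; simp

/-- The comparison of dimensions behind the degree bound: if every polynomial killed by `Θ` is a
multiple of `W`, the dimension of the polynomials of weighted degree at most `N` grows, from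
`N - ω` to `N`, by at most the dimension of the residue classes of degree at most `N`. The degree
`ρ` in `Z` tends to infinity. -/
theorem card_weightSet_le {d : ℕ} (hd : 0 < d) {D : Type*} [CommRing D] [Algebra K D]
    (Θ : Polynomial (MvPolynomial (Option (Fin m)) K) →ₗ[K] Polynomial D)
    (V : Submodule K D) [Module.Finite K V] (N : ℕ)
    (hΘ : ∀ H : Polynomial (MvPolynomial (Option (Fin m)) K), weightDegree d H ≤ N →
      (Θ H).natDegree ≤ H.natDegree + N ∧ ∀ j, (Θ H).coeff j ∈ V)
    (W : Polynomial (MvPolynomial (Option (Fin m)) K)) (hW0 : W ≠ 0)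
    (hW : ∀ H, Θ H = 0 → W ∣ H) (hN : weightDegree d W ≤ N) :
    Nat.card (weightSet m d N) ≤
      Nat.card (weightSet m d (N - weightDegree d W)) + Module.finrank K V := by
  have hfin : ∀ N, Module.Finite K (restrictSupport K (weightSet m d N)) := fun N =>
    have := finite_weightSet m d N hd
    finite_restrictSupport _
  have := hfin N
  have := hfin (N - weightDegree d W)
  have key : ∀ ρ : ℕ, ρ * Nat.card (weightSet m d N) ≤
      (ρ + N) * Module.finrank K V + ρ * Nat.card (weightSet m d (N - weightDegree d W)) := by
    intro ρ
    set t := toPoly (restrictSupport K (weightSet m d N)) ρ with ht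
    set φ := Θ ∘ₗ t with hφ
    have h1 := LinearMap.finrank_range_add_finrank_ker φ
    rw [finrank_pi_submodule, finrank_restrictSupport] at h1
    -- the image consists of polynomials in `z` of degree less than `ρ + N` over `V`
    have h2 : Module.finrank K (LinearMap.range φ) ≤ (ρ + N) * Module.finrank K V := by
      rw [← finrank_pi_submodule]
      refine (Submodule.finrank_mono (t := LinearMap.range (toPoly V (ρ + N))) ?_).trans
        (LinearMap.finrank_range_le _)
      rintro _ ⟨v, rfl⟩
      have hv : t v ∈ LinearMap.range t := ⟨v, rfl⟩
      rw [ht, mem_range_toPoly] at hv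
      have hv' := hΘ (t v) ((weightDegree_le_iff _ _ _).mpr hv.2)
      rw [mem_range_toPoly]
      refine ⟨?_, hv'.2⟩
      by_cases h0 : t v = 0
      · simp only [hφ, LinearMap.comp_apply, h0, map_zero, Polynomial.degree_zero]
        exact WithBot.bot_lt_coe _
      · have h3 := (Polynomial.natDegree_lt_iff_degree_lt h0).mpr hv.1
        refine lt_of_le_of_lt Polynomial.degree_le_natDegree ?_
        rw [hφ, LinearMap.comp_apply]
        exact_mod_cast lt_of_le_of_lt hv'.1 (Nat.add_lt_add_right h3 N)
    -- the kernel consists of multiples of `W`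
    have h3 : Module.finrank K (LinearMap.ker φ) ≤
        ρ * Nat.card (weightSet m d (N - weightDegree d W)) := by
      rw [← finrank_restrictSupport (K := K), ← finrank_pi_submodule]
      set ψ := LinearMap.mulLeft K W ∘ₗ
        toPoly (restrictSupport K (weightSet m d (N - weightDegree d W))) ρ with hψ
      have h4 : ∀ v : LinearMap.ker φ, (t ∘ₗ (LinearMap.ker φ).subtype) v ∈ LinearMap.range ψ := by
        intro v
        have hv : t v.1 ∈ LinearMap.range t := ⟨v.1, rfl⟩
        rw [ht, mem_range_toPoly] at hv
        obtain ⟨H, hH⟩ := hW (t v.1) (LinearMap.mem_ker.mp v.2)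
        have hH' : H ∈ LinearMap.range
            (toPoly (restrictSupport K (weightSet m d (N - weightDegree d W))) ρ) := by
          rw [mem_range_toPoly]
          by_cases hH0 : H = 0
          · rw [hH0]
            exact ⟨by rw [Polynomial.degree_zero]; exact WithBot.bot_lt_coe _, by simp⟩
          · constructor
            · refine lt_of_le_of_lt ?_ hv.1
              change H.degree ≤ (t v.1).degree
              rw [hH]
              exact Polynomial.degree_le_mul_left H hW0 |>.trans (by rw [mul_comm])
            · rw [← weightDegree_le_iff]
              have h5 := (weightDegree_le_iff d N (t v.1)).mpr hv.2
              rw [hH, weightDegree_mul d hW0 hH0] at h5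
              omega
        obtain ⟨u, hu⟩ := hH'
        refine ⟨u, ?_⟩
        rw [hψ, LinearMap.comp_apply, hu, LinearMap.mulLeft_apply, ← hH]
        rfl
      have h5 : Function.Injective (LinearMap.codRestrict (LinearMap.range ψ) _ h4) := by
        intro u v huv
        exact Subtype.ext (toPoly_injective _ _ (congrArg Subtype.val huv))
      exact (LinearMap.finrank_le_finrank_of_injective h5).trans (LinearMap.finrank_range_le _)
    omega
  -- `ρ a ≤ (ρ + N) r + ρ b` for all `ρ` gives `a ≤ r + b`
  by_contra! hlt
  set a := Nat.card (weightSet m d N)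
  set b := Nat.card (weightSet m d (N - weightDegree d W))
  set r := Module.finrank K V
  have h1 := key (N * r + 1)
  have h2 : (N * r + 1) * (b + r + 1) ≤ (N * r + 1) * a := Nat.mul_le_mul_left _ hlt
  nlinarith

end Rank

/-! ### Kernels of homomorphisms from polynomial rings -/

section PrincipalKernel

/-- The kernel of a homomorphism from `Q[X]` to a domain which is injective on the unique
factorization domain `Q` is generated by an irreducible factor of any of its nonzero elements
(Gauss's lemma). -/
theorem exists_irreducible_dvd_of_map_eq_zero {Q R : Type*} [CommRing Q] [IsDomain Q]
    [UniqueFactorizationMonoid Q] [CommRing R] [IsDomain R] (Θ : Polynomial Q →+* R)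
    (hinj : ∀ q : Q, Θ (Polynomial.C q) = 0 → q = 0) (G : Polynomial Q) (hG0 : G ≠ 0)
    (hG : Θ G = 0) :
    ∃ W : Polynomial Q, Irreducible W ∧ Θ W = 0 ∧ W ∣ G ∧ ∀ H, Θ H = 0 → W ∣ H := by
  classical
  let _ : StrongNormalizationMonoid Q := UniqueFactorizationMonoid.strongNormalizationMonoid
  let _ : NormalizedGCDMonoid Q := UniqueFactorizationMonoid.toNormalizedGCDMonoid Q
  obtain ⟨W, hWirr, hWG, hW⟩ : ∃ W : Polynomial Q, Irreducible W ∧ W ∣ G ∧ Θ W = 0 := by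
    obtain ⟨s, hs, u, hu⟩ := UniqueFactorizationMonoid.exists_prime_factors G hG0
    have h1 : Θ s.prod = 0 := by
      have := hG
      rw [← hu, map_mul] at this
      exact (mul_eq_zero.mp this).resolve_right (u.isUnit.map Θ).ne_zero
    rw [map_multiset_prod, Multiset.prod_eq_zero_iff, Multiset.mem_map] at h1
    obtain ⟨W, hWs, hW⟩ := h1
    exact ⟨W, (hs W hWs).irreducible, (Multiset.dvd_prod hWs).trans ⟨u, hu.symm⟩, hW⟩
  refine ⟨W, hWirr, hW, hWG, fun H hH => ?_⟩
  have hdeg : W.natDegree ≠ 0 := by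
    intro h
    have h1 := Polynomial.eq_C_of_natDegree_eq_zero h
    rw [h1] at hW
    have h2 := hinj _ hW
    rw [h2, map_zero] at h1
    exact hWirr.ne_zero h1
  have hprim : W.IsPrimitive := hWirr.isPrimitive hdeg
  let F := FractionRing Q
  by_contra hndvd
  have hirrF : Irreducible (W.map (algebraMap Q F)) :=
    hprim.irreducible_iff_irreducible_map_fraction_map.mp hWirr
  have hcop : IsCoprime (W.map (algebraMap Q F)) (H.map (algebraMap Q F)) := by
    rw [hirrF.coprime_iff_not_dvd]
    exact fun h => hndvd (hprim.dvd_of_fraction_map_dvd_fraction_map h)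
  obtain ⟨a, b, hab⟩ := hcop
  obtain ⟨c, hc, hca⟩ := IsLocalization.integerNormalization_spec (nonZeroDivisors Q) a
  obtain ⟨e, he, heb⟩ := IsLocalization.integerNormalization_spec (nonZeroDivisors Q) b
  set a' := IsLocalization.integerNormalization (nonZeroDivisors Q) a
  set b' := IsLocalization.integerNormalization (nonZeroDivisors Q) b
  have key : Polynomial.C e * a' * W + Polynomial.C c * b' * H = Polynomial.C (c * e) := by
    apply Polynomial.map_injective (algebraMap Q F) (IsFractionRing.injective Q F)
    simp only [Polynomial.map_add, Polynomial.map_mul, Polynomial.map_C, hca, heb,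
      Algebra.smul_def, Polynomial.algebraMap_apply, map_mul]
    linear_combination Polynomial.C (algebraMap Q F c) * Polynomial.C (algebraMap Q F e) * hab
  have h1 := congrArg Θ key
  rw [map_add, map_mul, map_mul, hW, map_mul, hH, mul_zero, mul_zero, add_zero] at h1
  have h2 := hinj _ h1.symm
  exact mul_ne_zero (nonZeroDivisors.ne_zero hc) (nonZeroDivisors.ne_zero he) h2

/-- A divisor of a polynomial in one of the variables involves no other variable. -/
theorem exists_eq_aeval_of_dvd_aeval {K σ : Type*} [Field K] (ψ : Polynomial K) (hψ : ψ ≠ 0)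
    (g : MvPolynomial (Option σ) K)
    (hg : g ∣ Polynomial.aeval (X none : MvPolynomial (Option σ) K) ψ) :
    ∃ φ : Polynomial K, φ ∣ ψ ∧ g = Polynomial.aeval (X none : MvPolynomial (Option σ) K) φ := by
  have hE : ∀ φ : Polynomial K,
      optionEquivRight K σ (Polynomial.aeval (X none : MvPolynomial (Option σ) K) φ) = C φ := by
    intro φ
    have : (optionEquivRight K σ).toAlgHom.comp (Polynomial.aeval (X none)) =
        (IsScalarTower.toAlgHom K (Polynomial K) (MvPolynomial σ (Polynomial K))) := by
      ext
      simp [MvPolynomial.algebraMap_eq]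
    exact DFunLike.congr_fun this φ
  obtain ⟨r, hr⟩ := hg
  have h1 : C ψ = optionEquivRight K σ g * optionEquivRight K σ r := by
    rw [← map_mul, ← hr, hE]
  have hne : optionEquivRight K σ g * optionEquivRight K σ r ≠ 0 := by
    rw [← h1]; simpa using hψ
  have h2 := totalDegree_mul_of_isDomain (left_ne_zero_of_mul hne) (right_ne_zero_of_mul hne)
  rw [← h1, totalDegree_C] at h2
  have h3 := totalDegree_eq_zero_iff_eq_C.mp
    (show (optionEquivRight K σ g).totalDegree = 0 by omega)
  have h4 := totalDegree_eq_zero_iff_eq_C.mp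
    (show (optionEquivRight K σ r).totalDegree = 0 by omega)
  refine ⟨coeff 0 (optionEquivRight K σ g), ⟨coeff 0 (optionEquivRight K σ r), ?_⟩, ?_⟩
  · apply C_injective σ (Polynomial K)
    rw [h1, h3, h4, ← C_mul]
    simp
  · apply (optionEquivRight K σ).injective
    rw [hE, ← h3]

/-- If `p` involves `X_j`, the other variables are algebraically independent modulo `p`, and `z` is
independent of them. -/
theorem succ_le_trdeg_polynomial_quotient {K : Type} [Field K] {m : ℕ}
    (p : MvPolynomial (Fin (m + 1)) K) (hp : Irreducible p) :
    ((m + 1 : ℕ) : Cardinal) ≤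
      Algebra.trdeg K (Polynomial (MvPolynomial (Fin (m + 1)) K ⧸ Ideal.span {p})) := by
  classical
  obtain ⟨j, hj⟩ : ∃ j, p.degreeOf j ≠ 0 := by
    by_contra! h
    have h1 : p.totalDegree = 0 := by
      rw [totalDegree_eq_zero_iff]
      intro s hs j
      exact Nat.le_zero.mp ((monomial_le_degreeOf j hs).trans (h j).le)
    have h2 := totalDegree_eq_zero_iff_eq_C.mp h1
    apply hp.not_isUnit
    rw [h2]
    refine (isUnit_iff_ne_zero.mpr ?_).map C
    intro h3
    rw [h3, C_0] at h2
    exact hp.ne_zero h2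
  let ι : MvPolynomial {i // i ≠ j} K →ₐ[K] MvPolynomial (Fin (m + 1)) K ⧸ Ideal.span {p} :=
    (Ideal.Quotient.mkₐ K (Ideal.span {p})).comp (rename Subtype.val)
  have hι : Function.Injective ι := by
    rw [injective_iff_map_eq_zero]
    intro q hq
    have h1 : p ∣ rename Subtype.val q :=
      Ideal.mem_span_singleton.mp (Ideal.Quotient.eq_zero_iff_mem.mp hq)
    by_contra hq0
    obtain ⟨r, hr⟩ := h1
    have hne : rename Subtype.val q ≠ 0 := by
      rwa [Ne, map_eq_zero_iff _ (rename_injective _ Subtype.val_injective)]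
    rw [hr] at hne
    have h2 := degreeOf_mul_eq (n := j) (left_ne_zero_of_mul hne) (right_ne_zero_of_mul hne)
    rw [← hr] at h2
    have h3 : (rename Subtype.val q : MvPolynomial (Fin (m + 1)) K).degreeOf j = 0 := by
      by_contra h4
      have h5 : j ∈ (rename Subtype.val q : MvPolynomial (Fin (m + 1)) K).vars := by
        rw [vars_def, Multiset.mem_toFinset, ← Multiset.count_pos, ← degreeOf_def]
        exact Nat.pos_of_ne_zero h4
      obtain ⟨i, _, hi⟩ := Finset.mem_image.mp (vars_rename _ _ h5)
      exact i.2 hi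
    omega
  let Φ : MvPolynomial (Option {i // i ≠ j}) K →ₐ[K]
      Polynomial (MvPolynomial (Fin (m + 1)) K ⧸ Ideal.span {p}) :=
    (Polynomial.mapAlgHom ι).comp (optionEquivLeft K {i // i ≠ j}).toAlgHom
  have hΦ : Function.Injective Φ :=
    Function.Injective.comp (g := Polynomial.mapAlgHom ι) (Polynomial.map_injective _ hι)
      (optionEquivLeft K {i // i ≠ j}).injective
  have hind : AlgebraicIndependent K fun o => Φ (X o) := by
    rw [AlgebraicIndependent, show aeval (fun o => Φ (X o)) = Φ by ext; simp]
    exact hΦ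
  have h1 := hind.cardinalMk_le_trdeg
  rw [Cardinal.mk_fintype] at h1
  convert h1 using 2
  simp

end PrincipalKernel

/-! ### Eliminants modulo an irreducible polynomial -/

section Eliminant

/-- The element `s` is integral over the subalgebra generated by the family `w`. The coefficients of
an equation of integral dependence are given as polynomials in the members of `w`, rather than as
elements of the subalgebra. -/
def IsIntegralOverFamily {K S ι : Type*} [Field K] [CommRing S] [Algebra K S] (w : ι → S) (s : S) :
    Prop :=
  (aeval w : MvPolynomial ι K →ₐ[K] S).toRingHom.IsIntegralElem s

namespace IsIntegralOverFamily

variable {K S ι : Type*} [Field K] [CommRing S] [Algebra K S] {w : ι → S} {s t : S}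

theorem of_mem_range (q : MvPolynomial ι K) (h : aeval w q = s) :
    IsIntegralOverFamily (K := K) w s := by
  rw [← h]
  exact (aeval w : MvPolynomial ι K →ₐ[K] S).toRingHom.isIntegralElem_map

theorem add (hs : IsIntegralOverFamily (K := K) w s) (ht : IsIntegralOverFamily (K := K) w t) :
    IsIntegralOverFamily (K := K) w (s + t) :=
  RingHom.IsIntegralElem.add _ hs ht

theorem sub (hs : IsIntegralOverFamily (K := K) w s) (ht : IsIntegralOverFamily (K := K) w t) :
    IsIntegralOverFamily (K := K) w (s - t) :=
  RingHom.IsIntegralElem.sub _ hs ht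

theorem mul (hs : IsIntegralOverFamily (K := K) w s) (ht : IsIntegralOverFamily (K := K) w t) :
    IsIntegralOverFamily (K := K) w (s * t) :=
  RingHom.IsIntegralElem.mul _ hs ht

theorem sum {κ : Type*} (u : Finset κ) (g : κ → S)
    (h : ∀ i ∈ u, IsIntegralOverFamily (K := K) w (g i)) :
    IsIntegralOverFamily (K := K) w (∑ i ∈ u, g i) :=
  Finset.sum_induction _ _ (fun _ _ => add) (of_mem_range 0 (map_zero _)) h

theorem map {S' : Type*} [CommRing S'] [Algebra K S'] (f : S →ₐ[K] S')
    (hs : IsIntegralOverFamily (K := K) w s) :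
    IsIntegralOverFamily (K := K) (fun i => f (w i)) (f s) := by
  have h := RingHom.IsIntegralElem.map hs f.toRingHom
  have he : f.toRingHom.comp (aeval w : MvPolynomial ι K →ₐ[K] S).toRingHom =
      (aeval fun i => f (w i) : MvPolynomial ι K →ₐ[K] S').toRingHom := by
    ext <;> simp
  rw [he] at h
  exact h

end IsIntegralOverFamily

theorem isIntegralOverFamily_of_isIntegral {K S ι : Type*} [Field K] [CommRing S] [Algebra K S]
    (w : ι → S) (s : S) (hs : IsIntegral (Algebra.adjoin K (Set.range w)) s) :
    IsIntegralOverFamily (K := K) w s := by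
  obtain ⟨P, hP, hP0⟩ := hs
  have hmem : ∀ q : MvPolynomial ι K, aeval w q ∈ Algebra.adjoin K (Set.range w) := by
    intro q
    rw [Algebra.adjoin_range_eq_range_aeval]
    exact ⟨q, rfl⟩
  let ρ : MvPolynomial ι K →ₐ[K] Algebra.adjoin K (Set.range w) :=
    (aeval w).codRestrict _ hmem
  have hρ : Function.Surjective ρ := by
    rintro ⟨r, hr⟩
    have hr' := hr
    rw [Algebra.adjoin_range_eq_range_aeval] at hr'
    obtain ⟨q, hq⟩ := hr'
    exact ⟨q, Subtype.ext hq⟩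
  obtain ⟨g, hg, _, hgm⟩ := Polynomial.lifts_and_natDegree_eq_and_monic
    (f := ρ.toRingHom) (p := P) (by
      rw [Polynomial.lifts_iff_coeff_lifts]
      exact fun j => hρ _) hP
  refine ⟨g, hgm, ?_⟩
  rw [← hg, Polynomial.eval₂_map] at hP0
  exact hP0

theorem IsIntegralOverFamily.isAlgebraic_adjoin {K S ι : Type*} [Field K] [CommRing S] [IsDomain S]
    [Algebra K S] (w : ι → S) (s : S)
    (hs : IsIntegralOverFamily (K := K) w s) :
    IsAlgebraic (Algebra.adjoin K (Set.range w)) s := by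
  refine IsIntegral.isAlgebraic ?_
  have hmem : ∀ q : MvPolynomial ι K, aeval w q ∈ Algebra.adjoin K (Set.range w) := by
    intro q
    rw [Algebra.adjoin_range_eq_range_aeval]
    exact ⟨q, rfl⟩
  let ρ : MvPolynomial ι K →ₐ[K] Algebra.adjoin K (Set.range w) :=
    (aeval w).codRestrict _ hmem
  obtain ⟨P, hP, hP0⟩ := hs
  exact ⟨P.map ρ.toRingHom, hP.map _, (Polynomial.eval₂_map _ _ _).trans hP0⟩

/-- A family `w` with at most as many members as the transcendence degree is algebraically
independent as soon as the algebra is generated by elements integral over `K[w]` and one further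
element `z` which is a quotient of such elements. -/
theorem algebraicIndependent_of_isIntegralOverFamily {K S ι : Type} [Field K] [CommRing S]
    [IsDomain S] [Algebra K S] [Fintype ι] (w : ι → S) (B : Set S) (z a : S)
    (hB : ∀ b ∈ B, IsIntegralOverFamily (K := K) w b)
    (ha : a ∈ B) (ha0 : a ≠ 0)
    (haz : IsIntegralOverFamily (K := K) w (a * z))
    (hgen : ∀ T : Subring S, B ⊆ T → z ∈ T → T = ⊤)
    (hcard : (Fintype.card ι : Cardinal) ≤ Algebra.trdeg K S) : AlgebraicIndependent K w := by
  have hz : IsAlgebraic (Algebra.adjoin K (Set.range w)) z :=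
    IsAlgebraic.of_mul (y := a) (mem_nonZeroDivisors_iff_ne_zero.mpr ha0)
      (IsIntegralOverFamily.isAlgebraic_adjoin w _ (hB a ha))
      (IsIntegralOverFamily.isAlgebraic_adjoin w _ haz)
  have htop := hgen (Subalgebra.algebraicClosure (Algebra.adjoin K (Set.range w)) S).toSubring
    (fun b hb => IsIntegralOverFamily.isAlgebraic_adjoin w _ (hB b hb)) hz
  have halg : Algebra.IsAlgebraic (Algebra.adjoin K (Set.range w)) S := by
    refine ⟨fun s => ?_⟩
    have : s ∈ (Subalgebra.algebraicClosure (Algebra.adjoin K (Set.range w)) S).toSubring := by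
      rw [htop]; trivial
    exact this
  refine (Algebra.IsAlgebraic.isTranscendenceBasis_of_le_trdeg_of_finite K w ?_).1
  rwa [Cardinal.mk_fintype]

theorem coeff_single_none_aeval {K σ : Type*} [Field K] (φ : Polynomial K) (k : ℕ) :
    coeff (Finsupp.single none k) (Polynomial.aeval (X none : MvPolynomial (Option σ) K) φ) =
      φ.coeff k := by
  classical
  induction φ using Polynomial.induction_on' with
  | add p q hp hq => simp [hp, hq]
  | monomial n a =>
    rw [Polynomial.aeval_monomial, MvPolynomial.algebraMap_eq, X_pow_eq_monomial, C_mul_monomial,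
      mul_one, coeff_monomial, Polynomial.coeff_monomial]
    by_cases h : n = k
    · simp [h]
    · rw [if_neg h, if_neg]
      intro h2
      exact h (Finsupp.single_injective none h2)

variable {K : Type} [Field K] {m d : ℕ}

/-- The generators `l` and `F_i z + l'_i`, the images of `U` and of the `T_i`. -/
noncomputable def perturbation {n : ℕ} (F : Fin m → MvPolynomial (Fin n) K)
    (l : MvPolynomial (Fin n) K) (l' : Fin m → MvPolynomial (Fin n) K) :
    Option (Fin m) → Polynomial (MvPolynomial (Fin n) K) :=
  fun o => o.elim (Polynomial.C l) fun i => Polynomial.C (F i) * Polynomial.X + Polynomial.C (l' i)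

/-- The substitution of `perturbation` for `U`, `T_i` and of `z` for `Z`. -/
noncomputable def perturbationHom {n : ℕ} (F : Fin m → MvPolynomial (Fin n) K)
    (l : MvPolynomial (Fin n) K) (l' : Fin m → MvPolynomial (Fin n) K) :
    Polynomial (MvPolynomial (Option (Fin m)) K) →ₐ[K] Polynomial (MvPolynomial (Fin n) K) :=
  Polynomial.eval₂AlgHom (aeval (perturbation F l l')) Polynomial.X fun _ => Commute.all _ _

/-- As `U` and the `T_i` are themselves mapped to polynomials in `z`, all coefficients of `H` from
the constant one to the `i`-th contribute to the coefficient of `z ^ i`. -/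
theorem coeff_perturbationHom {n : ℕ} (F : Fin m → MvPolynomial (Fin n) K)
    (l : MvPolynomial (Fin n) K) (l' : Fin m → MvPolynomial (Fin n) K)
    (H : Polynomial (MvPolynomial (Option (Fin m)) K)) (i : ℕ) :
    (perturbationHom F l l' H).coeff i = ∑ j ∈ Finset.range (H.natDegree + 1),
      if j ≤ i then (aeval (perturbation F l l') (H.coeff j)).coeff (i - j) else 0 := by
  change (Polynomial.eval₂ (aeval (perturbation F l l')).toRingHom Polynomial.X H).coeff i = _
  rw [Polynomial.eval₂_eq_sum_range, Polynomial.finsetSum_coeff]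
  simp only [Polynomial.coeff_mul_X_pow']
  rfl

theorem perturbationHom_coeff_zero_aeval {n : ℕ} (F : Fin m → MvPolynomial (Fin n) K)
    (l : MvPolynomial (Fin n) K) (l' : Fin m → MvPolynomial (Fin n) K) (φ : Polynomial K) :
    aeval (perturbation F l l') (Polynomial.aeval (X none : MvPolynomial (Option (Fin m)) K) φ) =
      Polynomial.C (Polynomial.aeval l φ) := by
  rw [← Polynomial.aeval_algHom_apply, aeval_X]
  have h := Polynomial.aeval_algHom_apply
    ((Polynomial.CAlgHom : MvPolynomial (Fin n) K →ₐ[MvPolynomial (Fin n) K] _).restrictScalars K)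
    l φ
  exact h

/-- The eliminant of the system `p = F_1 = ⋯ = F_m = 0` with respect to the linear form `l`, for an
irreducible `p`. It is the leading coefficient of the minimal relation `W` between `z`, `l` and
the `F_i z + l'_i` modulo `p`. Some power of `ψ` is a multiple of it since
`ψ(l) z` is integral over the algebra generated by the latter, and its degree is at most the
weighted degree of `W`. The coefficient of the highest power of `z` in the relation exhibits the
eliminant as a combination of the `F_i` modulo `p`. -/
theorem exists_eliminant_of_irreducible (hd : 0 < d) (p : MvPolynomial (Fin (m + 1)) K)
    (hp : Irreducible p) (F : Fin m → MvPolynomial (Fin (m + 1)) K)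
    (hF : ∀ i, (F i).totalDegree ≤ d)
    (l : MvPolynomial (Fin (m + 1)) K) (hl : l.totalDegree ≤ 1)
    (l' : Fin m → MvPolynomial (Fin (m + 1)) K) (hl' : ∀ i, (l' i).totalDegree ≤ 1)
    (ψ : Polynomial K) (hψ : ψ ≠ 0)
    (h : Fin m → MvPolynomial (Fin (m + 1)) K)
    (hψF : p ∣ Polynomial.aeval l ψ - ∑ i, h i * F i)
    (hFp : ∃ i, ¬ p ∣ F i)
    (hint : ∀ j, IsIntegralOverFamily (K := K) (fun o =>
      Polynomial.mapAlgHom (Ideal.Quotient.mkₐ K (Ideal.span {p})) (perturbation F l l' o))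
        (Polynomial.C (Ideal.Quotient.mk (Ideal.span {p}) (X j)))) :
    ∃ φ : Polynomial K, (∃ k, φ ∣ ψ ^ k) ∧ φ.natDegree ≤ p.totalDegree * d ^ m ∧
      ∃ y ∈ boundedCombos F d (p.totalDegree * d ^ m), p ∣ Polynomial.aeval l φ - y := by
  classical
  have hprime : (Ideal.span {p}).IsPrime := (Ideal.span_singleton_prime hp.ne_zero).mpr hp.prime
  let mk := Ideal.Quotient.mkₐ K (Ideal.span {p})
  let π := Polynomial.mapAlgHom mk
  let w := fun o => π (perturbation F l l' o)
  let Θ := π.comp (perturbationHom F l l')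
  have hmk0 : ∀ a, mk a = 0 ↔ p ∣ a := fun a =>
    Ideal.Quotient.eq_zero_iff_mem.trans Ideal.mem_span_singleton
  have hΘC : ∀ q, Θ (Polynomial.C q) = aeval w q := by
    intro q
    have h1 : π.comp (aeval (perturbation F l l')) = aeval w := by ext; simp [w]
    rw [← h1]
    simp [Θ, perturbationHom]
  have hΘcoeff : ∀ H i, (Θ H).coeff i = mk ((perturbationHom F l l' H).coeff i) := by
    intro H i
    simp [Θ, π]
  have hΘX : Θ Polynomial.X = Polynomial.X := by
    simp [Θ, perturbationHom, π]
  have hCI : ∀ a, IsIntegralOverFamily (K := K) w (Polynomial.C (mk a)) := by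
    intro a
    induction a using MvPolynomial.induction_on with
    | C a =>
      refine .of_mem_range (C a) ?_
      rw [aeval_C, Polynomial.algebraMap_apply]
      congr 1
    | add a b ha hb => rw [map_add, map_add]; exact ha.add hb
    | mul_X a j ha => rw [map_mul, map_mul]; exact ha.mul (hint j)
  have hFz : ∀ i, IsIntegralOverFamily (K := K) w (Polynomial.C (mk (F i)) * Polynomial.X) := by
    intro i
    have h0 : IsIntegralOverFamily (K := K) w (w (some i)) :=
      .of_mem_range (X (some i)) (aeval_X w (some i))
    have h1 := h0.sub (hCI (l' i))
    simpa [w, π, mk, perturbation] using h1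
  have hindep : AlgebraicIndependent K w := by
    obtain ⟨i, hi⟩ := hFp
    refine algebraicIndependent_of_isIntegralOverFamily w (Set.range fun a => Polynomial.C (mk a))
      Polynomial.X (Polynomial.C (mk (F i))) ?_ ⟨_, rfl⟩ ?_ (hFz i) ?_ ?_
    · rintro _ ⟨a, rfl⟩
      exact hCI a
    · rw [Ne, Polynomial.C_eq_zero, hmk0]
      exact hi
    · intro T hT hX
      rw [eq_top_iff]
      rintro s -
      induction s using Polynomial.induction_on' with
      | add s t hs ht => exact T.add_mem hs ht
      | monomial n a =>
        rw [← Polynomial.C_mul_X_pow_eq_monomial]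
        obtain ⟨a, rfl⟩ := Ideal.Quotient.mk_surjective a
        exact T.mul_mem (hT ⟨a, rfl⟩) (T.pow_mem hX n)
    · refine le_trans (le_of_eq ?_) (succ_le_trdeg_polynomial_quotient p hp)
      simp
  -- `ψ(l) z` is integral, being a combination of the `F_i z`
  have hv : IsIntegralOverFamily (K := K) w
      (Polynomial.C (mk (Polynomial.aeval l ψ)) * Polynomial.X) := by
    have h1 : mk (Polynomial.aeval l ψ) = ∑ i, mk (h i) * mk (F i) := by
      have := (hmk0 _).mpr hψF
      rw [map_sub, sub_eq_zero] at this
      rw [this, map_sum]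
      simp only [map_mul]
    rw [h1, map_sum, Finset.sum_mul]
    refine .sum _ _ fun i _ => ?_
    rw [map_mul, mul_assoc]
    exact (hCI _).mul (hFz i)
  obtain ⟨g, hg, hg0⟩ := hv
  set c : MvPolynomial (Option (Fin m)) K := Polynomial.aeval (X none) ψ with hc
  have hc0 : c ≠ 0 := by
    intro h0
    apply hψ
    ext k
    rw [← coeff_single_none_aeval (σ := Fin m), ← hc, h0, coeff_zero, Polynomial.coeff_zero]
  have hΘc : Θ (Polynomial.C c) = Polynomial.C (mk (Polynomial.aeval l ψ)) := by
    change π (perturbationHom F l l' (Polynomial.C c)) = _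
    have : perturbationHom F l l' (Polynomial.C c) = aeval (perturbation F l l') c := by
      simp [perturbationHom]
    rw [this, hc, perturbationHom_coeff_zero_aeval]
    simp [π]
  have hdegcX : (Polynomial.C c * Polynomial.X).natDegree = 1 :=
    Polynomial.natDegree_C_mul_X c hc0
  -- the equation of `ψ(l) z`, read as an equation for `z`; its leading coefficient is a power of
  -- `ψ(U)`
  set G := g.comp (Polynomial.C c * Polynomial.X) with hG
  have hGlc : G.leadingCoeff = c ^ g.natDegree := by
    rw [hG, Polynomial.leadingCoeff_comp (by rw [hdegcX]; exact one_ne_zero), hg.leadingCoeff,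
      one_mul, Polynomial.leadingCoeff_C_mul_X]
  have hG0 : G ≠ 0 := by
    rw [← Polynomial.leadingCoeff_ne_zero, hGlc]
    exact pow_ne_zero _ hc0
  have hΘG : Θ G = 0 := by
    have h1 : ∀ P : Polynomial (MvPolynomial (Option (Fin m)) K),
        Θ (P.comp (Polynomial.C c * Polynomial.X)) = Polynomial.eval₂ (aeval w).toRingHom
          (Polynomial.C (mk (Polynomial.aeval l ψ)) * Polynomial.X) P := by
      intro P
      induction P using Polynomial.induction_on' with
      | add s t hs ht => rw [Polynomial.add_comp, map_add, hs, ht, Polynomial.eval₂_add]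
      | monomial n a =>
        rw [Polynomial.monomial_comp, map_mul, hΘC, map_pow, map_mul, hΘc, hΘX,
          Polynomial.eval₂_monomial]
        rfl
    exact (h1 g).trans hg0
  have hΘinj : ∀ q, Θ (Polynomial.C q) = 0 → q = 0 := fun q hq =>
    hindep (by rw [map_zero, ← hΘC]; exact hq)
  obtain ⟨W, hWirr, hΘW, hWG, hW⟩ := exists_irreducible_dvd_of_map_eq_zero
    (R := Polynomial (MvPolynomial (Fin (m + 1)) K ⧸ Ideal.span {p})) Θ.toRingHom hΘinj G hG0 hΘG
  obtain ⟨φ, hφ, hWφ⟩ := exists_eq_aeval_of_dvd_aeval (ψ ^ g.natDegree) (pow_ne_zero _ hψ)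
    W.leadingCoeff (by
      rw [map_pow, ← hc, ← hGlc]
      exact Polynomial.leadingCoeff_dvd_leadingCoeff hWG)
  -- the weighted degree of `W` is bounded by comparing dimensions
  have hcoeff : ∀ (N : ℕ) (H : Polynomial (MvPolynomial (Option (Fin m)) K)),
      weightDegree d H ≤ N → ∀ j, aeval (perturbation F l l') (H.coeff j) ∈ zFiltration F d N :=
    fun N H hH j => aeval_mem_zFiltration hd hF hl hl' ((weightDegree_le_iff d N H).mp hH j)
  have hω : weightDegree d W ≤ p.totalDegree * d ^ m := by
    refine le_mul_pow_of_simplexCard_le m d _ _ p.totalDegree hd fun L hL => ?_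
    have hN : p.totalDegree ≤ d * L + weightDegree d W :=
      hL.trans ((Nat.le_mul_of_pos_left L hd).trans (Nat.le_add_right _ _))
    have h1 := card_weightSet_le hd Θ.toLinearMap
      (classFiltration p (d * L + weightDegree d W)) (d * L + weightDegree d W) (by
        intro H hH
        have h2 := hcoeff _ H hH
        constructor
        · refine (Polynomial.natDegree_map_le).trans ?_
          rw [Polynomial.natDegree_le_iff_coeff_eq_zero]
          intro i hi
          change (perturbationHom F l l' H).coeff i = 0
          rw [coeff_perturbationHom]
          refine Finset.sum_eq_zero fun j hj => ?_
          split_ifs with hji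
          · have hj' := Finset.mem_range.mp hj
            exact Polynomial.coeff_eq_zero_of_natDegree_lt
              (lt_of_le_of_lt (h2 j).1 (by omega))
          · rfl
        · intro i
          refine ⟨(perturbationHom F l l' H).coeff i, ?_, ?_⟩
          · rw [SetLike.mem_coe, mem_restrictSupport_degreeSet, coeff_perturbationHom]
            refine totalDegree_finsetSum_le fun j _ => ?_
            split_ifs
            · exact (h2 j).2.1 _
            · simp
          · exact (hΘcoeff H i).symm) W hWirr.ne_zero hW (Nat.le_add_left _ _)
    rw [Nat.add_sub_cancel] at h1
    have h2 := card_weightSet_add_le m d L (weightDegree d W) hd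
    have h3 := finrank_classFiltration_le p hp.ne_zero _ hN
    omega
  refine ⟨φ, ⟨_, hφ⟩, ?_, ?_⟩
  · refine le_trans ?_ hω
    have h1 := (weightDegree_le_iff d _ W).mp le_rfl W.natDegree
    change W.leadingCoeff ∈ _ at h1
    rw [hWφ] at h1
    have hφ0 : φ ≠ 0 := ne_zero_of_dvd_ne_zero (pow_ne_zero _ hψ) hφ
    have h2 := h1 (mem_support_iff.mpr (show coeff (Finsupp.single none φ.natDegree)
      (Polynomial.aeval (X none) φ) ≠ 0 by
        rw [coeff_single_none_aeval]; exact Polynomial.leadingCoeff_ne_zero.mpr hφ0))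
    have h3 : Finsupp.single (none : Option (Fin m)) φ.natDegree none +
      d * ∑ i : Fin m, Finsupp.single (none : Option (Fin m)) φ.natDegree (some i) ≤
        weightDegree d W := h2
    rw [Finsupp.single_eq_same] at h3
    omega
  · refine ⟨-∑ j ∈ Finset.range W.natDegree,
      (aeval (perturbation F l l') (W.coeff j)).coeff (W.natDegree - j), ?_, ?_⟩
    · refine Submodule.neg_mem _ (Submodule.sum_mem _ fun j hj => ?_)
      have hj' := Finset.mem_range.mp hj
      exact (hcoeff _ W hω j).2.2 _ (by omega)
    · have h1 : p ∣ (perturbationHom F l l' W).coeff W.natDegree := by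
        rw [← hmk0]
        rw [← hΘcoeff, show Θ W = 0 from hΘW, Polynomial.coeff_zero]
      have h2 : (perturbationHom F l l' W).coeff W.natDegree = ∑ j ∈ Finset.range W.natDegree,
          (aeval (perturbation F l l') (W.coeff j)).coeff (W.natDegree - j) +
            Polynomial.aeval l φ := by
        rw [coeff_perturbationHom, Finset.sum_range_succ, if_pos le_rfl, Nat.sub_self,
          show W.coeff W.natDegree = W.leadingCoeff from rfl, hWφ,
          perturbationHom_coeff_zero_aeval, Polynomial.coeff_C_zero]
        congr 1
        exact Finset.sum_congr rfl fun j hj => if_pos (Finset.mem_range.mp hj).le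
      rw [h2] at h1
      rwa [sub_neg_eq_add, add_comm (Polynomial.aeval l φ)]

end Eliminant

/-! ### Eliminants modulo an arbitrary polynomial -/

section EliminantOfProduct

variable {K : Type} [Field K] {m d : ℕ}

theorem totalDegree_aeval_le_natDegree {n : ℕ} {l : MvPolynomial (Fin n) K}
    (hl : l.totalDegree ≤ 1) (φ : Polynomial K) :
    (Polynomial.aeval l φ).totalDegree ≤ φ.natDegree := by
  rw [Polynomial.aeval_eq_sum_range]
  refine totalDegree_finsetSum_le fun i hi => (totalDegree_smul_le _ _).trans ?_
  refine (totalDegree_pow _ _).trans ?_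
  have := Finset.mem_range.mp hi
  nlinarith

/-- The eliminant of the system `f = F_1 = ⋯ = F_m = 0` with respect to `l`, obtained by
multiplying the eliminants belonging to the irreducible factors of `f`. -/
theorem exists_eliminant (hd : 0 < d) (f : MvPolynomial (Fin (m + 1)) K)
    (hf : f ≠ 0) (F : Fin m → MvPolynomial (Fin (m + 1)) K)
    (hF : ∀ i, (F i).totalDegree ≤ d)
    (l : MvPolynomial (Fin (m + 1)) K) (hl : l.totalDegree ≤ 1)
    (l' : Fin m → MvPolynomial (Fin (m + 1)) K) (hl' : ∀ i, (l' i).totalDegree ≤ 1)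
    (ψ : Polynomial K) (hψ : ψ ≠ 0)
    (h : Fin m → MvPolynomial (Fin (m + 1)) K)
    (hψF : f ∣ Polynomial.aeval l ψ - ∑ i, h i * F i)
    (hFp : ∀ p, Irreducible p → p ∣ f → ∃ i, ¬ p ∣ F i)
    (hint : ∀ j, IsIntegralOverFamily (K := K) (fun o =>
      Polynomial.mapAlgHom (Ideal.Quotient.mkₐ K (Ideal.span {f})) (perturbation F l l' o))
        (Polynomial.C (Ideal.Quotient.mk (Ideal.span {f}) (X j)))) :
    ∃ φ : Polynomial K, (∃ k, φ ∣ ψ ^ k) ∧ φ.natDegree ≤ f.totalDegree * d ^ m ∧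
      ∃ y ∈ boundedCombos F d (f.totalDegree * d ^ m), f ∣ Polynomial.aeval l φ - y := by
  suffices H : ∀ g : MvPolynomial (Fin (m + 1)) K, g ∣ f →
      ∃ φ : Polynomial K, (∃ k, φ ∣ ψ ^ k) ∧ φ.natDegree ≤ g.totalDegree * d ^ m ∧
      ∃ y ∈ boundedCombos F d (g.totalDegree * d ^ m), g ∣ Polynomial.aeval l φ - y from
    H f dvd_rfl
  intro g
  induction g using UniqueFactorizationMonoid.induction_on_prime with
  | h₁ => intro h0; exact absurd (zero_dvd_iff.mp h0) hf
  | h₂ u hu => exact fun _ => ⟨1, ⟨0, one_dvd _⟩, by simp, 0, Submodule.zero_mem _, hu.dvd⟩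
  | h₃ g p hg0 hp ih =>
    intro hpg
    obtain ⟨φ, ⟨k, hk⟩, hφd, y, hy, hyφ⟩ := ih ((dvd_mul_left g p).trans hpg)
    have hpf : p ∣ f := (dvd_mul_right p g).trans hpg
    have hle : Ideal.span {f} ≤ Ideal.span {p} := by
      rw [Ideal.span_singleton_le_span_singleton]; exact hpf
    obtain ⟨φ', ⟨k', hk'⟩, hφd', y', hy', hyφ'⟩ :=
      exists_eliminant_of_irreducible hd p hp.irreducible F hF l hl l' hl' ψ hψ h
        (hpf.trans hψF) (hFp p hp.irreducible hpf) (by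
          intro j
          have h1 := (hint j).map
            (S' := Polynomial (MvPolynomial (Fin (m + 1)) K ⧸ Ideal.span {p}))
            (Polynomial.mapAlgHom (Ideal.Quotient.factorₐ K hle))
          have h2 : ∀ P : Polynomial (MvPolynomial (Fin (m + 1)) K),
              Polynomial.mapAlgHom (Ideal.Quotient.factorₐ K hle)
                (Polynomial.mapAlgHom (Ideal.Quotient.mkₐ K (Ideal.span {f})) P) =
              Polynomial.mapAlgHom (Ideal.Quotient.mkₐ K (Ideal.span {p})) P := by
            intro P
            ext i
            simp
          simp only [h2] at h1
          convert h1 using 1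
          simp)
    have hdeg : (p * g).totalDegree = p.totalDegree + g.totalDegree :=
      totalDegree_mul_of_isDomain hp.ne_zero hg0
    refine ⟨φ' * φ, ⟨k' + k, by rw [pow_add]; exact mul_dvd_mul hk' hk⟩, ?_, ?_⟩
    · refine Polynomial.natDegree_mul_le.trans ?_
      rw [hdeg, add_mul]
      exact Nat.add_le_add hφd' hφd
    · -- `φ' φ = φ' y + (φ' - y') (φ - y) + y' (φ - y)`, and the middle term is divisible by `p g`
      refine ⟨Polynomial.aeval l φ' * y + (Polynomial.aeval l φ - y) * y', ?_, ?_⟩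
      · rw [hdeg, add_mul]
        refine Submodule.add_mem _ ?_ ?_
        · rw [add_comm (p.totalDegree * d ^ m)]
          exact mul_mem_boundedCombos hy ((totalDegree_aeval_le_natDegree hl φ').trans hφd')
        · refine mul_mem_boundedCombos hy' ((totalDegree_sub _ _).trans (max_le ?_ ?_))
          · exact (totalDegree_aeval_le_natDegree hl φ).trans hφd
          · exact totalDegree_le_of_mem_boundedCombos hF hy
      · have := mul_dvd_mul hyφ' hyφ
        rw [map_mul]
        convert this using 1
        ring

end EliminantOfProduct

/-! ### General linear combinations -/

section Selection

variable {K R ι : Type*} [Field K] [Infinite K] [CommRing R] [Algebra K R] [Fintype ι]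

/-- Prime avoidance for linear combinations over an infinite field. -/
theorem exists_sum_smul_notMem (G : ι → R) (P : Set (Ideal R)) (hP : P.Finite)
    (h : ∀ p ∈ P, ∃ j, G j ∉ p) : ∃ a : ι → K, ∀ p ∈ P, ∑ j, a j • G j ∉ p := by
  classical
  let φ : (ι → K) →ₗ[K] R := Fintype.linearCombination K G
  let W : Ideal R → Submodule K (ι → K) := fun p => (p.restrictScalars K).comap φ
  have hW : ⊤ ∉ hP.toFinset.image W := by
    intro h0
    obtain ⟨p, hp, hpW⟩ := Finset.mem_image.mp h0
    obtain ⟨j, hj⟩ := h p (hP.mem_toFinset.mp hp)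
    have h1 : Pi.single j 1 ∈ W p := hpW ▸ Submodule.mem_top
    refine hj ?_
    simpa [W, φ, Fintype.linearCombination_apply, Pi.single_apply] using h1
  have h1 := Subspace.biUnion_ne_univ_of_top_notMem hW
  obtain ⟨a, ha⟩ := (Set.ne_univ_iff_exists_notMem _).mp h1
  refine ⟨a, fun p hp hap => ha ?_⟩
  simp only [Set.mem_iUnion]
  exact ⟨W p, Finset.mem_image_of_mem _ (hP.mem_toFinset.mpr hp), hap⟩

/-- If no prime containing `f` contains every `G j`, then successive general linear combinations
of the `G j` cut down the dimension of `f = 0` one step at a time. -/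
theorem exists_combinations_height [IsDomain R] [IsNoetherianRing R] (f : R) (hf : f ≠ 0)
    (G : ι → R) (hG : ∀ q : Ideal R, q.IsPrime → f ∈ q → ∃ j, G j ∉ q)
    (P : Set (Ideal R)) (hP : P.Finite) (h : ∀ p ∈ P, ∃ j, G j ∉ p) (r : ℕ) :
    ∃ a : Fin r → ι → K, (∀ i, ∀ p ∈ P, ∑ j, a i j • G j ∉ p) ∧
      ∀ q : Ideal R, q.IsPrime → f ∈ q → (∀ i, ∑ j, a i j • G j ∈ q) →
        ((r + 1 : ℕ) : ℕ∞) ≤ q.height := by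
  induction r with
  | zero =>
    refine ⟨Fin.elim0, fun i => i.elim0, fun q hq hfq _ => ?_⟩
    have hlt : (⊥ : Ideal R) < q := bot_lt_iff_ne_bot.mpr fun h0 => hf (by simpa [h0] using hfq)
    have := Ideal.height_add_one_le_of_lt_of_isPrime hlt
    simpa using le_trans le_add_self this
  | succ r ih =>
    obtain ⟨a, haP, ha⟩ := ih
    let I : Ideal R := Ideal.span {f} ⊔ Ideal.span (Set.range fun i => ∑ j, a i j • G j)
    have hfI : f ∈ I := Ideal.mem_sup_left (Ideal.mem_span_singleton_self f)
    obtain ⟨b, hb⟩ := exists_sum_smul_notMem (K := K) G (P ∪ I.minimalPrimes)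
      (hP.union (Ideal.finite_minimalPrimes_of_isNoetherianRing R I)) (by
        rintro p (hp | hp)
        · exact h p hp
        · exact hG p hp.1.1 (hp.1.2 hfI))
    refine ⟨Fin.snoc a b, fun i => ?_, fun q hq hfq hq' => ?_⟩
    · induction i using Fin.lastCases with
      | last => simpa using fun p hp => hb p (Or.inl hp)
      | cast i => simpa using haP i
    · have hIq : I ≤ q := by
        refine sup_le ((Ideal.span_singleton_le_iff_mem _).mpr hfq) (Ideal.span_le.mpr ?_)
        rintro _ ⟨i, rfl⟩
        simpa using hq' i.castSucc
      obtain ⟨q₀, hq₀, hle⟩ := Ideal.exists_minimalPrimes_le hIq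
      have hlt : q₀ < q := by
        refine lt_of_le_of_ne hle ?_
        rintro rfl
        exact hb q₀ (Or.inr hq₀) (by simpa using hq' (Fin.last r))
      have := hq₀.1.1
      have h1 := Ideal.height_add_one_le_of_lt_of_isPrime hlt
      have h2 := ha q₀ hq₀.1.1 (hq₀.1.2 hfI) fun i =>
        hq₀.1.2 (Ideal.mem_sup_right (Ideal.subset_span ⟨i, rfl⟩))
      refine le_trans ?_ h1
      push_cast at h2 ⊢
      gcongr

end Selection

/-! ### Zeros of polynomial systems -/

section FiniteZeroSet

variable {n : ℕ}

theorem ker_eval_injective {K : Type*} [Field K] :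
    Function.Injective fun x : Fin n → K => RingHom.ker (eval x) := by
  intro x y h
  funext i
  have h1 : X i - C (x i) ∈ RingHom.ker (eval y) := by
    rw [← show RingHom.ker (eval x) = RingHom.ker (eval y) from h]; simp [RingHom.mem_ker]
  rw [RingHom.mem_ker] at h1
  simp only [map_sub, eval_X, eval_C] at h1
  exact (sub_eq_zero.mp h1).symm

/-- A system all of whose primes have height at least the number of variables has finitely many
zeros. -/
theorem finite_zeros_of_le_height {K : Type*} [Field K] (I : Ideal (MvPolynomial (Fin n) K))
    (h : ∀ q : Ideal (MvPolynomial (Fin n) K), q.IsPrime → I ≤ q → (n : ℕ∞) ≤ q.height) :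
    {x : Fin n → K | I ≤ RingHom.ker (eval x)}.Finite := by
  refine Set.Finite.of_finite_image (f := fun x : Fin n → K => RingHom.ker (eval x))
    ((Ideal.finite_minimalPrimes_of_isNoetherianRing _ I).subset ?_)
    (ker_eval_injective.injOn)
  rintro _ ⟨x, hx, rfl⟩
  have hprime : (RingHom.ker (eval x)).IsPrime := RingHom.ker_isPrime _
  obtain ⟨q, hq, hle⟩ := Ideal.exists_minimalPrimes_le (show I ≤ RingHom.ker (eval x) from hx)
  rcases hle.eq_or_lt with h0 | hlt
  · rw [h0] at hq
    exact hq
  · exfalso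
    have := hq.1.1
    have h1 := Ideal.height_add_one_le_of_lt_of_isPrime hlt
    have h2 := h q hq.1.1 hq.1.2
    have h3 := Ideal.height_le_ringKrullDim_of_isPrime (I := RingHom.ker (eval x))
    rw [MvPolynomial.ringKrullDim_of_isNoetherianRing, ringKrullDim_eq_zero_of_field,
      zero_add] at h3
    have h4 : (RingHom.ker (eval x)).height ≤ (n : ℕ∞) := by
      have : ((RingHom.ker (eval x)).height : WithBot ℕ∞) ≤ ((n : ℕ∞) : WithBot ℕ∞) := by
        simpa using h3
      exact_mod_cast this
    have h5 : (n : ℕ∞) + 1 ≤ n := (add_le_add_left h2 1).trans (h1.trans h4)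
    have h6 : n + 1 ≤ n := by exact_mod_cast h5
    omega

end FiniteZeroSet

section Smooth

variable {n : ℕ}

/-- Hilbert's Nullstellensatz. -/
theorem mem_radical_of_forall_eval {K : Type*} [Field K] [IsAlgClosed K]
    (I : Ideal (MvPolynomial (Fin n) K)) (g : MvPolynomial (Fin n) K)
    (h : ∀ x, I ≤ RingHom.ker (eval x) → eval x g = 0) : g ∈ I.radical := by
  rw [← MvPolynomial.vanishingIdeal_zeroLocus_eq_radical (K := K), mem_vanishingIdeal_iff]
  intro x hx
  exact h x fun p hp => by simpa [RingHom.mem_ker, aeval_eq_eval] using hx p hp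

/-- By the Nullstellensatz, smoothness in terms of points carries over to all prime ideals. -/
theorem IsSmoothHypersurface.exists_pderiv_notMem {f : MvPolynomial (Fin n) ℂ}
    (hf : IsSmoothHypersurface f) (q : Ideal (MvPolynomial (Fin n) ℂ)) (hq : q.IsPrime)
    (hfq : f ∈ q) : ∃ j, pderiv j f ∉ q := by
  by_contra! hall
  let I : Ideal (MvPolynomial (Fin n) ℂ) :=
    Ideal.span {f} ⊔ Ideal.span (Set.range fun j => pderiv j f)
  have hIq : I ≤ q := by
    refine sup_le ((Ideal.span_singleton_le_iff_mem _).mpr hfq) (Ideal.span_le.mpr ?_)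
    rintro _ ⟨j, rfl⟩
    exact hall j
  have h1 : (1 : MvPolynomial (Fin n) ℂ) ∈ I.radical := by
    refine mem_radical_of_forall_eval I 1 fun x hx => ?_
    obtain ⟨i, hi⟩ := hf x (hx (Ideal.mem_sup_left (Ideal.mem_span_singleton_self f)))
    exact absurd (hx (Ideal.mem_sup_right (Ideal.subset_span ⟨i, rfl⟩))) hi
  exact hq.ne_top ((Ideal.eq_top_iff_one q).mpr ((hq.radical_le_iff.mpr hIq) h1))

end Smooth

/-! ### An effective Nullstellensatz for smooth hypersurfaces -/

section Bezout

theorem exists_bezout_natDegree_le {K : Type*} [Field K] {φ φ' : Polynomial K}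
    (h : IsCoprime φ φ') (h0 : φ' ≠ 0) :
    ∃ a b : Polynomial K, a * φ + b * φ' = 1 ∧ a.natDegree ≤ φ'.natDegree ∧
      b.natDegree ≤ φ.natDegree := by
  obtain ⟨u, v, huv⟩ := h
  have hdiv := EuclideanDomain.mod_add_div u φ'
  have heq : u % φ' * φ + (v + φ * (u / φ')) * φ' = 1 := by
    rw [← huv]
    linear_combination φ * hdiv
  have ha : (u % φ').natDegree ≤ φ'.natDegree :=
    Polynomial.natDegree_le_natDegree (EuclideanDomain.mod_lt u h0).le
  refine ⟨_, _, heq, ha, ?_⟩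
  by_cases hb : v + φ * (u / φ') = 0
  · simp [hb]
  have h1 := Polynomial.natDegree_mul hb h0
  rw [show (v + φ * (u / φ')) * φ' = 1 - u % φ' * φ by rw [← heq]; ring] at h1
  have h2 := Polynomial.natDegree_sub_le 1 (u % φ' * φ)
  have h3 := Polynomial.natDegree_mul_le (p := u % φ') (q := φ)
  simp only [Polynomial.natDegree_one] at h2
  have h4 := h2.trans (max_le (Nat.zero_le _) h3)
  omega

end Bezout

section Translates

/-- `exists_translates_isIntegral` for two families at once, read in a product ring: the same
linear forms serve both families. -/
theorem exists_common_translates {K T S : Type*} [Field K] [Infinite K] [CommRing T] [Algebra K T]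
    [CommRing S] [Algebra K S] (π : T →ₐ[K] S) {m : ℕ}
    (hdep : ∀ v : Option (Option (Fin m)) → S × S, ¬ AlgebraicIndependent K v)
    (x : Fin (m + 1) → T) (y y' : Fin m → T) (V : Finset (Fin (m + 1) → K)) (hV : 0 ∉ V) :
    ∃ (c : Fin (m + 1) → K) (e : Fin m → Fin (m + 1) → K), (∀ v ∈ V, ∑ j, c j * v j ≠ 0) ∧
      (∀ j, IsIntegralOverFamily (K := K) (fun o => π (translates x y c e o)) (π (x j))) ∧
      ∀ j, IsIntegralOverFamily (K := K) (fun o => π (translates x y' c e o)) (π (x j)) := by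
  obtain ⟨c, e, hc, hint⟩ := exists_translates_isIntegral (k := K) m
    (fun j => (π (x j), π (x j))) (fun i => (π (y i), π (y' i))) hdep V hV
  refine ⟨c, e, hc, fun j => ?_, fun j => ?_⟩
  · have h1 := (isIntegralOverFamily_of_isIntegral _ _ (hint j)).map (AlgHom.fst K S S)
    convert h1 using 1
    · funext o
      cases o <;> simp [translates, Prod.fst_sum]
    · rfl
  · have h1 := (isIntegralOverFamily_of_isIntegral _ _ (hint j)).map (AlgHom.snd K S S)
    convert h1 using 1
    · funext o
      cases o <;> simp [translates, Prod.snd_sum]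
    · rfl

theorem translates_eq_perturbation {K : Type} [Field K] {m n : ℕ}
    (F : Fin m → MvPolynomial (Fin n) K) (c : Fin n → K) (e : Fin m → Fin n → K)
    (o : Option (Fin m)) :
    translates (fun j => Polynomial.C (X j : MvPolynomial (Fin n) K))
      (fun i => Polynomial.C (F i) * Polynomial.X) c e o =
    perturbation F (∑ j, c j • X j) (fun i => ∑ j, e i j • X j) o := by
  cases o <;> simp [translates, perturbation, map_sum, Polynomial.smul_C]

theorem totalDegree_sum_smul_X_le {K : Type} [Field K] {n : ℕ} (c : Fin n → K) :
    (∑ j, c j • X j : MvPolynomial (Fin n) K).totalDegree ≤ 1 :=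
  totalDegree_finsetSum_le fun _ _ => (totalDegree_smul_le _ _).trans (totalDegree_X _).le

end Translates

section BoundedCombos

variable {K : Type} [Field K] {n m r d N : ℕ}

theorem exists_of_mem_boundedCombos {G : Fin r → MvPolynomial (Fin n) K}
    {y : MvPolynomial (Fin n) K} (hy : y ∈ boundedCombos G d N) :
    ∃ g : Fin r → MvPolynomial (Fin n) K, (∀ j, (g j).totalDegree ≤ N - d) ∧
      y = ∑ j, g j * G j := by
  classical
  induction hy using Submodule.span_induction with
  | mem y hy =>
    obtain ⟨i, g, hg, rfl⟩ := hy
    refine ⟨Pi.single i g, fun j => ?_, by simp [Pi.single_apply]⟩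
    by_cases hij : j = i
    · subst hij; simp; omega
    · simp [hij]
  | zero => exact ⟨0, by simp, by simp⟩
  | add x y _ _ hx hy =>
    obtain ⟨g, hg, rfl⟩ := hx
    obtain ⟨h, hh, rfl⟩ := hy
    exact ⟨g + h, fun j => (totalDegree_add _ _).trans (max_le (hg j) (hh j)), by
      simp [add_mul, Finset.sum_add_distrib]⟩
  | smul c y _ hy =>
    obtain ⟨g, hg, rfl⟩ := hy
    exact ⟨c • g, fun j => (totalDegree_smul_le _ _).trans (hg j), by simp [Finset.smul_sum]⟩

theorem boundedCombos_combinations_le (G : Fin r → MvPolynomial (Fin n) K)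
    (a : Fin m → Fin r → K) :
    boundedCombos (fun i => ∑ j, a i j • G j) d N ≤ boundedCombos G d N := by
  refine Submodule.span_le.mpr ?_
  rintro _ ⟨i, g, hg, rfl⟩
  rw [Finset.mul_sum]
  refine Submodule.sum_mem _ fun j _ => ?_
  rw [mul_smul_comm]
  exact Submodule.smul_mem _ _ (Submodule.subset_span ⟨j, g, hg, rfl⟩)

end BoundedCombos

section Nullstellensatz

variable {K : Type} [Field K] [IsAlgClosed K] {m d : ℕ}

/-- If `f = F_1 = ⋯ = F_m = 0` has finitely many solutions `V`, the eliminant can be taken with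
all its roots among the values of `l` on `V`. -/
theorem exists_eliminant_of_finite_zeros (hd : 0 < d) (f : MvPolynomial (Fin (m + 1)) K)
    (hf : f ≠ 0) (F : Fin m → MvPolynomial (Fin (m + 1)) K)
    (hF : ∀ i, (F i).totalDegree ≤ d)
    (l : MvPolynomial (Fin (m + 1)) K) (hl : l.totalDegree ≤ 1)
    (l' : Fin m → MvPolynomial (Fin (m + 1)) K) (hl' : ∀ i, (l' i).totalDegree ≤ 1)
    (V : Finset (Fin (m + 1) → K))
    (hV : ∀ x, eval x f = 0 → (∀ i, eval x (F i) = 0) → x ∈ V)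
    (hFp : ∀ p, Irreducible p → p ∣ f → ∃ i, ¬ p ∣ F i)
    (hint : ∀ j, IsIntegralOverFamily (K := K) (fun o =>
      Polynomial.mapAlgHom (Ideal.Quotient.mkₐ K (Ideal.span {f})) (perturbation F l l' o))
        (Polynomial.C (Ideal.Quotient.mk (Ideal.span {f}) (X j)))) :
    ∃ φ : Polynomial K, (∃ k, φ ∣ (∏ x ∈ V, (Polynomial.X - Polynomial.C (eval x l))) ^ k) ∧
      φ.natDegree ≤ f.totalDegree * d ^ m ∧
      ∃ y ∈ boundedCombos F d (f.totalDegree * d ^ m), f ∣ Polynomial.aeval l φ - y := by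
  set φ₀ : Polynomial K := ∏ x ∈ V, (Polynomial.X - Polynomial.C (eval x l)) with hφ₀
  have hmon : φ₀.Monic := Polynomial.monic_prod_of_monic _ _ fun x _ => Polynomial.monic_X_sub_C _
  let I : Ideal (MvPolynomial (Fin (m + 1)) K) := Ideal.span {f} ⊔ Ideal.span (Set.range F)
  have hrad : Polynomial.aeval l φ₀ ∈ I.radical := by
    refine mem_radical_of_forall_eval I _ fun x hx => ?_
    have hxV : x ∈ V := hV x (hx (Ideal.mem_sup_left (Ideal.mem_span_singleton_self f)))
      fun i => hx (Ideal.mem_sup_right (Ideal.subset_span ⟨i, rfl⟩))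
    rw [hφ₀, map_prod, map_prod]
    refine Finset.prod_eq_zero hxV ?_
    simp [Polynomial.aeval_C, MvPolynomial.algebraMap_eq]
  obtain ⟨M, hM⟩ := hrad
  obtain ⟨u, hu, w, hw, huw⟩ := Submodule.mem_sup.mp hM
  obtain ⟨h, hh⟩ := Ideal.mem_span_range_iff_exists_fun.mp hw
  obtain ⟨φ, ⟨k, hk⟩, hφ⟩ := exists_eliminant hd f hf F hF l hl l' hl' (φ₀ ^ M)
    (pow_ne_zero _ hmon.ne_zero) h (by
      rw [map_pow, ← huw, hh, add_sub_cancel_right]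
      exact Ideal.mem_span_singleton.mp hu) hFp hint
  exact ⟨φ, ⟨M * k, by rwa [pow_mul]⟩, hφ⟩

end Nullstellensatz

section Effective

theorem totalDegree_pderiv_le {K : Type*} [Field K] {n : ℕ} (j : Fin n)
    (f : MvPolynomial (Fin n) K) : (pderiv j f).totalDegree ≤ f.totalDegree := by
  refine Finset.sup_le fun s hs => ?_
  rw [mem_support_iff, coeff_pderiv] at hs
  have h1 := le_totalDegree (mem_support_iff.mpr (left_ne_zero_of_mul hs))
  refine le_trans ?_ h1
  rw [Finsupp.sum_add_index' (by simp) (by simp)]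
  exact Nat.le_add_right _ _

/-- In one variable the derivative has an inverse modulo `f`, which may be reduced modulo `f`. -/
theorem exists_sum_pderiv_sub_one_fin_one (f : MvPolynomial (Fin 1) ℂ)
    (hf : IsSmoothHypersurface f) (hd : f ≠ 0) :
    ∃ g : Fin 1 → MvPolynomial (Fin 1) ℂ, (∀ j, (g j).totalDegree ≤ f.totalDegree) ∧
      f ∣ ∑ j, g j * pderiv j f - 1 := by
  let I : Ideal (MvPolynomial (Fin 1) ℂ) := Ideal.span {f} ⊔ Ideal.span {pderiv 0 f}
  have hI : I = ⊤ := by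
    by_contra hI
    obtain ⟨q, hq, hle⟩ := Ideal.exists_le_maximal I hI
    obtain ⟨j, hj⟩ := hf.exists_pderiv_notMem q hq.isPrime
      (hle (Ideal.mem_sup_left (Ideal.mem_span_singleton_self f)))
    rw [Fin.fin_one_eq_zero j] at hj
    exact hj (hle (Ideal.mem_sup_right (Ideal.mem_span_singleton_self _)))
  obtain ⟨u, hu, w, hw, huw⟩ := Submodule.mem_sup.mp ((Ideal.eq_top_iff_one I).mp hI)
  obtain ⟨v, rfl⟩ := Ideal.mem_span_singleton'.mp hw
  let e := uniqueAlgEquiv ℂ (Fin 1)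
  have he0 : e f ≠ 0 := by simpa using hd
  refine ⟨fun _ => e.symm (e v % e f), fun _ => ?_, ?_⟩
  · have h1 : ∀ p, e.symm p = Polynomial.aeval (X 0 : MvPolynomial (Fin 1) ℂ) p := by
      intro p
      induction p using Polynomial.induction_on' with
      | add p q hp hq => rw [map_add, map_add, hp, hq]
      | monomial k c =>
        rw [Polynomial.aeval_monomial, e.symm_apply_eq, map_mul, map_pow, algebraMap_eq]
        simp [e, uniqueAlgEquiv, Polynomial.C_mul_X_pow_eq_monomial]
    have h2 : (e f).natDegree ≤ f.totalDegree := by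
      refine (Polynomial.natDegree_le_iff_coeff_eq_zero).mpr fun k hk => ?_
      rw [coeff_uniqueAlgEquiv]
      refine coeff_eq_zero_of_totalDegree_lt ?_
      change f.totalDegree < Finsupp.sum (Finsupp.single default k) fun _ e => e
      rwa [Finsupp.sum_single_index rfl]
    rw [h1]
    refine (totalDegree_aeval_le_natDegree (totalDegree_X _).le _).trans (le_trans ?_ h2)
    exact Polynomial.natDegree_le_natDegree (EuclideanDomain.mod_lt _ he0).le
  · have h3 : e.symm (e v % e f) = v - f * e.symm (e v / e f) := by
      apply e.injective
      rw [map_sub, map_mul, e.apply_symm_apply, e.apply_symm_apply,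
        EuclideanDomain.mod_eq_sub_mul_div]
    rw [Fin.sum_univ_one, h3, ← huw]
    have := (Ideal.mem_span_singleton.mp hu).neg_right
    refine ((this.add (Dvd.intro (-(e.symm (e v / e f) * pderiv 0 f)) rfl))).trans (dvd_of_eq ?_)
    ring

/-- Two general systems of linear combinations of the partial derivatives have disjoint finite sets
of zeros on `f = 0`. A linear form `l` taking different values on them yields coprime eliminants
`φ` and `φ'` of degree at most `d ^ (m + 1)`, and a Bézout relation between `φ(l)` and `φ'(l)`
represents `1`. -/
theorem exists_sum_pderiv_sub_one_of_pos {m : ℕ} (hm : 0 < m)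
    (f : MvPolynomial (Fin (m + 1)) ℂ) (hf : IsSmoothHypersurface f) (hd : 0 < f.totalDegree) :
    ∃ g : Fin (m + 1) → MvPolynomial (Fin (m + 1)) ℂ,
      (∀ j, (g j).totalDegree ≤ 2 * f.totalDegree ^ (m + 1) - f.totalDegree) ∧
      f ∣ ∑ j, g j * pderiv j f - 1 := by
  classical
  have hf0 : f ≠ 0 := by rintro rfl; simp at hd
  set d := f.totalDegree with hdef
  let G : Fin (m + 1) → MvPolynomial (Fin (m + 1)) ℂ := fun j => pderiv j f
  have hGd : ∀ j, (G j).totalDegree ≤ d := by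
    intro j
    refine (totalDegree_pderiv_le j f)
  have hcd : ∀ a : Fin (m + 1) → ℂ, (∑ j, a j • G j).totalDegree ≤ d := fun a =>
    totalDegree_finsetSum_le fun j _ => (totalDegree_smul_le _ _).trans (hGd j)
  have hG := hf.exists_pderiv_notMem
  -- the ideals generated by the irreducible factors of `f`
  let P : Set (Ideal (MvPolynomial (Fin (m + 1)) ℂ)) :=
    (fun p => Ideal.span {p}) '' {p | p ∈ UniqueFactorizationMonoid.factors f}
  have hPfin : P.Finite := Set.Finite.image _ (Multiset.finite_toSet _)
  have hPG : ∀ p ∈ P, ∃ j, G j ∉ p := by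
    rintro _ ⟨p, hp, rfl⟩
    have hp' := UniqueFactorizationMonoid.prime_of_factor p hp
    exact hG _ ((Ideal.span_singleton_prime hp'.ne_zero).mpr hp') (Ideal.mem_span_singleton.mpr
      (UniqueFactorizationMonoid.dvd_of_mem_factors hp))
  have hPirr : ∀ F : MvPolynomial (Fin (m + 1)) ℂ, (∀ q ∈ P, F ∉ q) →
      ∀ p, Irreducible p → p ∣ f → ¬ p ∣ F := by
    intro F hF p hp hpf hpF
    obtain ⟨q, hq, hpq⟩ :=
      UniqueFactorizationMonoid.exists_mem_factors_of_dvd hf0 hp hpf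
    exact hF _ ⟨q, hq, rfl⟩ (Ideal.mem_span_singleton.mpr (hpq.symm.dvd.trans hpF))
  have hfin : ∀ F : Fin m → MvPolynomial (Fin (m + 1)) ℂ,
      (∀ q : Ideal _, q.IsPrime → f ∈ q → (∀ i, F i ∈ q) → ((m + 1 : ℕ) : ℕ∞) ≤ q.height) →
      {x | eval x f = 0 ∧ ∀ i, eval x (F i) = 0}.Finite := by
    intro F hF
    refine (finite_zeros_of_le_height (Ideal.span {f} ⊔ Ideal.span (Set.range F))
      fun q hq hle => hF q hq ?_ fun i => ?_).subset ?_
    · exact hle (Ideal.mem_sup_left (Ideal.mem_span_singleton_self f))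
    · exact hle (Ideal.mem_sup_right (Ideal.subset_span ⟨i, rfl⟩))
    · rintro x ⟨h1, h2⟩
      refine sup_le (c := RingHom.ker (eval x)) ((Ideal.span_singleton_le_iff_mem _).mpr h1)
        (Ideal.span_le.mpr ?_)
      rintro _ ⟨i, rfl⟩
      exact h2 i
  obtain ⟨a, haP, ha⟩ := exists_combinations_height (K := ℂ) f hf0 G hG P hPfin hPG m
  have hVfin := hfin _ ha
  -- the second system avoids the zeros of the first one
  obtain ⟨a', haP', ha'⟩ := exists_combinations_height (K := ℂ) f hf0 G hG
    (P ∪ (fun x => RingHom.ker (eval x)) '' {x | eval x f = 0 ∧ ∀ i, eval x (∑ j, a i j • G j) = 0})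
    (hPfin.union (hVfin.image _)) (by
      rintro p (hp | ⟨x, hx, rfl⟩)
      · exact hPG p hp
      · exact hG _ (RingHom.ker_isPrime _) hx.1) m
  have hVfin' := hfin _ ha'
  let V := hVfin.toFinset
  let V' := hVfin'.toFinset
  let W : Finset (Fin (m + 1) → ℂ) := (V ×ˢ V').image fun q => q.1 - q.2
  have hW : 0 ∉ W := by
    intro h0
    obtain ⟨⟨x, x'⟩, hxx, h1⟩ := Finset.mem_image.mp h0
    obtain ⟨hx, hx'⟩ := Finset.mem_product.mp hxx
    obtain rfl : x = x' := sub_eq_zero.mp h1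
    exact haP' ⟨0, hm⟩ _ (Or.inr ⟨x, hVfin.mem_toFinset.mp hx, rfl⟩)
      ((hVfin'.mem_toFinset.mp hx').2 ⟨0, hm⟩)
  obtain ⟨c, e, hc, hint, hint'⟩ := exists_common_translates (K := ℂ)
    (S := Polynomial (MvPolynomial (Fin (m + 1)) ℂ ⧸ Ideal.span {f}))
    (Polynomial.mapAlgHom (Ideal.Quotient.mkₐ ℂ (Ideal.span {f})))
    (not_algebraicIndependent_quotient_prod f hf0)
    (fun j => Polynomial.C (X j : MvPolynomial (Fin (m + 1)) ℂ))
    (fun i => Polynomial.C (∑ j, a i j • G j) * Polynomial.X)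
    (fun i => Polynomial.C (∑ j, a' i j • G j) * Polynomial.X) W hW
  simp only [translates_eq_perturbation] at hint hint'
  set l : MvPolynomial (Fin (m + 1)) ℂ := ∑ j, c j • X j with hl
  have hl1 : l.totalDegree ≤ 1 := totalDegree_sum_smul_X_le c
  obtain ⟨φ, ⟨k, hk⟩, hφd, y, hy, hyφ⟩ := exists_eliminant_of_finite_zeros hd f hf0 _
    (fun i => hcd (a i)) l hl1 _ (fun i => totalDegree_sum_smul_X_le (e i)) V
    (fun x h1 h2 => hVfin.mem_toFinset.mpr ⟨h1, h2⟩)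
    (fun p hp hpf => ⟨⟨0, hm⟩, hPirr _ (haP _) p hp hpf⟩) (fun j => by simpa using hint j)
  obtain ⟨φ', ⟨k', hk'⟩, hφd', y', hy', hyφ'⟩ := exists_eliminant_of_finite_zeros hd f hf0 _
    (fun i => hcd (a' i)) l hl1 _ (fun i => totalDegree_sum_smul_X_le (e i)) V'
    (fun x h1 h2 => hVfin'.mem_toFinset.mpr ⟨h1, h2⟩)
    (fun p hp hpf => ⟨⟨0, hm⟩, hPirr _ (fun q hq => haP' _ q (Or.inl hq)) p hp hpf⟩)
    (fun j => by simpa using hint' j)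
  have hcop : IsCoprime φ φ' := by
    refine IsCoprime.of_isCoprime_of_dvd_left (IsCoprime.of_isCoprime_of_dvd_right ?_ hk') hk
    refine IsCoprime.pow (IsCoprime.prod_left fun x hx => IsCoprime.prod_right fun x' hx' => ?_)
    refine Polynomial.isCoprime_X_sub_C_of_isUnit_sub (IsUnit.mk0 _ ?_)
    have := hc (x - x') (Finset.mem_image.mpr ⟨(x, x'), Finset.mem_product.mpr ⟨hx, hx'⟩, rfl⟩)
    simpa [hl, smul_eval, mul_sub] using this
  have hφ0 : φ' ≠ 0 := by
    refine ne_zero_of_dvd_ne_zero (pow_ne_zero _ ?_) hk'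
    exact (Polynomial.monic_prod_of_monic _ _ fun x _ => Polynomial.monic_X_sub_C _).ne_zero
  obtain ⟨u, v, huv, hu, hv⟩ := exists_bezout_natDegree_le hcop hφ0
  have hy1 := mul_mem_boundedCombos (boundedCombos_combinations_le G a hy)
    ((totalDegree_aeval_le_natDegree hl1 u).trans (hu.trans hφd'))
  have hy2 := mul_mem_boundedCombos (boundedCombos_combinations_le G a' hy')
    ((totalDegree_aeval_le_natDegree hl1 v).trans (hv.trans hφd))
  obtain ⟨g, hg, hgy⟩ := exists_of_mem_boundedCombos (Submodule.add_mem _ hy1 hy2)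
  refine ⟨g, fun j => (hg j).trans (le_of_eq ?_), ?_⟩
  · rw [← hdef, pow_succ', two_mul]
  · have h1 := congrArg (Polynomial.aeval l) huv
    simp only [map_add, map_mul, map_one] at h1
    have : ∑ j, g j * pderiv j f - 1 = -(Polynomial.aeval l u * (Polynomial.aeval l φ - y) +
        Polynomial.aeval l v * (Polynomial.aeval l φ' - y')) := by
      rw [← h1, ← hgy]
      ring
    rw [this]
    exact ((hyφ.mul_left _).add (hyφ'.mul_left _)).neg_right

/-- Effective Nullstellensatz for a smooth hypersurface: the constant `1` is a combination of the
partial derivatives modulo `f`, with coefficients of degree at most `2 d ^ n - d`. -/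
theorem IsSmoothHypersurface.exists_sum_pderiv_sub_one {n : ℕ} (f : MvPolynomial (Fin n) ℂ)
    (hf : IsSmoothHypersurface f) (hd : 0 < f.totalDegree) :
    ∃ g : Fin n → MvPolynomial (Fin n) ℂ,
      (∀ j, (g j).totalDegree ≤ 2 * f.totalDegree ^ n - f.totalDegree) ∧
      f ∣ ∑ j, g j * pderiv j f - 1 := by
  match n with
  | 0 =>
    rw [MvPolynomial.eq_C_of_isEmpty f, totalDegree_C] at hd
    exact absurd hd (lt_irrefl 0)
  | 1 =>
    obtain ⟨g, hg, h⟩ := exists_sum_pderiv_sub_one_fin_one f hf (by rintro rfl; simp at hd)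
    exact ⟨g, fun j => (hg j).trans (by rw [pow_one]; omega), h⟩
  | m + 2 => exact exists_sum_pderiv_sub_one_of_pos m.succ_pos f hf hd

end Effective

/-! ### Power series in `f` -/

section AdicEvaluation

variable {R : Type*} [CommRing R] (f : R)

theorem factorPow_evalₐ (I : Ideal R) {m n : ℕ} (h : m ≤ n) (y : AdicCompletion I R) :
    Ideal.Quotient.factorPow I h (AdicCompletion.evalₐ I n y) = AdicCompletion.evalₐ I m y := by
  obtain ⟨x, rfl⟩ := AdicCompletion.mk_surjective I R y
  rw [AdicCompletion.evalₐ_mk, AdicCompletion.evalₐ_mk]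
  exact AdicCompletion.Ideal.mk_eq_mk I h x

theorem evalₐ_eq_of_le (I : Ideal R) {m n : ℕ} (h : m ≤ n) {y z : AdicCompletion I R}
    (hyz : AdicCompletion.evalₐ I n y = AdicCompletion.evalₐ I n z) :
    AdicCompletion.evalₐ I m y = AdicCompletion.evalₐ I m z := by
  rw [← factorPow_evalₐ I h, hyz, factorPow_evalₐ]

/-- The image of `f` in the completion along `(f)`. -/
noncomputable def uniformizer : AdicCompletion (Ideal.span {f}) R :=
  algebraMap R (AdicCompletion (Ideal.span {f}) R) f

theorem evalₐ_uniformizer_pow (n : ℕ) :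
    AdicCompletion.evalₐ (Ideal.span {f}) n (uniformizer f ^ n) = 0 := by
  rw [uniformizer, ← map_pow, AlgHom.commutes, Ideal.Quotient.algebraMap_eq,
    Ideal.Quotient.eq_zero_iff_mem]
  exact Ideal.pow_mem_pow (Ideal.mem_span_singleton_self f) n

theorem eval₂_eq_zero_of_X_pow_dvd {C S : Type*} [CommRing C] [CommRing S] (σ : C →+* S) {t : S}
    {n : ℕ} (ht : t ^ n = 0) {p : Polynomial C} (hp : Polynomial.X ^ n ∣ p) :
    p.eval₂ σ t = 0 := by
  obtain ⟨q, rfl⟩ := hp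
  simp [Polynomial.eval₂_mul, ht]

/-- The substitution of an element `t` with `t ^ n = 0` into power series, which depends only on
their truncations at `n`. -/
noncomputable def evalNilpotent {C S : Type*} [CommRing C] [CommRing S] (σ : C →+* S) (t : S)
    (n : ℕ) (ht : t ^ n = 0) : PowerSeries C →+* S where
  toFun b := (PowerSeries.trunc n b).eval₂ σ t
  map_zero' := by simp
  map_one' := by
    rcases n with _ | n
    · rw [pow_zero] at ht
      exact (subsingleton_of_zero_eq_one ht.symm).elim _ _
    · rw [PowerSeries.trunc_one, Polynomial.eval₂_one]
  map_add' a b := by rw [map_add, Polynomial.eval₂_add]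
  map_mul' a b := by
    rw [← Polynomial.eval₂_mul, ← sub_eq_zero, ← Polynomial.eval₂_sub]
    refine eval₂_eq_zero_of_X_pow_dvd σ ht (Polynomial.X_pow_dvd_iff.mpr fun k hk => ?_)
    rw [Polynomial.coeff_sub, PowerSeries.coeff_trunc, if_pos hk,
      PowerSeries.coeff_mul_eq_coeff_trunc_mul_trunc a b hk,
      ← Polynomial.coe_mul, Polynomial.coeff_coe, sub_self]

variable {f} {C : Type*} [CommRing C]

theorem evalNilpotent_evalₐ (σ : C →+* AdicCompletion (Ideal.span {f}) R) (n : ℕ) (ht)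
    (b : PowerSeries C) :
    evalNilpotent ((AdicCompletion.evalₐ (Ideal.span {f}) n : _ →+* _).comp σ)
      (AdicCompletion.evalₐ (Ideal.span {f}) n (uniformizer f)) n ht b =
    AdicCompletion.evalₐ (Ideal.span {f}) n
        (∑ ν ∈ Finset.range n, σ (PowerSeries.coeff ν b) * uniformizer f ^ ν) := by
  change (PowerSeries.trunc n b).eval₂ _ _ = _
  rw [PowerSeries.eval₂_trunc_eq_sum_range, map_sum]
  simp

theorem evalₐ_uniformizer_pow_eq_zero (n : ℕ) :
    AdicCompletion.evalₐ (Ideal.span {f}) n (uniformizer f) ^ n = 0 := by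
  rw [← map_pow, evalₐ_uniformizer_pow]

theorem factorPow_comp_evalNilpotent (σ : C →+* AdicCompletion (Ideal.span {f}) R) {m n : ℕ}
    (h : m ≤ n) :
    (Ideal.Quotient.factorPow (Ideal.span {f}) h).comp
      (evalNilpotent ((AdicCompletion.evalₐ (Ideal.span {f}) n : _ →+* _).comp σ) _ n
        (evalₐ_uniformizer_pow_eq_zero n)) =
      evalNilpotent ((AdicCompletion.evalₐ (Ideal.span {f}) m : _ →+* _).comp σ) _ m
        (evalₐ_uniformizer_pow_eq_zero m) := by
  ext b
  rw [RingHom.comp_apply, evalNilpotent_evalₐ, evalNilpotent_evalₐ, factorPow_evalₐ,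
    ← Finset.sum_range_add_sum_Ico _ h, map_add, add_eq_left, map_sum]
  refine Finset.sum_eq_zero fun ν hν => ?_
  rw [← Nat.add_sub_cancel' (Finset.mem_Ico.mp hν).1, pow_add, map_mul, map_mul,
    evalₐ_uniformizer_pow, zero_mul, mul_zero]

/-- The ring homomorphism `∑ b_ν T^ν ↦ ∑ σ (b_ν) f^ν` into the completion along `(f)`. -/
noncomputable def adicEval (σ : C →+* AdicCompletion (Ideal.span {f}) R) :
    PowerSeries C →+* AdicCompletion (Ideal.span {f}) R :=
  AdicCompletion.liftRingHom (Ideal.span {f})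
    (fun n => evalNilpotent ((AdicCompletion.evalₐ (Ideal.span {f}) n : _ →+* _).comp σ) _ n
      (evalₐ_uniformizer_pow_eq_zero n)) (factorPow_comp_evalNilpotent σ)

theorem evalₐ_adicEval (σ : C →+* AdicCompletion (Ideal.span {f}) R) (b : PowerSeries C) (n : ℕ) :
    AdicCompletion.evalₐ (Ideal.span {f}) n (adicEval σ b) =
      AdicCompletion.evalₐ (Ideal.span {f}) n
        (∑ ν ∈ Finset.range n, σ (PowerSeries.coeff ν b) * uniformizer f ^ ν) := by
  rw [adicEval, AdicCompletion.evalₐ_liftRingHom _ _ (factorPow_comp_evalNilpotent σ),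
    evalNilpotent_evalₐ]

theorem adicEval_C (σ : C →+* AdicCompletion (Ideal.span {f}) R) (c : C) :
    adicEval σ (PowerSeries.C c) = σ c := by
  refine AdicCompletion.ext_evalₐ fun n => ?_
  -- the sum at level `n + 1` is not empty
  refine evalₐ_eq_of_le _ n.le_succ ?_
  rw [evalₐ_adicEval, Finset.sum_range_succ']
  simp [PowerSeries.coeff_C]

theorem adicEval_X (σ : C →+* AdicCompletion (Ideal.span {f}) R) :
    adicEval σ PowerSeries.X = uniformizer f := by
  refine AdicCompletion.ext_evalₐ fun n => ?_
  -- the sum at level `n + 2` contains the term of index `1`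
  refine evalₐ_eq_of_le _ (Nat.le_add_right n 2) ?_
  rw [evalₐ_adicEval, Finset.sum_range_succ', Finset.sum_range_succ']
  simp [PowerSeries.coeff_X]

theorem evalOneₐ_uniformizer : AdicCompletion.evalOneₐ (Ideal.span {f}) (uniformizer f) = 0 := by
  rw [uniformizer, AlgHom.commutes, Ideal.Quotient.algebraMap_eq, Ideal.Quotient.eq_zero_iff_mem]
  exact Ideal.mem_span_singleton_self f

theorem exists_eq_C_add_X_mul (b : PowerSeries C) :
    ∃ b' : PowerSeries C, b = PowerSeries.C (PowerSeries.coeff 0 b) + PowerSeries.X * b' ∧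
      ∀ k, PowerSeries.coeff k b' = PowerSeries.coeff (k + 1) b := by
  refine ⟨PowerSeries.mk fun k => PowerSeries.coeff (k + 1) b, ?_, fun k => by simp⟩
  rw [add_comm, PowerSeries.coeff_zero_eq_constantCoeff_apply]
  exact PowerSeries.eq_X_mul_shift_add_const b

theorem adicEval_C_add_X_mul (σ : C →+* AdicCompletion (Ideal.span {f}) R) (c : C)
    (b : PowerSeries C) : adicEval σ (PowerSeries.C c + PowerSeries.X * b) =
      σ c + uniformizer f * adicEval σ b := by
  rw [map_add, map_mul, adicEval_C, adicEval_X]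

theorem evalOneₐ_adicEval (σ : C →+* AdicCompletion (Ideal.span {f}) R) (b : PowerSeries C) :
    AdicCompletion.evalOneₐ (Ideal.span {f}) (adicEval σ b) =
      AdicCompletion.evalOneₐ (Ideal.span {f}) (σ (PowerSeries.coeff 0 b)) := by
  obtain ⟨b', hb, -⟩ := exists_eq_C_add_X_mul b
  conv_lhs => rw [hb, adicEval_C_add_X_mul]
  simp [evalOneₐ_uniformizer]

variable (f) in
/-- Every element of the completion along `(f)` has an expansion `∑ c_ν f^ν` with `c_ν` in the
ring itself. -/
theorem adicEval_algebraMap_surjective :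
    Function.Surjective (adicEval (algebraMap R (AdicCompletion (Ideal.span {f}) R))) := by
  intro y
  have h1 : ∀ n, ∃ r : R, AdicCompletion.evalₐ (Ideal.span {f}) n y =
      Ideal.Quotient.mk (Ideal.span {f} ^ n) r ∧ (n = 0 → r = 0) := by
    intro n
    by_cases hn : n = 0
    · subst hn
      refine ⟨0, ?_, fun _ => rfl⟩
      have : Subsingleton (R ⧸ Ideal.span {f} ^ 0) :=
        Ideal.Quotient.subsingleton_iff.mpr (by rw [pow_zero, Ideal.one_eq_top])
      exact Subsingleton.elim _ _
    · obtain ⟨r, hr⟩ := Ideal.Quotient.mk_surjective (AdicCompletion.evalₐ (Ideal.span {f}) n y)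
      exact ⟨r, hr.symm, fun h => absurd h hn⟩
  choose r hr hr0 using h1
  have h2 : ∀ n, ∃ c, r (n + 1) - r n = c * f ^ n := by
    intro n
    have h3 := factorPow_evalₐ (Ideal.span {f}) n.le_succ y
    rw [hr, hr] at h3
    have h4 : r (n + 1) - r n ∈ Ideal.span {f} ^ n := Ideal.Quotient.eq.mp h3
    rw [Ideal.span_singleton_pow, Ideal.mem_span_singleton'] at h4
    obtain ⟨c, hc⟩ := h4
    exact ⟨c, hc.symm⟩
  choose c hc using h2
  refine ⟨PowerSeries.mk c, AdicCompletion.ext_evalₐ fun n => ?_⟩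
  have h5 : ∑ ν ∈ Finset.range n, c ν * f ^ ν = r n := by
    rw [Finset.sum_congr rfl fun ν _ => (hc ν).symm, Finset.sum_range_sub, hr0 0 rfl, sub_zero]
  rw [evalₐ_adicEval, hr, ← h5]
  simp only [PowerSeries.coeff_mk, uniformizer]
  simp only [← map_pow, ← map_mul, ← map_sum, AlgHom.commutes]
  simp

theorem exists_eq_uniformizer_mul {y : AdicCompletion (Ideal.span {f}) R}
    (hy : AdicCompletion.evalOneₐ (Ideal.span {f}) y = 0) : ∃ z, y = uniformizer f * z := by
  obtain ⟨c, rfl⟩ := adicEval_algebraMap_surjective f y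
  rw [evalOneₐ_adicEval, AlgHom.commutes, Ideal.Quotient.algebraMap_eq,
    Ideal.Quotient.eq_zero_iff_mem, Ideal.mem_span_singleton] at hy
  obtain ⟨h, hh⟩ := hy
  obtain ⟨c', hc, -⟩ := exists_eq_C_add_X_mul c
  rw [hc, adicEval_C_add_X_mul, hh, map_mul, ← uniformizer, ← mul_add]
  exact ⟨_, rfl⟩

/-- The element `f` is not a zero divisor in the completion: if `f r ∈ (f^(n+1))`, then
`r ∈ (f^n)`. -/
theorem uniformizer_mul_left_cancel [IsDomain R] (hf : f ≠ 0)
    {y z : AdicCompletion (Ideal.span {f}) R} (h : uniformizer f * y = uniformizer f * z) :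
    y = z := by
  rw [← sub_eq_zero] at h ⊢
  rw [← mul_sub] at h
  generalize y - z = w at h ⊢
  refine AdicCompletion.ext_evalₐ fun n => ?_
  obtain ⟨r, hr⟩ := Ideal.Quotient.mk_surjective (AdicCompletion.evalₐ (Ideal.span {f}) (n + 1) w)
  have h1 := congrArg (AdicCompletion.evalₐ (Ideal.span {f}) (n + 1)) h
  rw [map_mul, map_zero, ← hr, uniformizer, AlgHom.commutes, Ideal.Quotient.algebraMap_eq,
    ← map_mul, Ideal.Quotient.eq_zero_iff_mem, Ideal.span_singleton_pow, Ideal.mem_span_singleton,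
    pow_succ', mul_dvd_mul_iff_left hf] at h1
  rw [← factorPow_evalₐ _ n.le_succ, ← hr, map_zero]
  refine Ideal.Quotient.eq_zero_iff_mem.mpr ?_
  rwa [Ideal.span_singleton_pow, Ideal.mem_span_singleton]

/-- If `σ` lifts the elements of `A/(f)` to the completion, then every element of the completion has
a unique expansion `∑ σ (b_ν) f^ν`: its coefficients are found one by one, since an element that
vanishes modulo `f` is a multiple of `f`, and `f` is not a zero divisor. -/
theorem adicEval_bijective [IsDomain R] (hf : f ≠ 0)
    (σ : R ⧸ Ideal.span {f} →+* AdicCompletion (Ideal.span {f}) R)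
    (hσ : ∀ b, AdicCompletion.evalOneₐ (Ideal.span {f}) (σ b) = b) :
    Function.Bijective (adicEval σ) := by
  constructor
  · rw [injective_iff_map_eq_zero]
    intro b hb
    ext k
    rw [map_zero]
    induction k generalizing b with
    | zero => rw [← hσ (PowerSeries.coeff 0 b), ← evalOneₐ_adicEval, hb, map_zero]
    | succ k ih =>
      have h0 : PowerSeries.coeff 0 b = 0 := by
        rw [← hσ (PowerSeries.coeff 0 b), ← evalOneₐ_adicEval, hb, map_zero]
      obtain ⟨b', hb', hk⟩ := exists_eq_C_add_X_mul b
      rw [← hk]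
      refine ih b' (uniformizer_mul_left_cancel hf ?_)
      rw [hb', adicEval_C_add_X_mul, h0, map_zero, zero_add] at hb
      rw [hb, mul_zero]
  · intro y
    have h1 : ∀ z, ∃ z',
        z = σ (AdicCompletion.evalOneₐ (Ideal.span {f}) z) + uniformizer f * z' := by
      intro z
      obtain ⟨z', hz'⟩ := exists_eq_uniformizer_mul
        (y := z - σ (AdicCompletion.evalOneₐ (Ideal.span {f}) z)) (by rw [map_sub, hσ, sub_self])
      exact ⟨z', by rw [← hz']; ring⟩
    choose t ht using h1
    refine ⟨PowerSeries.mk fun k => AdicCompletion.evalOneₐ (Ideal.span {f}) (t^[k] y),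
      AdicCompletion.ext_evalₐ fun n => ?_⟩
    have h2 : y = ∑ ν ∈ Finset.range n,
        σ (AdicCompletion.evalOneₐ (Ideal.span {f}) (t^[ν] y)) * uniformizer f ^ ν +
          uniformizer f ^ n * t^[n] y := by
      induction n with
      | zero => simp
      | succ n ih =>
        rw [Finset.sum_range_succ, Function.iterate_succ_apply']
        conv_lhs => rw [ih, ht (t^[n] y)]
        ring
    rw [evalₐ_adicEval]
    conv_rhs => rw [h2, map_add, map_mul, evalₐ_uniformizer_pow, zero_mul, add_zero]
    simp only [PowerSeries.coeff_mk]

end AdicEvaluation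

/-! ### Degree bounds for power series -/

section Growth

variable {K : Type*} [Field K] {n : ℕ}

/-- A family of bounds for the degrees of the coefficients of power series, compatible with
products: `γ m ν` bounds the `ν`-th coefficient of a series of weight `m`. -/
structure IsGrowth (γ : ℕ → ℕ → ℕ) : Prop where
  mono : ∀ {m m' : ℕ} (ν : ℕ), m ≤ m' → γ m ν ≤ γ m' ν
  add_le : ∀ m m' i j : ℕ, γ m i + γ m' j ≤ γ (m + m') (i + j)

/-- The coefficients of `v` obey the degree bounds `γ m`. -/
def HasGrowth (γ : ℕ → ℕ → ℕ) (m : ℕ) (v : PowerSeries (MvPolynomial (Fin n) K)) : Prop :=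
  ∀ ν, (PowerSeries.coeff ν v).totalDegree ≤ γ m ν

namespace HasGrowth

variable {γ : ℕ → ℕ → ℕ} {m m' : ℕ} {v w : PowerSeries (MvPolynomial (Fin n) K)}

theorem add (hv : HasGrowth γ m v) (hw : HasGrowth γ m w) : HasGrowth γ m (v + w) := fun ν => by
  rw [map_add]
  exact (totalDegree_add _ _).trans (max_le (hv ν) (hw ν))

theorem sub (hv : HasGrowth γ m v) (hw : HasGrowth γ m w) : HasGrowth γ m (v - w) := fun ν => by
  rw [map_sub]
  exact (totalDegree_sub _ _).trans (max_le (hv ν) (hw ν))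

theorem sum {ι : Type*} (s : Finset ι) (v : ι → PowerSeries (MvPolynomial (Fin n) K))
    (h : ∀ i ∈ s, HasGrowth γ m (v i)) : HasGrowth γ m (∑ i ∈ s, v i) := fun ν => by
  rw [map_sum]
  exact totalDegree_finsetSum_le fun i hi => h i hi ν

theorem C {a : MvPolynomial (Fin n) K} (ha : a.totalDegree ≤ γ m 0) :
    HasGrowth γ m (PowerSeries.C a) := fun ν => by
  rw [PowerSeries.coeff_C]
  split_ifs with h
  · rwa [h]
  · simp

theorem one : HasGrowth γ m (1 : PowerSeries (MvPolynomial (Fin n) K)) := by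
  rw [← map_one PowerSeries.C]
  exact C (by simp)


end HasGrowth

variable {γ : ℕ → ℕ → ℕ} {m m' : ℕ} {v w : PowerSeries (MvPolynomial (Fin n) K)}

namespace IsGrowth

theorem hasGrowth_mono (hγ : IsGrowth γ) (hv : HasGrowth γ m v) (h : m ≤ m') :
    HasGrowth γ m' v := fun ν => (hv ν).trans (hγ.mono ν h)

theorem hasGrowth_mul (hγ : IsGrowth γ) (hv : HasGrowth γ m v) (hw : HasGrowth γ m' w) :
    HasGrowth γ (m + m') (v * w) := fun ν => by
  rw [PowerSeries.coeff_mul]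
  refine totalDegree_finsetSum_le fun ij hij => (totalDegree_mul _ _).trans ?_
  rw [← Finset.HasAntidiagonal.mem_antidiagonal.mp hij]
  exact (Nat.add_le_add (hv _) (hw _)).trans (hγ.add_le _ _ _ _)

theorem hasGrowth_pow (hγ : IsGrowth γ) (hv : HasGrowth γ m v) (k : ℕ) :
    HasGrowth γ (k * m) (v ^ k) := by
  induction k with
  | zero => rw [pow_zero]; exact HasGrowth.one
  | succ k ih =>
    rw [pow_succ, add_mul, one_mul]
    exact hγ.hasGrowth_mul ih hv

theorem hasGrowth_prod (hγ : IsGrowth γ) {ι : Type*} (s : Finset ι) (e : ι → ℕ)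
    (v : ι → PowerSeries (MvPolynomial (Fin n) K)) (h : ∀ i ∈ s, HasGrowth γ (e i) (v i)) :
    HasGrowth γ (∑ i ∈ s, e i) (∏ i ∈ s, v i) := by
  classical
  induction s using Finset.induction_on with
  | empty => simpa using HasGrowth.one
  | insert i s hi ih =>
    rw [Finset.sum_insert hi, Finset.prod_insert hi]
    exact hγ.hasGrowth_mul (h i (Finset.mem_insert_self _ _))
      (ih fun j hj => h j (Finset.mem_insert_of_mem hj))

theorem hasGrowth_aeval (hγ : IsGrowth γ) (Y : Fin n → PowerSeries (MvPolynomial (Fin n) K))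
    (hY : ∀ i, HasGrowth γ 1 (Y i)) (p : MvPolynomial (Fin n) K) :
    HasGrowth γ p.totalDegree (aeval Y p) := by
  rw [aeval_def, eval₂_eq]
  refine HasGrowth.sum _ _ fun s hs => ?_
  rw [← zero_add p.totalDegree]
  refine hγ.hasGrowth_mul (m := 0) ?_ ?_
  · rw [PowerSeries.algebraMap_apply, MvPolynomial.algebraMap_eq]
    exact HasGrowth.C (by simp)
  refine hγ.hasGrowth_mono ?_ (le_totalDegree hs)
  exact hγ.hasGrowth_prod _ _ _ fun i _ => by simpa using hγ.hasGrowth_pow (hY i) (s i)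

end IsGrowth

end Growth

/-! ### Expansions with coefficients in the coordinate ring -/

section DegreeBound

variable {n : ℕ} {f : MvPolynomial (Fin n) ℂ}

theorem classDegree_mk_le (g : MvPolynomial (Fin n) ℂ) :
    classDegree f (Ideal.Quotient.mk (Ideal.span {f}) g) ≤ g.totalDegree :=
  Nat.sInf_le ⟨g, rfl, rfl⟩

theorem hasAdicSum_adicEval {C : Type*} [CommRing C] (σ : C →+* Completion f)
    (b : PowerSeries C) : HasAdicSum f (fun ν => σ (PowerSeries.coeff ν b)) (adicEval σ b) :=
  fun N => evalₐ_adicEval σ b N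

theorem HasAdicSum.unique {x : ℕ → Completion f} {y z : Completion f} (hy : HasAdicSum f x y)
    (hz : HasAdicSum f x z) : y = z :=
  AdicCompletion.ext_evalₐ fun N => (hy N).trans (hz N).symm

/-- A homomorphism into `Â` that takes the values `∑ Y_iν f^ν` on the coordinates is given on a
polynomial `p` by the expansion `p (Y)`. -/
theorem map_eq_adicEval_aeval (φ : MvPolynomial (Fin n) ℂ →ₐ[ℂ] Completion f)
    (Y : Fin n → PowerSeries (MvPolynomial (Fin n) ℂ))
    (hY : ∀ i, φ (X i) = adicEval (algebraMap _ (Completion f)) (Y i))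
    (p : MvPolynomial (Fin n) ℂ) :
    φ p = adicEval (algebraMap _ (Completion f)) (aeval Y p) := by
  induction p using MvPolynomial.induction_on with
  | C a =>
    rw [aeval_C, PowerSeries.algebraMap_apply, MvPolynomial.algebraMap_eq, adicEval_C]
    exact φ.commutes a
  | add p q hp hq => simp only [map_add, hp, hq]
  | mul_X p i hp => simp only [map_mul, hp, hY, aeval_X]

theorem map_mk_eq_adicEval_aeval (ψ : CoordRing f →ₐ[ℂ] Completion f)
    (Y : Fin n → PowerSeries (MvPolynomial (Fin n) ℂ))
    (hY : ∀ i, ψ (Ideal.Quotient.mk (Ideal.span {f}) (X i)) =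
      adicEval (algebraMap _ (Completion f)) (Y i)) (p : MvPolynomial (Fin n) ℂ) :
    ψ (Ideal.Quotient.mk (Ideal.span {f}) p) =
      adicEval (algebraMap _ (Completion f)) (aeval Y p) :=
  map_eq_adicEval_aeval (ψ.comp (Ideal.Quotient.mkₐ ℂ (Ideal.span {f}))) Y hY p

theorem isGrowth_geometric {d : ℕ} (hd : 0 < d) (E : ℕ) :
    IsGrowth fun m ν => E * m * d ^ ν where
  mono ν h := by gcongr
  add_le m m' i j := by
    have h1 : d ^ i ≤ d ^ (i + j) := Nat.pow_le_pow_right hd (Nat.le_add_right i j)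
    have h2 : d ^ j ≤ d ^ (i + j) := Nat.pow_le_pow_right hd (Nat.le_add_left j i)
    calc E * m * d ^ i + E * m' * d ^ j ≤ E * m * d ^ (i + j) + E * m' * d ^ (i + j) := by gcongr
      _ = E * (m + m') * d ^ (i + j) := by ring

theorem totalDegree_le_of_mul {g h : MvPolynomial (Fin n) ℂ} (hg : g ≠ 0) :
    h.totalDegree ≤ (g * h).totalDegree := by
  by_cases hh : h = 0
  · simp [hh]
  · rw [totalDegree_mul_of_isDomain hg hh]
    exact Nat.le_add_left _ _

/-- The degrees in the expansion of `y = ∑ ψ (b_ν) f^ν` are controlled by those in an expansion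
`y = ∑ c_ν f^ν` with polynomial coefficients: the polynomial `c_0` represents `b_0`, and dividing
`y - ψ (b_0)` by `f` multiplies the degrees of the polynomial coefficients by at most `d E`. -/
theorem exists_mk_eq_coeff_totalDegree_le (hf : f ≠ 0) {d E : ℕ} (hd : 0 < d) (hE : 0 < E)
    (ψ : CoordRing f →ₐ[ℂ] Completion f)
    (hψ : ∀ b, AdicCompletion.evalOneₐ (Ideal.span {f}) (ψ b) = b)
    (Y : Fin n → PowerSeries (MvPolynomial (Fin n) ℂ))
    (hY : ∀ i, ψ (Ideal.Quotient.mk (Ideal.span {f}) (X i)) =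
      adicEval (algebraMap _ (Completion f)) (Y i))
    (hYd : ∀ i ν, (PowerSeries.coeff ν (Y i)).totalDegree ≤ d ^ ν * E)
    (k m : ℕ) (b : PowerSeries (CoordRing f)) (c : PowerSeries (MvPolynomial (Fin n) ℂ))
    (hbc : adicEval (ψ : CoordRing f →+* Completion f) b =
      adicEval (algebraMap _ (Completion f)) c)
    (hc : ∀ ν, (PowerSeries.coeff ν c).totalDegree ≤ m * d ^ ν) :
    ∃ g, Ideal.Quotient.mk (Ideal.span {f}) g = PowerSeries.coeff k b ∧
      g.totalDegree ≤ (d * E) ^ k * m := by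
  have hzero : ∀ (b : PowerSeries (CoordRing f)) (c : PowerSeries (MvPolynomial (Fin n) ℂ)),
      adicEval (ψ : CoordRing f →+* Completion f) b = adicEval (algebraMap _ (Completion f)) c →
      Ideal.Quotient.mk (Ideal.span {f}) (PowerSeries.coeff 0 c) = PowerSeries.coeff 0 b := by
    intro b c hbc
    have h1 := congrArg (AdicCompletion.evalOneₐ (Ideal.span {f})) hbc
    rw [evalOneₐ_adicEval, evalOneₐ_adicEval, AlgHom.commutes] at h1
    rw [← hψ (PowerSeries.coeff 0 b)]
    exact h1.symm
  induction k generalizing m b c with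
  | zero => exact ⟨_, hzero b c hbc, by simpa using hc 0⟩
  | succ k ih =>
    obtain ⟨b', hb, hbk⟩ := exists_eq_C_add_X_mul b
    set e := c - aeval Y (PowerSeries.coeff 0 c) with he
    have hgrowth : HasGrowth (fun m ν => E * m * d ^ ν) m e := by
      have hG := isGrowth_geometric hd E
      refine HasGrowth.sub (fun ν => (hc ν).trans ?_)
        (hG.hasGrowth_mono (hG.hasGrowth_aeval Y (fun i ν => ?_) _) ?_)
      · exact Nat.mul_le_mul_right _ (Nat.le_mul_of_pos_left m hE)
      · exact (hYd i ν).trans (le_of_eq (by ring))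
      · simpa using hc 0
    have hΦe : adicEval (algebraMap _ (Completion f)) e =
        uniformizer f * adicEval (ψ : CoordRing f →+* Completion f) b' := by
      rw [he, map_sub, ← map_mk_eq_adicEval_aeval ψ Y hY, hzero b c hbc, ← hbc]
      conv_lhs => rw [hb, adicEval_C_add_X_mul]
      simp
    obtain ⟨h, hh⟩ : f ∣ PowerSeries.coeff 0 e := by
      have h1 := congrArg (AdicCompletion.evalOneₐ (Ideal.span {f})) hΦe
      rw [map_mul, evalOneₐ_uniformizer, zero_mul, evalOneₐ_adicEval, AlgHom.commutes,
        Ideal.Quotient.algebraMap_eq, Ideal.Quotient.eq_zero_iff_mem] at h1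
      exact Ideal.mem_span_singleton.mp h1
    obtain ⟨r, hr, hrk⟩ := exists_eq_C_add_X_mul e
    have hb'c : adicEval (ψ : CoordRing f →+* Completion f) b' =
        adicEval (algebraMap _ (Completion f)) (PowerSeries.C h + r) := by
      refine uniformizer_mul_left_cancel hf ?_
      rw [← hΦe, hr, adicEval_C_add_X_mul, hh, map_mul, map_add, adicEval_C, ← uniformizer, mul_add]
    have hdeg : ∀ ν, (PowerSeries.coeff ν (PowerSeries.C h + r)).totalDegree ≤
        d * E * m * d ^ ν := by
      intro ν
      have hr' : (PowerSeries.coeff ν r).totalDegree ≤ d * E * m * d ^ ν := by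
        rw [hrk]
        refine (hgrowth (ν + 1)).trans (le_of_eq ?_)
        ring
      have hh' : h.totalDegree ≤ d * E * m := by
        refine (totalDegree_le_of_mul hf).trans ?_
        rw [← hh]
        refine (hgrowth 0).trans ?_
        change E * m * d ^ 0 ≤ d * E * m
        rw [pow_zero, mul_one, mul_assoc]
        exact Nat.le_mul_of_pos_left _ hd
      rw [map_add, PowerSeries.coeff_C]
      refine (totalDegree_add _ _).trans (max_le ?_ hr')
      split_ifs with hν
      · exact hh'.trans (Nat.le_mul_of_pos_right _ (pow_pos hd ν))
      · simp
    obtain ⟨g, hg, hgd⟩ := ih (d * E * m) b' (PowerSeries.C h + r) hb'c hdeg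
    exact ⟨g, by rw [hg, hbk], hgd.trans (le_of_eq (by ring))⟩

/-- For a bounded lift `ψ` every element of the completion has a unique expansion
`∑ ψ (b_ν) f^ν`, and the degrees of the `b_ν` belonging to a polynomial are bounded. -/
theorem IsBoundedLift.exists_ringEquiv (hd : 0 < f.totalDegree)
    {ψ : CoordRing f →ₐ[ℂ] Completion f} (hψ : IsBoundedLift f ψ) :
    ∃ ψhat : PowerSeries (CoordRing f) ≃+* Completion f,
      (∀ b : PowerSeries (CoordRing f),
        HasAdicSum f (fun ν => ψ (PowerSeries.coeff ν b)) (ψhat b)) ∧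
      ∀ (a : MvPolynomial (Fin n) ℂ) (ν : ℕ),
        classDegree f (PowerSeries.coeff ν
          (ψhat.symm (algebraMap (MvPolynomial (Fin n) ℂ) (Completion f) a))) ≤
          (2 * f.totalDegree ^ n + f.totalDegree) ^ ν * a.totalDegree := by
  have hf : f ≠ 0 := by rintro rfl; simp at hd
  have hn : n ≠ 0 := by
    rintro rfl
    rw [MvPolynomial.eq_C_of_isEmpty f, totalDegree_C] at hd
    exact lt_irrefl 0 hd
  choose c hc hcd using hψ.degree_le
  let ψhat : PowerSeries (CoordRing f) ≃+* Completion f :=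
    RingEquiv.ofBijective (adicEval (ψ : CoordRing f →+* Completion f))
      (adicEval_bijective hf _ hψ.lifts_id)
  refine ⟨ψhat, fun b => hasAdicSum_adicEval _ b, fun a ν => ?_⟩
  have hψa : adicEval (ψ : CoordRing f →+* Completion f)
      (ψhat.symm (algebraMap (MvPolynomial (Fin n) ℂ) (Completion f) a)) =
      adicEval (algebraMap (MvPolynomial (Fin n) ℂ) (Completion f)) (PowerSeries.C a) := by
    rw [adicEval_C]
    exact ψhat.apply_symm_apply _
  obtain ⟨g, hg, hgd⟩ := exists_mk_eq_coeff_totalDegree_le hf hd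
    (E := 2 * f.totalDegree ^ (n - 1) + 1) (Nat.succ_pos _) ψ hψ.lifts_id
    (fun i => PowerSeries.mk (c i))
    (fun i => (hc i).unique (by
      have := hasAdicSum_adicEval (algebraMap (MvPolynomial (Fin n) ℂ) (Completion f))
        (PowerSeries.mk (c i))
      simpa only [PowerSeries.coeff_mk] using this))
    (fun i ν => by simpa using hcd i ν) ν a.totalDegree _ _ hψa
    (fun ν => by
      rw [PowerSeries.coeff_C]
      split_ifs
      · exact Nat.le_mul_of_pos_right _ (pow_pos hd ν)
      · simp)
  rw [← hg]
  refine (classDegree_mk_le g).trans (hgd.trans (le_of_eq ?_))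
  congr 2
  obtain ⟨k, rfl⟩ := Nat.exists_eq_succ_of_ne_zero hn
  simp only [Nat.succ_eq_add_one, Nat.add_sub_cancel]
  ring

end DegreeBound

/-! ### The displaced equation and its solution -/

section FixedPoint

variable {R : Type*} [CommRing R]

/-- A self-map of the ring of power series that is contracting for the `X`-adic topology has a
fixed point, whose coefficients are those of the iterates. -/
theorem exists_fixedPoint_of_contracting (Θ : PowerSeries R → PowerSeries R)
    (hΘ : ∀ (a b : PowerSeries R) (n : ℕ), PowerSeries.X ^ n ∣ a - b →
      PowerSeries.X ^ (n + 1) ∣ Θ a - Θ b) :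
    ∃ v, Θ v = v ∧ ∀ ν, PowerSeries.coeff ν v = PowerSeries.coeff ν (Θ^[ν + 1] 0) := by
  have hstep : ∀ n, PowerSeries.X ^ n ∣ Θ^[n + 1] 0 - Θ^[n] 0 := by
    intro n
    induction n with
    | zero => simp
    | succ n ih =>
      rw [Function.iterate_succ_apply' Θ (n + 1), Function.iterate_succ_apply' Θ n]
      exact hΘ _ _ _ (by rwa [Function.iterate_succ_apply' Θ n] at ih)
  have hle : ∀ m n, m ≤ n → PowerSeries.X ^ m ∣ Θ^[n] 0 - Θ^[m] 0 := by
    intro m n h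
    induction n, h using Nat.le_induction with
    | base => simp
    | succ n h ih =>
      rw [← sub_add_sub_cancel _ (Θ^[n] 0)]
      exact dvd_add ((pow_dvd_pow _ h).trans (hstep n)) ih
  have hcoeff : ∀ a b : PowerSeries R, ∀ n, PowerSeries.X ^ n ∣ a - b ↔
      ∀ ν < n, PowerSeries.coeff ν a = PowerSeries.coeff ν b := by
    intro a b n
    rw [PowerSeries.X_pow_dvd_iff]
    simp only [map_sub, sub_eq_zero]
  let v : PowerSeries R := PowerSeries.mk fun ν => PowerSeries.coeff ν (Θ^[ν + 1] 0)
  have hv : ∀ n, PowerSeries.X ^ n ∣ v - Θ^[n] 0 := by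
    intro n
    rw [hcoeff]
    intro ν hν
    rw [PowerSeries.coeff_mk]
    exact ((hcoeff _ _ _).mp (hle (ν + 1) n hν) ν ν.lt_succ_self).symm
  refine ⟨v, ?_, fun ν => by rw [PowerSeries.coeff_mk]⟩
  ext ν
  have h1 := (hcoeff _ _ _).mp (hΘ _ _ _ (hv ν)) ν ν.lt_succ_self
  have h2 := (hcoeff _ _ _).mp (hv (ν + 1)) ν ν.lt_succ_self
  rw [h1, h2, Function.iterate_succ_apply']

end FixedPoint

section DisplacedEquation

variable {n : ℕ} (f : MvPolynomial (Fin n) ℂ) (g : Fin n → MvPolynomial (Fin n) ℂ)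

/-- The polynomial `f (X - g S)` in `S`. -/
noncomputable def displaced : Polynomial (MvPolynomial (Fin n) ℂ) :=
  aeval (fun i => Polynomial.C (X i) - Polynomial.C (g i) * Polynomial.X) f

/-- Taylor expansion to first order. -/
theorem X_sq_dvd_displaced_sub : Polynomial.X ^ 2 ∣ displaced f g -
    (Polynomial.C f - Polynomial.X * Polynomial.C (∑ i, g i * pderiv i f)) := by
  classical
  unfold displaced
  induction f using MvPolynomial.induction_on with
  | C a =>
    rw [aeval_C, Polynomial.algebraMap_apply, MvPolynomial.algebraMap_eq]
    simp
  | add p q hp hq =>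
    convert dvd_add hp hq using 1
    simp only [map_add, mul_add, Finset.sum_add_distrib]
    ring
  | mul_X p j hp =>
    obtain ⟨q, hq⟩ := hp
    have hsum : ∑ i, g i * pderiv i (p * X j) = (∑ i, g i * pderiv i p) * X j + p * g j := by
      simp only [pderiv_mul, pderiv_X, mul_add, Finset.sum_add_distrib, Finset.sum_mul]
      congr 1
      · exact Finset.sum_congr rfl fun i _ => by ring
      · rw [Finset.sum_eq_single j] <;> simp +contextual [mul_comm, eq_comm]
    rw [hsum, map_mul, aeval_X, map_add, map_mul, map_mul, map_mul]
    refine ⟨q * (Polynomial.C (X j) - Polynomial.C (g j) * Polynomial.X) +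
      Polynomial.C (∑ i, g i * pderiv i p) * Polynomial.C (g j), ?_⟩
    linear_combination (Polynomial.C (X j) - Polynomial.C (g j) * Polynomial.X) * hq

theorem coeff_zero_displaced : (displaced f g).coeff 0 = f := by
  have h := Polynomial.X_pow_dvd_iff.mp (X_sq_dvd_displaced_sub f g) 0 (by norm_num)
  simpa [sub_eq_zero] using h

theorem coeff_one_displaced : (displaced f g).coeff 1 = -∑ i, g i * pderiv i f := by
  have h := Polynomial.X_pow_dvd_iff.mp (X_sq_dvd_displaced_sub f g) 1 (by norm_num)
  simp only [Polynomial.coeff_sub, Polynomial.coeff_C_succ, zero_sub, Polynomial.coeff_X_mul,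
    Polynomial.coeff_C_zero, sub_neg_eq_add] at h
  exact eq_neg_of_add_eq_zero_left h

/-- Substitution of a power series `s` for `S` in `f (X - g S)`. -/
theorem aeval_sub_mul_eq_eval₂ (s : PowerSeries (MvPolynomial (Fin n) ℂ)) :
    aeval (fun i => PowerSeries.C (X i) - PowerSeries.C (g i) * s) f =
      (displaced f g).eval₂ PowerSeries.C s := by
  unfold displaced
  induction f using MvPolynomial.induction_on with
  | C a =>
    rw [aeval_C, aeval_C, Polynomial.algebraMap_apply, PowerSeries.algebraMap_apply,
      Polynomial.eval₂_C]
  | add p q hp hq => rw [map_add, map_add, Polynomial.eval₂_add, hp, hq]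
  | mul_X p i hp =>
    rw [map_mul, map_mul, Polynomial.eval₂_mul, hp, aeval_X, aeval_X, Polynomial.eval₂_sub,
      Polynomial.eval₂_mul, Polynomial.eval₂_C, Polynomial.eval₂_C, Polynomial.eval₂_X]

/-- Each power of `S` comes with a factor of degree at most `D`. -/
theorem totalDegree_coeff_displaced_le {D : ℕ} (hg : ∀ i, (g i).totalDegree ≤ D) (k : ℕ) :
    ((displaced f g).coeff k).totalDegree ≤ f.totalDegree + k * D := by
  have hγ : IsGrowth fun m ν => m + ν * D :=
    ⟨fun ν h => by gcongr, fun m m' i j => le_of_eq (by ring)⟩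
  have h1 := hγ.hasGrowth_aeval
    (fun i => PowerSeries.C (X i) - PowerSeries.C (g i) * PowerSeries.X) (fun i ν => ?_) f k
  · rwa [aeval_sub_mul_eq_eval₂, Polynomial.eval₂_C_X_eq_coe, Polynomial.coeff_coe] at h1
  · rcases ν with _ | _ | ν
    · simp [totalDegree_X]
    · have : (PowerSeries.coeff 1 (PowerSeries.C (g i) * PowerSeries.X)) = g i := by
        rw [PowerSeries.coeff_succ_mul_X, PowerSeries.coeff_zero_C]
      rw [zero_add, map_sub, this, PowerSeries.coeff_C, if_neg one_ne_zero, zero_sub,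
        totalDegree_neg]
      exact (hg i).trans (by simp)
    · simp [PowerSeries.coeff_succ_mul_X]

theorem aeval_sub_mul_eq_sum (s : PowerSeries (MvPolynomial (Fin n) ℂ)) :
    aeval (fun i => PowerSeries.C (X i) - PowerSeries.C (g i) * s) f =
      PowerSeries.C f - PowerSeries.C (∑ i, g i * pderiv i f) * s +
        ∑ k ∈ Finset.range (displaced f g).natDegree,
          PowerSeries.C ((displaced f g).coeff (k + 2)) * s ^ (k + 2) := by
  rw [aeval_sub_mul_eq_eval₂, Polynomial.eval₂_eq_sum_range' _ (n := (displaced f g).natDegree + 2)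
    (by omega), Finset.sum_range_succ', Finset.sum_range_succ', coeff_zero_displaced, zero_add,
    coeff_one_displaced, map_neg]
  ring

end DisplacedEquation

section Newton

variable {n : ℕ}

/-- Degree bounds `C ν` that do not depend on the weight. -/
theorem isGrowth_linear (C : ℕ) : IsGrowth fun _ ν => C * ν :=
  ⟨fun _ _ => le_rfl, fun _ _ i j => le_of_eq (by ring)⟩

/-- The equation `f (X - g T v) = (f - T) (1 - h T v)` has a solution `v` with coefficients of
linearly growing degrees, if `∑ g_i ∂_i f = 1 + h f`. -/
theorem exists_newton_series (f : MvPolynomial (Fin n) ℂ) (g : Fin n → MvPolynomial (Fin n) ℂ)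
    (h : MvPolynomial (Fin n) ℂ) {D : ℕ} (hg : ∀ i, (g i).totalDegree ≤ D)
    (hh : h.totalDegree ≤ D) (hgh : ∑ i, g i * pderiv i f = 1 + h * f) :
    ∃ v : PowerSeries (MvPolynomial (Fin n) ℂ),
      (∀ ν, (PowerSeries.coeff ν v).totalDegree ≤ (2 * D + f.totalDegree) * ν) ∧
      aeval (fun i => PowerSeries.C (X i) - PowerSeries.C (g i) * (PowerSeries.X * v)) f =
        (PowerSeries.C f - PowerSeries.X) * (1 - PowerSeries.C h * (PowerSeries.X * v)) := by
  set N := (displaced f g).natDegree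
  set q := fun k => (displaced f g).coeff (k + 2) with hq
  set c := 2 * D + f.totalDegree with hc
  have hγ := isGrowth_linear c
  -- the equation reads `v = 1 + T Q(v)`
  let Q : Polynomial (PowerSeries (MvPolynomial (Fin n) ℂ)) :=
    ∑ k ∈ Finset.range N,
        Polynomial.C (PowerSeries.C (q k) * PowerSeries.X ^ k) * Polynomial.X ^ (k + 2) -
      Polynomial.C (PowerSeries.C h) * Polynomial.X
  have hQ : ∀ v, Q.eval v = ∑ k ∈ Finset.range N,
      PowerSeries.C (q k) * PowerSeries.X ^ k * v ^ (k + 2) - PowerSeries.C h * v := by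
    intro v
    simp [Q, Polynomial.eval_finsetSum]
  obtain ⟨v, hv, hvν⟩ := exists_fixedPoint_of_contracting (fun v => 1 + PowerSeries.X * Q.eval v)
    (by
      intro a b n hab
      rw [add_sub_add_left_eq_sub, ← mul_sub, pow_succ']
      exact mul_dvd_mul_left _ (hab.trans (Polynomial.sub_dvd_eval_sub a b Q)))
  have hCX : ∀ (p : MvPolynomial (Fin n) ℂ) (k : ℕ), p.totalDegree ≤ c * k →
      HasGrowth (fun _ ν => c * ν) 0 (PowerSeries.C p * PowerSeries.X ^ k) := by
    intro p k hp ν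
    rw [PowerSeries.coeff_C_mul_X_pow]
    split_ifs with h
    · rwa [h]
    · simp
  -- the map preserves the degree bounds: `q_k X^(k+1)` obeys them as `f.totalDegree + (k + 2) * D`
  -- is at most `c * (k + 1)`
  have hstep : ∀ w, HasGrowth (fun _ ν => c * ν) 0 w →
      HasGrowth (fun _ ν => c * ν) 0 (1 + PowerSeries.X * Q.eval w) := by
    intro w hw
    rw [hQ, mul_sub, Finset.mul_sum]
    refine HasGrowth.one.add (HasGrowth.sub (HasGrowth.sum _ _ fun k _ => ?_) ?_)
    · have h1 := hγ.hasGrowth_mul (hCX (q k) (k + 1) ?_) (hγ.hasGrowth_pow hw (k + 2))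
      · intro ν
        convert h1 ν using 3
        ring
      · refine (totalDegree_coeff_displaced_le f g hg (k + 2)).trans ?_
        rw [hc]
        nlinarith [Nat.zero_le (k * f.totalDegree), Nat.zero_le (k * D)]
    · have h1 := hγ.hasGrowth_mul (hCX h 1 (by omega)) hw
      intro ν
      convert h1 ν using 3
      ring
  refine ⟨v, fun ν => ?_, ?_⟩
  · rw [hvν]
    have : ∀ k, HasGrowth (fun _ ν => c * ν) 0 ((fun v => 1 + PowerSeries.X * Q.eval v)^[k] 0) := by
      intro k
      induction k with
      | zero => intro ν; simp
      | succ k ih => rw [Function.iterate_succ_apply']; exact hstep _ ih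
    exact this _ ν
  · have h1 : 1 + PowerSeries.X * (∑ k ∈ Finset.range N,
        PowerSeries.C (q k) * PowerSeries.X ^ k * v ^ (k + 2) - PowerSeries.C h * v) = v := by
      rw [← hQ]
      exact hv
    have h2 : ∑ k ∈ Finset.range N, PowerSeries.C (q k) * (PowerSeries.X * v) ^ (k + 2) =
        PowerSeries.X ^ 2 * ∑ k ∈ Finset.range N,
          PowerSeries.C (q k) * PowerSeries.X ^ k * v ^ (k + 2) := by
      rw [Finset.mul_sum]
      exact Finset.sum_congr rfl fun k _ => by ring
    rw [aeval_sub_mul_eq_sum, hgh, h2, map_add, map_one, map_mul]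
    linear_combination PowerSeries.X * h1

end Newton

/-! ### The bounded lift -/

section Lift

variable {n : ℕ} {f : MvPolynomial (Fin n) ℂ}

/-- For `D = 2 d^n - d` and `k = 2 d^(n-1) + 1`, the bound for the degree of `g_i v_ν` is at most
the one required of the coefficient of index `ν + 1`. -/
theorem lift_degree_le {d D k : ℕ} (hd : 3 ≤ d) (hD : d * k = D + 2 * d) (ν : ℕ) :
    D + (2 * D + d) * ν ≤ d ^ (ν + 1) * k := by
  have h1 : 2 * ν + 1 ≤ d ^ ν := by
    calc 2 * ν + 1 ≤ 3 ^ ν := by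
          induction ν with
          | zero => simp
          | succ ν ih => rw [pow_succ]; omega
      _ ≤ d ^ ν := Nat.pow_le_pow_left hd ν
  calc D + (2 * D + d) * ν ≤ (2 * ν + 1) * (D + 2 * d) := by nlinarith [Nat.zero_le (ν * d)]
    _ ≤ d ^ ν * (d * k) := by rw [hD]; exact Nat.mul_le_mul_right _ h1
    _ = d ^ (ν + 1) * k := by ring

/-- A smooth hypersurface admits a bounded lift: the points `X_i` are moved along the direction
`g` with `∑ g_i ∂_i f = 1 + h f` to a solution `Y` of the equation `f = 0`. -/
theorem IsSmoothHypersurface.exists_isBoundedLift (hf : IsSmoothHypersurface f)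
    (hd : 3 ≤ f.totalDegree) :
    ∃ ψ : CoordRing f →ₐ[ℂ] Completion f, Function.Injective ψ ∧ IsBoundedLift f ψ := by
  have hf0 : f ≠ 0 := by rintro rfl; simp at hd
  have hn : n ≠ 0 := by
    rintro rfl
    rw [MvPolynomial.eq_C_of_isEmpty f, totalDegree_C] at hd
    omega
  set d := f.totalDegree with hdef
  obtain ⟨g, hg, h, hh⟩ := hf.exists_sum_pderiv_sub_one f (by omega)
  rw [← hdef] at hg
  set D := 2 * d ^ n - d with hD
  have hhd : h.totalDegree ≤ D := by
    by_cases h0 : h = 0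
    · simp [h0]
    have h1 : (f * h).totalDegree ≤ D + d := by
      rw [← hh]
      refine (totalDegree_sub _ _).trans (max_le (totalDegree_finsetSum_le fun j _ => ?_) (by simp))
      exact (totalDegree_mul _ _).trans (Nat.add_le_add (hg j) (totalDegree_pderiv_le j f))
    rw [totalDegree_mul_of_isDomain hf0 h0] at h1
    omega
  obtain ⟨v, hv, hvf⟩ := exists_newton_series f g h hg hhd (by linear_combination hh)
  let Y : Fin n → PowerSeries (MvPolynomial (Fin n) ℂ) := fun i =>
    PowerSeries.C (X i) - PowerSeries.C (g i) * (PowerSeries.X * v)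
  let Φ := adicEval (algebraMap (MvPolynomial (Fin n) ℂ) (Completion f))
  let φ : MvPolynomial (Fin n) ℂ →ₐ[ℂ] Completion f := aeval fun i => Φ (Y i)
  have hφ : ∀ p, φ p = Φ (aeval Y p) := map_eq_adicEval_aeval φ Y fun i => aeval_X _ i
  have hφf : φ f = 0 := by
    rw [hφ, hvf, map_mul, map_sub]
    -- the factor `f - T` of `f (Y)` is mapped to `0`
    have h1 : Φ (PowerSeries.C f) = Φ PowerSeries.X := by
      rw [adicEval_C, adicEval_X]
      rfl
    rw [h1, sub_self, zero_mul]
  let ψ : CoordRing f →ₐ[ℂ] Completion f := Ideal.Quotient.liftₐ (Ideal.span {f}) φ (by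
    intro a ha
    obtain ⟨b, rfl⟩ := Ideal.mem_span_singleton.mp ha
    rw [map_mul, hφf, zero_mul])
  have hψ : ∀ p, ψ (Ideal.Quotient.mk _ p) = φ p := fun p => Ideal.Quotient.liftₐ_apply _ _ _ _
  have hY0 : ∀ i, PowerSeries.coeff 0 (Y i) = X i := by
    intro i
    simp [Y]
  have hY1 : ∀ i ν, PowerSeries.coeff (ν + 1) (Y i) = -(g i * PowerSeries.coeff ν v) := by
    intro i ν
    simp [Y, PowerSeries.coeff_succ_X_mul]
  have hid : ∀ b : CoordRing f, AdicCompletion.evalOneₐ (Ideal.span {f}) (ψ b) = b := by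
    have h1 : ((AdicCompletion.evalOneₐ (Ideal.span {f})).restrictScalars ℂ).comp φ =
        Ideal.Quotient.mkₐ ℂ (Ideal.span {f}) := by
      refine MvPolynomial.algHom_ext fun i => ?_
      change AdicCompletion.evalOneₐ (Ideal.span {f}) (φ (X i)) = _
      rw [aeval_X, evalOneₐ_adicEval, hY0, AlgHom.commutes]
      rfl
    intro b
    obtain ⟨p, rfl⟩ := Ideal.Quotient.mk_surjective b
    rw [hψ]
    exact DFunLike.congr_fun h1 p
  refine ⟨ψ, Function.LeftInverse.injective hid, hid, fun i => ⟨fun ν => PowerSeries.coeff ν (Y i),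
    ?_, fun ν => ?_⟩⟩
  · rw [hψ, aeval_X]
    exact hasAdicSum_adicEval _ _
  · rcases ν with _ | ν
    · change (PowerSeries.coeff 0 (Y i)).totalDegree ≤ d ^ 0 * (2 * d ^ (n - 1) + 1)
      rw [hY0, totalDegree_X]
      simp
    · change (PowerSeries.coeff (ν + 1) (Y i)).totalDegree ≤
        d ^ (ν + 1) * (2 * d ^ (n - 1) + 1)
      rw [hY1, totalDegree_neg]
      refine ((totalDegree_mul _ _).trans (Nat.add_le_add (hg i) (hv ν))).trans
        (lift_degree_le hd ?_ ν)
      obtain ⟨k, rfl⟩ := Nat.exists_eq_succ_of_ne_zero hn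
      rw [Nat.succ_eq_add_one] at hD
      have h1 : d ≤ 2 * d ^ (k + 1) := by
        have := Nat.le_self_pow (Nat.succ_ne_zero k) d
        omega
      have h2 : d * (2 * d ^ (k + 1 - 1) + 1) = 2 * d ^ (k + 1) + d := by
        rw [Nat.add_sub_cancel]
        ring
      rw [Nat.succ_eq_add_one, h2]
      omega

end Lift

end HypersurfaceCompletion

theorem mainTheorem3 (n : ℕ) (f : MvPolynomial (Fin n) ℂ) (hsq : Squarefree f)
    (hsmooth : HypersurfaceCompletion.IsSmoothHypersurface f) (hd : 3 ≤ f.totalDegree) :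
    (∃ ψ : HypersurfaceCompletion.CoordRing f →ₐ[ℂ] HypersurfaceCompletion.Completion f,
      Function.Injective ψ ∧ HypersurfaceCompletion.IsBoundedLift f ψ) ∧
    ∀ ψ : HypersurfaceCompletion.CoordRing f →ₐ[ℂ] HypersurfaceCompletion.Completion f,
      HypersurfaceCompletion.IsBoundedLift f ψ →
      ∃ ψhat : PowerSeries (HypersurfaceCompletion.CoordRing f) ≃+*
          HypersurfaceCompletion.Completion f,
        (∀ b : PowerSeries (HypersurfaceCompletion.CoordRing f),
          HypersurfaceCompletion.HasAdicSum f (fun ν => ψ (PowerSeries.coeff ν b)) (ψhat b)) ∧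
        ∀ (a : MvPolynomial (Fin n) ℂ) (ν : ℕ),
          HypersurfaceCompletion.classDegree f
            (PowerSeries.coeff ν
              (ψhat.symm (algebraMap (MvPolynomial (Fin n) ℂ)
                (HypersurfaceCompletion.Completion f) a))) ≤
            (2 * f.totalDegree ^ n + f.totalDegree) ^ ν * a.totalDegree := by
  exact ⟨hsmooth.exists_isBoundedLift hd, fun _ hψ => hψ.exists_ringEquiv (by omega)⟩
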